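/- Let $k$ be a commutative ring. A DG category is a category whose $\mathrm{Hom}$'s are complexes of $k$-modules (cohomological grading, $d$ of degree $1$) with composition given by morphisms of complexes; write $\mathrm{Ext}^n_{\mathcal C}(X,Y)=H^n(\mathrm{Hom}_{\mathcal C}(X,Y))$. Let $\mathcal K$ be the DG category with two objects $X_1,X_2$ which, as a graded $k$-category, is freely generated by morphisms $f:X_1\to X_2$ and $g:X_2\to X_1$ of degree $0$, $\alpha_i:X_i\to X_i$ ($i=1,2$) of degree $-1$ and $u:X_1\to X_2$ of degree $-2$, with the differential determined by $$df=dg=0,\quad d\alpha_1=gf-1,\quad d\alpha_2=fg-1,\quad du=f\alpha_1-\alpha_2f .$$ Let $\mathbf I_2$ be the $k$-linearization, viewed as a DG category concentrated in degree $0$, of the category $\mathbf J_2$ with two objects $X_1,X_2$ and precisely one morphism with any given source and target. Let $\mathcal A_0$ be the DG category with objects $X_1,X_2$ freely generated by one morphism $f:X_1\to X_2$ of degree $0$ with $df=0$; let $\mathcal A=\mathcal A_0^{\text{pre-tr}}$ be the DG category of one-sided twisted complexes over $\mathcal A_0$, and let $\mathcal B\subset\mathcal A$ be the full DG subcategory with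 the single object $\mathrm{Cone}(f)$. Let $\mathcal A/\mathcal B$ be the DG category obtained from $\mathcal A$ by freely adding a morphism $\varepsilon:\mathrm{Cone}(f)\to\mathrm{Cone}(f)$ of degree $-1$ with $d\varepsilon=\mathrm{id}$. Then: 1. $\mathcal K$ is a resolution of $\mathbf I_2$: the DG category $\mathcal K$ is semi-free, and there is a DG functor $\mathcal K\to\mathbf I_2$, identical on objects and sending $f$ and $g$ to the morphisms $X_1\to X_2$ and $X_2\to X_1$ of $\mathbf J_2$, which is a quasi-equivalence (i.e. it induces isomorphisms on the cohomology of all $\mathrm{Hom}$ complexes and is essentially surjective on homotopy categories). 2. There is a fully faithful DG functor $\mathcal K\to\mathcal A/\mathcal B$ with $X_i\mapsto X_i$ and $f\mapsto f$ (bijective on each $\mathrm{Hom}$ complex); so $\mathcal K$ is identified with the full DG subcategory of $\mathcal A/\mathcal B$ with objects $X_1$ and $X_2$. 3. $\mathrm{Ext}^n_{\mathcal A/\mathcal B}(X_i,X_j)=0$ for all $i,j\in\{1,2\}$ and all $n\neq 0$; $\mathrm{Ext}^0_{\mathcal A/\mathcal B}(X_i,X_i)$ is the free $k$-module generated by the class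 of $\mathrm{id}_{X_i}$; the class of $f$ is invertible in the homotopy category of $\mathcal A/\mathcal B$, and $\mathrm{Ext}^0_{\mathcal A/\mathcal B}(X_1,X_2)$ and $\mathrm{Ext}^0_{\mathcal A/\mathcal B}(X_2,X_1)$ are free $k$-modules generated by the classes of $f$ and $f^{-1}$ respectively. -/

import Mathlib

universe u v w u' v' g

noncomputable section

namespace DG

/-- The sign `(-1)^n` as an element of the ground ring `k`. -/
def sgn (k : Type w) [CommRing k] (n : ℤ) : k := ((n.negOnePow : ℤ) : k)

section sgn
variable (k : Type w) [CommRing k]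

@[simp] theorem sgn_zero : sgn k 0 = 1 := by simp [sgn]
@[simp] theorem sgn_neg_one : sgn k (-1) = -1 := by simp [sgn]
theorem sgn_add (m n : ℤ) : sgn k (m + n) = sgn k m * sgn k n := by
  simp [sgn, Int.negOnePow_add]
theorem sgn_succ (m : ℤ) : sgn k (m + 1) = - sgn k m := by
  simp [sgn, Int.negOnePow_succ]
@[simp] theorem sgn_mul_self (m : ℤ) : sgn k m * sgn k m = 1 := by
  rw [← sgn_add]; simp [sgn]
theorem sgn_sub (m n : ℤ) : sgn k (m - n) = sgn k m * sgn k n := by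
  simp [sgn, Int.negOnePow_sub]

end sgn

/-- A `ℤ`-graded `k`-category. `Hom X Y n` is the module of morphisms `X → Y` of degree `n`;
`comp h g f` is the composite `g ∘ f`. -/
structure GrCat (k : Type w) [CommRing k] where
  Obj : Type u
  Hom : Obj → Obj → ℤ → Type v
  [addCommGroup : ∀ X Y n, AddCommGroup (Hom X Y n)]
  [module : ∀ X Y n, Module k (Hom X Y n)]
  id : ∀ X, Hom X X 0
  comp : ∀ {X Y Z : Obj} {p q n : ℤ}, p + q = n → (Hom Y Z p →ₗ[k] Hom X Y q →ₗ[k] Hom X Z n)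
  id_comp : ∀ {X Y : Obj} {n : ℤ} (h : 0 + n = n) (f : Hom X Y n), comp h (id Y) f = f
  comp_id : ∀ {X Y : Obj} {n : ℤ} (h : n + 0 = n) (f : Hom X Y n), comp h f (id X) = f
  assoc : ∀ {W X Y Z : Obj} {p q r s t n : ℤ} (hpq : p + q = s) (hqr : q + r = t)
    (hs : s + r = n) (ht : p + t = n) (c : Hom Y Z p) (b : Hom X Y q) (a : Hom W X r),
    comp hs (comp hpq c b) a = comp ht c (comp hqr b a)

attribute [instance] GrCat.addCommGroup GrCat.module

/-- A DG category over `k`. -/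
structure DGCat (k : Type w) [CommRing k] extends GrCat.{u, v, w} k where
  d : ∀ {X Y : Obj} {m n : ℤ}, m + 1 = n → (Hom X Y m →ₗ[k] Hom X Y n)
  d_d : ∀ {X Y : Obj} {l m n : ℤ} (h : l + 1 = m) (h' : m + 1 = n) (f : Hom X Y l),
    d h' (d h f) = 0
  leibniz : ∀ {X Y Z : Obj} {p q n p' q' n' : ℤ} (h : p + q = n) (hn : n + 1 = n')
    (hp : p + 1 = p') (hq : q + 1 = q') (hl : p' + q = n') (hr : p + q' = n')
    (b : Hom Y Z p) (a : Hom X Y q),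
    d hn (comp h b a) = comp hl (d hp b) a + sgn k p • comp hr b (d hq a)

section basic
variable {k : Type w} [CommRing k]

/-- Transport of morphisms along an equality of degrees. -/
def GrCat.castDeg (A : GrCat.{u, v, w} k) {X Y : A.Obj} {m n : ℤ} (h : m = n) :
    A.Hom X Y m →ₗ[k] A.Hom X Y n :=
  h ▸ LinearMap.id

variable (A : DGCat.{u, v, w} k)

/-- Closed morphisms of degree `n`. -/
def DGCat.cocycles (X Y : A.Obj) (n : ℤ) : Submodule k (A.Hom X Y n) :=
  LinearMap.ker (A.d (X := X) (Y := Y) (rfl : n + 1 = n + 1))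

/-- Exact morphisms of degree `n`. -/
def DGCat.coboundaries (X Y : A.Obj) (n : ℤ) : Submodule k (A.Hom X Y n) :=
  LinearMap.range (A.d (X := X) (Y := Y) (sub_add_cancel n 1))

/-- `Ext^n(X, Y)`: the `n`-th cohomology of the complex `Hom(X, Y)`. -/
abbrev DGCat.Ext (X Y : A.Obj) (n : ℤ) : Type v :=
  A.cocycles X Y n ⧸ (A.coboundaries X Y n).submoduleOf (A.cocycles X Y n)

/-- The class in `Ext^n(X, Y)` of a closed morphism. -/
def DGCat.cls {X Y : A.Obj} {n : ℤ} (f : A.cocycles X Y n) : A.Ext X Y n :=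
  Submodule.Quotient.mk f

/-- `f : X → Y` and `g : Y → X` are closed of degree `0` and represent mutually inverse
morphisms of the homotopy category. -/
structure DGCat.IsHoInverse {X Y : A.Obj} (f : A.Hom X Y 0) (g : A.Hom Y X 0) : Prop where
  closed_left : f ∈ A.cocycles X Y 0
  closed_right : g ∈ A.cocycles Y X 0
  left : A.comp (add_zero 0) g f - A.id X ∈ A.coboundaries X X 0
  right : A.comp (add_zero 0) f g - A.id Y ∈ A.coboundaries Y Y 0

/-- A DG functor from `A` to `B` with the map `φ` on objects. -/
structure DGFunctor (A : DGCat.{u, v, w} k) (B : DGCat.{u', v', w} k) (φ : A.Obj → B.Obj) where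
  map : ∀ {X Y : A.Obj} (n : ℤ), A.Hom X Y n →ₗ[k] B.Hom (φ X) (φ Y) n
  map_id : ∀ X : A.Obj, map 0 (A.id X) = B.id (φ X)
  map_comp : ∀ {X Y Z : A.Obj} {p q n : ℤ} (h : p + q = n) (b : A.Hom Y Z p) (a : A.Hom X Y q),
    map n (A.comp h b a) = B.comp h (map p b) (map q a)
  map_d : ∀ {X Y : A.Obj} {m n : ℤ} (h : m + 1 = n) (f : A.Hom X Y m),
    map n (A.d h f) = B.d h (map m f)

variable {A} {B : DGCat.{u', v', w} k} {φ : A.Obj → B.Obj}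

theorem DGFunctor.cocycles_le (F : DGFunctor A B φ) (X Y : A.Obj) (n : ℤ) :
    A.cocycles X Y n ≤ (B.cocycles (φ X) (φ Y) n).comap (F.map n) := by
  intro f hf
  have hf' : A.d (rfl : n + 1 = n + 1) f = 0 := hf
  change B.d (rfl : n + 1 = n + 1) (F.map n f) = 0
  rw [← F.map_d, hf', map_zero]

/-- The map induced by a DG functor on closed morphisms. -/
def DGFunctor.mapCocycles (F : DGFunctor A B φ) (X Y : A.Obj) (n : ℤ) :
    A.cocycles X Y n →ₗ[k] B.cocycles (φ X) (φ Y) n :=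
  (F.map n).restrict (F.cocycles_le X Y n)

/-- The map induced by a DG functor on cohomology. -/
def DGFunctor.mapExt (F : DGFunctor A B φ) (X Y : A.Obj) (n : ℤ) :
    A.Ext X Y n →ₗ[k] B.Ext (φ X) (φ Y) n :=
  Submodule.mapQ _ _ (F.mapCocycles X Y n) (by
    rintro ⟨f, hf⟩ ⟨a, ha⟩
    refine ⟨F.map (n - 1) a, ?_⟩
    rw [← F.map_d, ha]
    rfl)

/-- A DG functor is fully faithful if it is bijective on morphisms. -/
def DGFunctor.FullyFaithful (F : DGFunctor A B φ) : Prop :=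
  ∀ (X Y : A.Obj) (n : ℤ), Function.Bijective (F.map (X := X) (Y := Y) n)

/-- Quasi-equivalence: fully faithful on graded homotopy categories and essentially surjective
on homotopy categories. -/
structure DGFunctor.IsQuasiEquivalence (F : DGFunctor A B φ) : Prop where
  fullyFaithful : ∀ (X Y : A.Obj) (n : ℤ), Function.Bijective (F.mapExt X Y n)
  essSurj : ∀ Z : B.Obj, ∃ (X : A.Obj) (a : B.Hom (φ X) Z 0) (b : B.Hom Z (φ X) 0),
    B.IsHoInverse a b

/-- `x` is a free generator of the `k`-module `M`. -/
def IsFreeGenerator (k : Type w) [CommRing k] {M : Type v} [AddCommGroup M] [Module k M]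
    (x : M) : Prop :=
  Function.Bijective fun c : k => c • x

end basic

/-! ### Words in a family of arrows -/

/-- Words (paths) in a family of arrows `E`; `cons e p` is the composite `e ∘ p`. -/
inductive Word {V : Type u} (E : V → V → Type g) (a : V) : V → Type (max u g)
  | nil : Word E a a
  | cons {b c : V} (e : E b c) (p : Word E a b) : Word E a c

namespace Word
variable {V : Type u} {E : V → V → Type g}

/-- The composite word `q ∘ p`. -/
def comp {a b : V} (p : Word E a b) : ∀ {c : V}, Word E b c → Word E a c
  | _, nil => p
  | _, cons e q => cons e (comp p q)

/-- The degree of a word, given the degrees of the arrows. -/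
def deg (δ : ∀ a b : V, E a b → ℤ) {a : V} : ∀ {b : V}, Word E a b → ℤ
  | _, nil => 0
  | _, cons e p => δ _ _ e + deg δ p

/-- All the arrows of the word have level less than `N`. -/
def LevelLT (lev : ∀ a b : V, E a b → ℕ) (N : ℕ) {a : V} : ∀ {b : V}, Word E a b → Prop
  | _, nil => True
  | _, cons e p => lev _ _ e < N ∧ LevelLT lev N p

theorem nil_comp {a b : V} (q : Word E a b) : comp nil q = q := by
  induction q with
  | nil => rfl
  | cons e q ih => simp [comp, ih]

theorem comp_assoc {a b c d : V} (p : Word E a b) (q : Word E b c) (r : Word E c d) :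
    comp (comp p q) r = comp p (comp q r) := by
  induction r with
  | nil => rfl
  | cons e r ih => simp [comp, ih]

theorem deg_comp (δ : ∀ a b : V, E a b → ℤ) {a b c : V} (p : Word E a b) (q : Word E b c) :
    deg δ (comp p q) = deg δ p + deg δ q := by
  induction q with
  | nil => simp [comp, deg]
  | cons e q ih => simp only [comp, deg, ih]; ring

end Word

/-- The category of words. -/
abbrev wordCat {V : Type u} (E : V → V → Type g) : CategoryTheory.Category.{max u g} V where
  Hom a b := Word E a b
  id _ := Word.nil
  comp p q := Word.comp p q
  id_comp := Word.nil_comp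
  comp_id _ := rfl
  assoc := Word.comp_assoc

/-! ### Graded linearization of a category -/

section lin
variable (k : Type w) [CommRing k] {V : Type u} (C : CategoryTheory.Category.{v} V)
  (deg : ∀ X Y : V, C.Hom X Y → ℤ)
  (deg_comp : ∀ (X Y Z : V) (f : C.Hom X Y) (g : C.Hom Y Z),
    deg X Z (C.comp f g) = deg X Y f + deg Y Z g)

/-- The bilinear extension of the composition of a category. -/
def linComp {X Y Z : V} {p q n : ℤ} (h : p + q = n) :
    ({f : C.Hom Y Z // deg _ _ f = p} →₀ k) →ₗ[k] ({f : C.Hom X Y // deg _ _ f = q} →₀ k) →ₗ[k]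
      ({f : C.Hom X Z // deg _ _ f = n} →₀ k) :=
  Finsupp.lift _ k _ fun b =>
    Finsupp.lmapDomain k k fun a : {f : C.Hom X Y // deg _ _ f = q} =>
      ⟨C.comp a.1 b.1, by rw [deg_comp, a.2, b.2, ← h, add_comm]⟩

theorem linComp_single {X Y Z : V} {p q n : ℤ} (h : p + q = n)
    (b : {f : C.Hom Y Z // deg _ _ f = p}) (a : {f : C.Hom X Y // deg _ _ f = q}) (y x : k) :
    linComp k C deg deg_comp h (Finsupp.single b y) (Finsupp.single a x) =
      Finsupp.single ⟨C.comp a.1 b.1, by rw [deg_comp, a.2, b.2, ← h, add_comm]⟩ (y * x) := by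
  simp [linComp, Finsupp.lmapDomain_apply, Finsupp.mapDomain_single]

/-- The `k`-linearization of a category whose morphisms carry an additive degree: the morphisms
of degree `n` of the category form a basis of the module of morphisms of degree `n`. -/
def GrCat.lin (deg_id : ∀ X, deg X X (C.id X) = 0) : GrCat.{u, max v w, w} k where
  Obj := V
  Hom X Y n := {f : C.Hom X Y // deg _ _ f = n} →₀ k
  id X := Finsupp.single ⟨C.id X, deg_id X⟩ 1
  comp h := linComp k C deg deg_comp h
  id_comp h f := by
    induction f using Finsupp.induction_linear with
    | zero => simp
    | add f g hf hg => rw [map_add, hf, hg]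
    | single a c => simp [linComp_single, C.comp_id]
  comp_id h f := by
    induction f using Finsupp.induction_linear with
    | zero => simp
    | add f g hf hg => rw [map_add, LinearMap.add_apply, hf, hg]
    | single a c => simp [linComp_single, C.id_comp]
  assoc hpq hqr hs ht c b a := by
    induction a using Finsupp.induction_linear with
    | zero => simp
    | add f g hf hg => rw [map_add, map_add, map_add, hf, hg]
    | single a x =>
      induction b using Finsupp.induction_linear with
      | zero => simp
      | add f g hf hg =>
        rw [map_add, map_add, map_add, LinearMap.add_apply, LinearMap.add_apply, map_add, hf, hg]
      | single b y =>
        induction c using Finsupp.induction_linear with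
        | zero => simp
        | add f g hf hg =>
          rw [map_add, map_add, LinearMap.add_apply, LinearMap.add_apply, map_add,
            LinearMap.add_apply, hf, hg]
        | single c z => simp only [linComp_single, C.assoc, mul_assoc]

/-- The `k`-category generated by a category, as a DG category concentrated in degree `0`. -/
def DGCat.lin : DGCat.{u, max v w, w} k where
  toGrCat := GrCat.lin k C (fun _ _ _ => 0) (fun _ _ _ _ _ => rfl) (fun _ => rfl)
  d _ := 0
  d_d _ _ _ := rfl
  leibniz _ _ _ _ _ _ _ _ := by simp

end lin

/-! ### Free DG categories -/

section free
variable (k : Type w) [CommRing k] {V : Type u} {E : V → V → Type g} (δ : ∀ a b : V, E a b → ℤ)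

/-- The graded `k`-category freely generated by a family `E` of arrows of degrees `δ`:
words form a basis of the morphisms. -/
def GrCat.free : GrCat.{u, max u g w, w} k :=
  GrCat.lin k (wordCat E) (fun _ _ => Word.deg δ) (fun _ _ _ => Word.deg_comp δ) (fun _ => rfl)

/-- The morphisms of degree `n` of the free graded category. -/
abbrev FreeHom (a b : V) (n : ℤ) : Type (max u g w) :=
  {p : Word E a b // Word.deg δ p = n} →₀ k

/-- A word as a morphism of the free graded category. -/
def word {a b : V} (p : Word E a b) {n : ℤ} (h : Word.deg δ p = n) : FreeHom k δ a b n :=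
  Finsupp.single ⟨p, h⟩ 1

/-- Composition in the free graded category. -/
def freeComp {a b c : V} {p q n : ℤ} (h : p + q = n) :
    FreeHom k δ b c p →ₗ[k] FreeHom k δ a b q →ₗ[k] FreeHom k δ a c n :=
  (GrCat.free k δ).comp h

variable {k δ}

theorem freeComp_word {a b c : V} (q : Word E b c) (p : Word E a b) {l m n : ℤ}
    (hq : Word.deg δ q = l) (hp : Word.deg δ p = m) (h : l + m = n) :
    freeComp k δ h (word k δ q hq) (word k δ p hp) =
      word k δ (p.comp q) (by rw [Word.deg_comp, hq, hp, ← h, add_comm]) := by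
  refine (linComp_single k (wordCat E) (fun _ _ => Word.deg δ) (fun _ _ _ => Word.deg_comp δ) h
    ⟨q, hq⟩ ⟨p, hp⟩ 1 1).trans ?_
  rw [mul_one]
  rfl

theorem freeComp_assoc {a b c e : V} {p q r s t n : ℤ} (hpq : p + q = s) (hqr : q + r = t)
    (hs : s + r = n) (ht : p + t = n) (x : FreeHom k δ c e p) (y : FreeHom k δ b c q)
    (z : FreeHom k δ a b r) :
    freeComp k δ hs (freeComp k δ hpq x y) z = freeComp k δ ht x (freeComp k δ hqr y z) :=
  (GrCat.free k δ).assoc hpq hqr hs ht x y z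

theorem freeComp_nil {a b : V} {z n : ℤ} (hz : Word.deg δ (.nil : Word E b b) = z) (h : z + n = n)
    (x : FreeHom k δ a b n) : freeComp k δ h (word k δ (.nil : Word E b b) hz) x = x := by
  obtain rfl : z = 0 := by omega
  exact (GrCat.free k δ).id_comp h x

theorem freeComp_nil_right {a b : V} {z n : ℤ} (hz : Word.deg δ (.nil : Word E a a) = z) (h : n + z = n)
    (x : FreeHom k δ a b n) : freeComp k δ h x (word k δ (.nil : Word E a a) hz) = x := by
  obtain rfl : z = 0 := by omega
  exact (GrCat.free k δ).comp_id h x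

theorem FreeHom.induction {a b : V} {n : ℤ} {P : FreeHom k δ a b n → Prop}
    (x : FreeHom k δ a b n) (zero : P 0) (add : ∀ x y, P x → P y → P (x + y))
    (smul : ∀ (c : k) (p : Word E a b) (h : Word.deg δ p = n), P (c • word k δ p h)) : P x := by
  induction x using Finsupp.induction_linear with
  | zero => exact zero
  | add f g hf hg => exact add f g hf hg
  | single a c => simpa [word] using smul c a.1 a.2

variable (k) in
/-- The derivation with prescribed values `dgen` on the generators, on words:
`d(e ∘ p) = dgen e ∘ p + (-1)^(δ e) e ∘ d p`. -/
def dWord (dgen : ∀ (a b : V) (e : E a b), FreeHom k δ a b (δ a b e + 1)) {a : V} :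
    ∀ {b : V} (p : Word E a b) {n : ℤ} (_ : Word.deg δ p + 1 = n), FreeHom k δ a b n
  | _, .nil, _, _ => 0
  | _, .cons (b := b) e p, n, h =>
    freeComp k δ (by rw [← h, Word.deg]; ring : (δ _ _ e + 1) + Word.deg δ p = n)
      (dgen _ _ e) (word k δ p rfl) +
    sgn k (δ _ _ e) • freeComp k δ
      (by rw [← h, Word.deg]; ring : δ _ _ e + (Word.deg δ p + 1) = n)
      (word k δ (.cons e (.nil : Word E b b)) (by simp [Word.deg])) (dWord dgen p rfl)

variable (dgen : ∀ (a b : V) (e : E a b), FreeHom k δ a b (δ a b e + 1))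

variable (k) in
/-- The derivation with prescribed values `dgen` on the generators. -/
def freeD {a b : V} {m n : ℤ} (h : m + 1 = n) : FreeHom k δ a b m →ₗ[k] FreeHom k δ a b n :=
  Finsupp.lift _ k _ fun p => dWord k dgen p.1 (by rw [p.2, h])

theorem freeD_word {a b : V} (p : Word E a b) {m n : ℤ} (hp : Word.deg δ p = m)
    (h : m + 1 = n) : freeD k dgen h (word k δ p hp) = dWord k dgen p (by rw [hp, h]) := by
  simp [freeD, word]

theorem dWord_nil {a : V} {n : ℤ} (h : Word.deg δ (.nil : Word E a a) + 1 = n) :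
    dWord k dgen (.nil : Word E a a) h = 0 := rfl

theorem dWord_cons {a b c : V} (e : E b c) (p : Word E a b) {i m n : ℤ} (hi : Word.deg δ p = i)
    (h : Word.deg δ (.cons e p) + 1 = n) (hm : Word.deg δ p + 1 = m)
    (h1 : δ _ _ e + 1 + i = n) (h2 : δ _ _ e + m = n) :
    dWord k dgen (.cons e p) h = freeComp k δ h1 (dgen _ _ e) (word k δ p hi) +
      sgn k (δ _ _ e) • freeComp k δ h2
        (word k δ (.cons e (.nil : Word E b b)) (by simp [Word.deg])) (dWord k dgen p hm) := by
  subst hi hm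
  rfl

theorem dWord_comp {a b c : V} (q : Word E b c) (p : Word E a b) {i j n l' m' : ℤ}
    (hi : Word.deg δ q = i) (hj : Word.deg δ p = j)
    (hn : Word.deg δ (p.comp q) + 1 = n)
    (hl : Word.deg δ q + 1 = l') (hm : Word.deg δ p + 1 = m')
    (h1 : l' + j = n) (h2 : i + m' = n) :
    dWord k dgen (p.comp q) hn =
      freeComp k δ h1 (dWord k dgen q hl) (word k δ p hj) +
      sgn k i • freeComp k δ h2 (word k δ q hi) (dWord k dgen p hm) := by
  induction q generalizing n i l' with
  | nil =>
    obtain rfl : i = 0 := hi.symm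
    rw [dWord_nil, map_zero, LinearMap.zero_apply, zero_add, sgn_zero, one_smul]
    obtain rfl : n = m' := by omega
    exact (freeComp_nil hi h2 _).symm
  | cons e q ih =>
    have hc := Word.deg_comp δ p q
    have hd : δ _ _ e + Word.deg δ q = i := hi
    obtain rfl : δ _ _ e + Word.deg δ (p.comp q) + 1 = n := hn
    refine (dWord_cons dgen e (p.comp q) rfl _ rfl (by ring) (by ring)).trans ?_
    rw [dWord_cons dgen e q rfl hl rfl (by omega) (by omega),
      ih rfl rfl rfl (by omega) (by omega)]
    simp only [map_add, map_smul, LinearMap.add_apply, LinearMap.smul_apply, smul_add, smul_smul,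
      add_assoc]
    congr 1
    · rw [freeComp_assoc (hqr := (by omega : Word.deg δ q + j = Word.deg δ (p.comp q)))
        (ht := by omega), freeComp_word]
    congr 1
    · rw [freeComp_assoc (hqr := (by omega : Word.deg δ q + 1 + j = Word.deg δ (p.comp q) + 1))
        (ht := by omega)]
    · rw [← sgn_add]
      congr 1
      · rw [hd]
      · rw [← freeComp_assoc (hpq := hd) (hs := h2), freeComp_word]
        rfl

theorem freeD_leibniz {a b c : V} {p q n p' q' n' : ℤ} (h : p + q = n) (hn : n + 1 = n')
    (hp : p + 1 = p') (hq : q + 1 = q') (hl : p' + q = n') (hr : p + q' = n')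
    (y : FreeHom k δ b c p) (x : FreeHom k δ a b q) :
    freeD k dgen hn (freeComp k δ h y x) =
      freeComp k δ hl (freeD k dgen hp y) x +
        sgn k p • freeComp k δ hr y (freeD k dgen hq x) := by
  induction x using FreeHom.induction with
  | zero => simp
  | add x x' hx hx' => simp only [map_add, hx, hx', smul_add]; abel
  | smul s x hx =>
    induction y using FreeHom.induction with
    | zero => simp
    | add y y' hy hy' =>
      simp only [map_add, LinearMap.add_apply, hy, hy', smul_add]; abel
    | smul t y hy =>
      simp only [map_smul, LinearMap.smul_apply, freeComp_word, freeD_word]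
      rw [dWord_comp dgen y x hy hx _ (hy ▸ hp) (hx ▸ hq) hl hr]
      simp only [smul_add, smul_smul]
      congr 2
      ring

theorem freeD_dWord (hd : ∀ (a b : V) (e : E a b), freeD k dgen rfl (dgen a b e) = 0)
    {a b : V} (p : Word E a b) {n n' : ℤ} (h : Word.deg δ p + 1 = n) (h' : n + 1 = n') :
    freeD k dgen h' (dWord k dgen p h) = 0 := by
  induction p generalizing n n' with
  | nil => simp [dWord]
  | cons e p ih =>
    subst h' h
    simp only [dWord, map_add, map_smul]
    rw [freeD_leibniz (hp := rfl) (hq := rfl) (hl := by rw [Word.deg]; ring)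
        (hr := by rw [Word.deg]; ring),
      freeD_leibniz (hp := rfl) (hq := rfl) (hl := by rw [Word.deg]; ring)
        (hr := by rw [Word.deg]; ring), hd, ih, freeD_word, freeD_word]
    simp only [dWord, map_zero, LinearMap.zero_apply, zero_add, smul_zero, add_zero, sgn_succ,
      neg_smul]
    rw [freeComp_nil_right rfl (by simp [Word.deg])]
    simp

theorem freeD_freeD (hd : ∀ (a b : V) (e : E a b), freeD k dgen rfl (dgen a b e) = 0)
    {a b : V} {l m n : ℤ} (h : l + 1 = m) (h' : m + 1 = n) (x : FreeHom k δ a b l) :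
    freeD k dgen h' (freeD k dgen h x) = 0 := by
  induction x using FreeHom.induction with
  | zero => simp
  | add x y hx hy => simp [hx, hy]
  | smul c p hp => rw [map_smul, map_smul, freeD_word, freeD_dWord dgen hd, smul_zero]

/-- The DG category freely generated by a family `E` of arrows of degrees `δ` with prescribed
differentials `dgen`. -/
def DGCat.free (hd : ∀ (a b : V) (e : E a b), freeD k dgen rfl (dgen a b e) = 0) :
    DGCat.{u, max u g w, w} k where
  toGrCat := GrCat.free k δ
  d h := freeD k dgen h
  d_d := freeD_freeD dgen hd
  leibniz := freeD_leibniz dgen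

end free

/-! ### Semi-free DG categories -/

section semifree
variable {k : Type w} [CommRing k] (A : DGCat.{u, v, w} k) {E : A.Obj → A.Obj → Type g}
  (δ : ∀ X Y, E X Y → ℤ)

/-- The value of a word in a family of morphisms of `A`. -/
def DGCat.evalWord (gen : ∀ X Y (e : E X Y), A.Hom X Y (δ X Y e)) {X : A.Obj} :
    ∀ {Y : A.Obj} (p : Word E X Y) {n : ℤ} (_ : Word.deg δ p = n), A.Hom X Y n
  | _, .nil, _, h => A.castDeg h (A.id X)
  | _, .cons e p, _, h => A.comp h (gen _ _ e) (evalWord gen p rfl)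

/-- `A` is semi-free: it is freely generated as a graded `k`-category by a family of homogeneous
morphisms (that is, the words in this family form a basis of the morphisms), and this family has
an exhaustive filtration by levels such that the differential of a generator is a combination of
words in generators of smaller levels. -/
def DGCat.IsSemiFree : Prop :=
  ∃ (E : A.Obj → A.Obj → Type g) (δ : ∀ X Y, E X Y → ℤ)
    (gen : ∀ X Y (e : E X Y), A.Hom X Y (δ X Y e)) (lev : ∀ X Y, E X Y → ℕ),
    (∀ (X Y : A.Obj) (n : ℤ), Function.Bijective
      (Finsupp.linearCombination k fun p : {p : Word E X Y // Word.deg δ p = n} =>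
        A.evalWord δ gen p.1 p.2)) ∧
    ∀ (X Y : A.Obj) (e : E X Y), A.d rfl (gen X Y e) ∈ Submodule.span k
      {x | ∃ (p : Word E X Y) (h : Word.deg δ p = δ X Y e + 1),
        p.LevelLT lev (lev X Y e) ∧ A.evalWord δ gen p h = x}

end semifree

section resolution
variable {k : Type w} [CommRing k] {A : DGCat.{u, v, w} k} {B : DGCat.{u', v', w} k}
  {φ : A.Obj → B.Obj}

/-- A resolution: a quasi-equivalence, bijective on objects, from a semi-free DG category. -/
structure DGFunctor.IsResolution (F : DGFunctor A B φ) : Prop where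
  semiFree : DGCat.IsSemiFree.{u, v, w, g} A
  bijective_obj : Function.Bijective φ
  quasiEquivalence : F.IsQuasiEquivalence

end resolution

/-! ### One-sided twisted complexes -/

section pretr
variable {k : Type w} [CommRing k]

/-- A one-sided twisted complex `(⨁ C i [r i], q)` over `A`. A morphism of degree `l` from
`C [r]` to `C' [r']` is a morphism `C → C'` of degree `l + r' - r`; these are composed as in `A`
and `(-1)^r' d` is the differential. -/
structure Tw (A : DGCat.{u, v, w} k) where
  n : ℕ
  C : Fin n → A.Obj
  r : Fin n → ℤ
  q : ∀ i j, A.Hom (C j) (C i) (1 + r i - r j)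
  upper : ∀ i j, j ≤ i → q i j = 0
  maurerCartan : ∀ i j, sgn k (r i) • A.d (by ring : _ = 2 + r i - r j) (q i j) +
    ∑ a, A.comp (by ring : _ = 2 + r i - r j) (q i a) (q a j) = 0

variable {A : DGCat.{u, v, w} k}

/-- Morphisms of degree `l` of twisted complexes: matrices. -/
abbrev TwHom (T T' : Tw A) (l : ℤ) : Type v :=
  ∀ (i : Fin T'.n) (j : Fin T.n), A.Hom (T.C j) (T'.C i) (l + T'.r i - T.r j)

/-- The identity matrix. -/
def twId (T : Tw A) : TwHom T T 0 := fun i j =>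
  if h : j = i then h ▸ A.castDeg (by ring) (A.id (T.C j)) else 0

/-- Matrix multiplication. -/
def twComp {T T' T'' : Tw A} {p q n : ℤ} (h : p + q = n) :
    TwHom T' T'' p →ₗ[k] TwHom T T' q →ₗ[k] TwHom T T'' n :=
  LinearMap.mk₂ k (fun b a i j => ∑ x, A.comp (by rw [← h]; ring) (b i x) (a x j))
    (by intros; ext; simp [Finset.sum_add_distrib])
    (by intros; ext; simp [Finset.smul_sum])
    (by intros; ext; simp [Finset.sum_add_distrib])
    (by intros; ext; simp [Finset.smul_sum])

/-- The naive differential: `(-1)^r' d` on each entry of a matrix. -/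
def twNaive {T T' : Tw A} {l n : ℤ} (h : l + 1 = n) : TwHom T T' l →ₗ[k] TwHom T T' n where
  toFun f i j := sgn k (T'.r i) • A.d (by rw [← h]; ring) (f i j)
  map_add' f g := by
    ext i j
    simp only [Pi.add_apply, map_add, smul_add]
  map_smul' c f := by
    ext i j
    simp only [Pi.smul_apply, map_smul, RingHom.id_apply, smul_comm c]

/-- The differential `f ↦ d_naive f + q' f - (-1)^l f q` for `f` of degree `l`. -/
def twD {T T' : Tw A} {l n : ℤ} (h : l + 1 = n) : TwHom T T' l →ₗ[k] TwHom T T' n :=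
  twNaive h + twComp (by rw [← h, add_comm] : 1 + l = n) T'.q -
    sgn k l • (twComp h).flip T.q

theorem twD_apply {T T' : Tw A} {l n : ℤ} (h : l + 1 = n) (f : TwHom T T' l) :
    twD h f = twNaive h f + twComp (by rw [← h, add_comm] : 1 + l = n) T'.q f -
      sgn k l • twComp h f T.q := rfl

theorem twComp_apply {T T' T'' : Tw A} {p q n : ℤ} (h : p + q = n) (b : TwHom T' T'' p)
    (a : TwHom T T' q) (i j) :
    twComp h b a i j = ∑ x, A.comp (by rw [← h]; ring) (b i x) (a x j) := rfl

theorem twNaive_apply {T T' : Tw A} {l n : ℤ} (h : l + 1 = n) (f : TwHom T T' l) (i j) :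
    twNaive h f i j = sgn k (T'.r i) • A.d (by rw [← h]; ring) (f i j) := rfl

theorem twComp_assoc {T₀ T₁ T₂ T₃ : Tw A} {p q r s t n : ℤ} (hpq : p + q = s) (hqr : q + r = t)
    (hs : s + r = n) (ht : p + t = n) (c : TwHom T₂ T₃ p) (b : TwHom T₁ T₂ q)
    (a : TwHom T₀ T₁ r) : twComp hs (twComp hpq c b) a = twComp ht c (twComp hqr b a) := by
  ext i j
  simp only [twComp_apply, map_sum, LinearMap.sum_apply]
  rw [Finset.sum_comm]
  refine Finset.sum_congr rfl fun x _ => Finset.sum_congr rfl fun y _ => ?_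
  exact A.assoc _ _ _ _ _ _ _

theorem twNaive_twNaive {T T' : Tw A} {l m n : ℤ} (h : l + 1 = m) (h' : m + 1 = n)
    (f : TwHom T T' l) : twNaive h' (twNaive h f) = 0 := by
  ext i j
  simp only [twNaive_apply, map_smul, A.d_d, smul_zero, Pi.zero_apply]

theorem twNaive_twComp {T T' T'' : Tw A} {p q n p' q' n' : ℤ} (h : p + q = n) (hn : n + 1 = n')
    (hp : p + 1 = p') (hq : q + 1 = q') (hl : p' + q = n') (hr : p + q' = n')
    (b : TwHom T' T'' p) (a : TwHom T T' q) :
    twNaive hn (twComp h b a) =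
      twComp hl (twNaive hp b) a + sgn k p • twComp hr b (twNaive hq a) := by
  ext i j
  simp only [twNaive_apply, twComp_apply, Pi.add_apply, Pi.smul_apply, map_sum, Finset.smul_sum,
    ← Finset.sum_add_distrib, map_smul, LinearMap.smul_apply]
  refine Finset.sum_congr rfl fun x _ => ?_
  rw [A.leibniz _ _ (by omega : p + T''.r i - T'.r x + 1 = p' + T''.r i - T'.r x)
    (by omega : q + T'.r x - T.r j + 1 = q' + T'.r x - T.r j) (by omega) (by omega), smul_add,
    smul_smul, smul_smul]
  congr 2
  rw [sgn_sub, sgn_add]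
  linear_combination (sgn k p * sgn k (T'.r x)) * sgn_mul_self k (T''.r i)

theorem Tw.maurerCartan' (T : Tw A) :
    twNaive (by norm_num : (1 : ℤ) + 1 = 2) T.q + twComp (by norm_num : (1 : ℤ) + 1 = 2) T.q T.q =
      (0 : TwHom T T 2) := by
  ext i j
  exact T.maurerCartan i j

theorem castId_comp (A : DGCat.{u, v, w} k) {X Y : A.Obj} {z n : ℤ} (hz : 0 = z) (h : z + n = n)
    (f : A.Hom X Y n) : A.comp h (A.castDeg hz (A.id Y)) f = f := by
  subst hz
  exact A.id_comp h f

theorem comp_castId (A : DGCat.{u, v, w} k) {X Y : A.Obj} {z n : ℤ} (hz : 0 = z) (h : n + z = n)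
    (f : A.Hom X Y n) : A.comp h f (A.castDeg hz (A.id X)) = f := by
  subst hz
  exact A.comp_id h f

theorem twId_self (T : Tw A) (i) : twId T i i = A.castDeg (by ring) (A.id (T.C i)) := by
  simp [twId]

theorem twId_ne (T : Tw A) {i j} (h : i ≠ j) : twId T i j = 0 := by
  simp [twId, h.symm]

/-- The graded category underlying the DG category of twisted complexes. -/
def GrCat.pretr (A : DGCat.{u, v, w} k) : GrCat.{max u v, v, w} k where
  Obj := Tw A
  Hom := TwHom
  id := twId
  comp := twComp
  id_comp {T T' n} h f := by
    ext i j
    rw [twComp_apply, Finset.sum_eq_single i, twId_self, castId_comp]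
    · intro b _ hb
      rw [twId_ne _ hb.symm, map_zero, LinearMap.zero_apply]
    · simp
  comp_id {T T' n} h f := by
    ext i j
    rw [twComp_apply, Finset.sum_eq_single j, twId_self, comp_castId]
    · intro b _ hb
      rw [twId_ne _ hb, map_zero]
    · simp
  assoc := twComp_assoc

theorem twD_twD {T T' : Tw A} {l m n : ℤ} (h : l + 1 = m) (h' : m + 1 = n) (f : TwHom T T' l) :
    twD h' (twD h f) = 0 := by
  have e1 := congrArg (fun z => twComp (by omega : 2 + l = n) z f) T'.maurerCartan'
  have e2 := congrArg (fun z => twComp (by omega : l + 2 = n) f z) T.maurerCartan'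
  simp only [map_add, LinearMap.add_apply, map_zero, LinearMap.zero_apply] at e1 e2
  simp only [twD_apply, map_add, map_sub, map_smul, twNaive_twNaive]
  rw [twNaive_twComp (hp := (by norm_num : (1 : ℤ) + 1 = 2)) (hq := h) (hl := by omega)
      (hr := by omega),
    twNaive_twComp (hp := h) (hq := (by norm_num : (1 : ℤ) + 1 = 2)) (hl := by omega)
      (hr := by omega)]
  rw [twComp_assoc (hpq := (by norm_num : (1 : ℤ) + 1 = 2)) (hqr := (by omega : 1 + l = m))
    (hs := by omega) (ht := by omega)] at e1
  rw [← twComp_assoc (hpq := (by omega : l + 1 = m)) (hqr := (by norm_num : (1 : ℤ) + 1 = 2))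
    (hs := by omega) (ht := by omega)] at e2
  rw [twComp_assoc (hpq := (by omega : 1 + l = m)) (hqr := (by omega : l + 1 = m))
    (hs := by omega) (ht := by omega)]
  obtain rfl := h
  simp only [sgn_succ]
  have hs1 : sgn k 1 = -1 := by simpa using sgn_succ k 0
  have hs := sgn_mul_self k l
  rw [hs1]
  simp only [smul_add, smul_sub, smul_neg, smul_smul, neg_smul, one_smul, hs]
  refine Eq.trans ?_ ((congrArg₂ (fun x y => x - y) e1 e2).trans (sub_zero _))
  abel

theorem twD_leibniz {T T' T'' : Tw A} {p q n p' q' n' : ℤ} (h : p + q = n) (hn : n + 1 = n')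
    (hp : p + 1 = p') (hq : q + 1 = q') (hl : p' + q = n') (hr : p + q' = n')
    (b : TwHom T' T'' p) (a : TwHom T T' q) :
    twD hn (twComp h b a) = twComp hl (twD hp b) a + sgn k p • twComp hr b (twD hq a) := by
  simp only [twD_apply, map_add, map_sub, map_smul, LinearMap.add_apply,
    LinearMap.sub_apply, LinearMap.smul_apply]
  rw [twNaive_twComp h hn hp hq hl hr,
    twComp_assoc (hpq := (by omega : 1 + p = p')) (hqr := h) (hs := hl) (ht := by omega),
    twComp_assoc (hpq := hp) (hqr := (by omega : 1 + q = q')) (hs := hl) (ht := hr),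
    twComp_assoc (hpq := h) (hqr := hq) (hs := hn) (ht := hr)]
  subst h
  simp only [sgn_add, smul_add, smul_sub, smul_smul]
  abel

/-- The DG category `A^pretr` of one-sided twisted complexes over `A`. -/
def DGCat.pretr (A : DGCat.{u, v, w} k) : DGCat.{max u v, v, w} k where
  toGrCat := GrCat.pretr A
  d := twD
  d_d := twD_twD
  leibniz := twD_leibniz

/-- An object of `A` as a twisted complex. -/
def Tw.of (X : A.Obj) : Tw A where
  n := 1
  C _ := X
  r _ := 0
  q _ _ := 0
  upper _ _ _ := rfl
  maurerCartan _ _ := by simp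

/-- A morphism of `A` as a morphism of twisted complexes. -/
def Tw.ofHom {X Y : A.Obj} {n : ℤ} (f : A.Hom X Y n) : TwHom (Tw.of X) (Tw.of Y) n :=
  fun _ _ => A.castDeg (by simp [Tw.of]) f

/-- The matrix with the only entry `f` in position `(0, 1)`. -/
def Tw.coneMatrix {X Y : A.Obj} (f : A.Hom X Y 0) (i j : Fin 2) :
    A.Hom ((![Y, X] : Fin 2 → A.Obj) j) ((![Y, X] : Fin 2 → A.Obj) i)
      (1 + (![0, 1] : Fin 2 → ℤ) i - (![0, 1] : Fin 2 → ℤ) j) :=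
  match i, j with
  | 0, 1 => A.castDeg (by simp) f
  | 0, 0 => 0
  | 1, 0 => 0
  | 1, 1 => 0

theorem Tw.coneMatrix_left {X Y : A.Obj} (f : A.Hom X Y 0) (i : Fin 2) :
    Tw.coneMatrix f i 0 = 0 := by
  fin_cases i <;> rfl

theorem Tw.coneMatrix_right {X Y : A.Obj} (f : A.Hom X Y 0) (j : Fin 2) :
    Tw.coneMatrix f 1 j = 0 := by
  fin_cases j <;> rfl

theorem d_castDeg (A : DGCat.{u, v, w} k) {X Y : A.Obj} {l m n : ℤ} (e : l = m) (h : m + 1 = n)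
    (f : A.Hom X Y l) : A.d h (A.castDeg e f) = A.d (by rw [e, h]) f := by
  subst e
  rfl

theorem Tw.d_coneMatrix {X Y : A.Obj} (f : A.Hom X Y 0) (hf : f ∈ A.cocycles X Y 0) :
    ∀ (i j : Fin 2) {n : ℤ}
      (h : 1 + (![0, 1] : Fin 2 → ℤ) i - (![0, 1] : Fin 2 → ℤ) j + 1 = n),
      A.d h (Tw.coneMatrix f i j) = 0
  | 0, 1, n, h => by
    obtain rfl : n = 0 + 1 := by rw [← h]; rfl
    exact (d_castDeg A _ _ f).trans hf
  | 0, 0, _, _ => map_zero _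
  | 1, 0, _, _ => map_zero _
  | 1, 1, _, _ => map_zero _

/-- The cone `(Y ⊕ X[1], q)`, with `q 0 1 = f`, of a closed morphism of degree `0`. -/
def Tw.cone {X Y : A.Obj} (f : A.Hom X Y 0) (hf : f ∈ A.cocycles X Y 0) : Tw A where
  n := 2
  C := ![Y, X]
  r := ![0, 1]
  q := Tw.coneMatrix f
  upper i j h := by
    fin_cases i <;> fin_cases j <;> first | rfl | (exfalso; revert h; decide)
  maurerCartan i j := by
    rw [Fin.sum_univ_two, Tw.coneMatrix_left, Tw.coneMatrix_right, map_zero, map_zero,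
      LinearMap.zero_apply]
    simp only [add_zero]
    rw [Tw.d_coneMatrix f hf, smul_zero]

end pretr

/-! ### The DG quotient -/

section quotient
variable {k : Type w} [CommRing k]

/-- Expressions in the morphisms of `A` and new morphisms `ε_U : U → U` of degree `-1`, for the
objects `U` in `S`. -/
inductive Expr (A : DGCat.{u, v, w} k) (S : Set A.Obj) :
    A.Obj → A.Obj → ℤ → Type (max u v w)
  | of {X Y : A.Obj} {n : ℤ} (f : A.Hom X Y n) : Expr A S X Y n
  | eps (U : A.Obj) (hU : U ∈ S) : Expr A S U U (-1)
  | comp {X Y Z : A.Obj} {p q n : ℤ} (h : p + q = n) (b : Expr A S Y Z p) (a : Expr A S X Y q) :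
      Expr A S X Z n
  | add {X Y : A.Obj} {n : ℤ} (a b : Expr A S X Y n) : Expr A S X Y n
  | smul {X Y : A.Obj} {n : ℤ} (c : k) (a : Expr A S X Y n) : Expr A S X Y n

variable {A : DGCat.{u, v, w} k} {S : Set A.Obj}

/-- The congruence on expressions generated by the axioms of a graded `k`-category and the
relations between the morphisms of `A`. -/
inductive Expr.Rel : ∀ {X Y : A.Obj} {n : ℤ}, Expr A S X Y n → Expr A S X Y n → Prop
  | refl {X Y n} (a : Expr A S X Y n) : Rel a a
  | symm {X Y n} {a b : Expr A S X Y n} : Rel a b → Rel b a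
  | trans {X Y n} {a b c : Expr A S X Y n} : Rel a b → Rel b c → Rel a c
  | comp_congr {X Y Z p q n} (h : p + q = n) {b b' : Expr A S Y Z p} {a a' : Expr A S X Y q} :
      Rel b b' → Rel a a' → Rel (.comp h b a) (.comp h b' a')
  | add_congr {X Y n} {a a' b b' : Expr A S X Y n} :
      Rel a a' → Rel b b' → Rel (.add a b) (.add a' b')
  | smul_congr {X Y n} (c : k) {a a' : Expr A S X Y n} :
      Rel a a' → Rel (.smul c a) (.smul c a')
  | add_assoc {X Y n} (a b c : Expr A S X Y n) : Rel (.add (.add a b) c) (.add a (.add b c))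
  | add_comm {X Y n} (a b : Expr A S X Y n) : Rel (.add a b) (.add b a)
  | zero_add {X Y n} (a : Expr A S X Y n) : Rel (.add (.of 0) a) a
  | zero_smul {X Y n} (a : Expr A S X Y n) : Rel (.smul 0 a) (.of 0)
  | one_smul {X Y n} (a : Expr A S X Y n) : Rel (.smul 1 a) a
  | mul_smul {X Y n} (c c' : k) (a : Expr A S X Y n) :
      Rel (.smul (c * c') a) (.smul c (.smul c' a))
  | smul_add {X Y n} (c : k) (a b : Expr A S X Y n) :
      Rel (.smul c (.add a b)) (.add (.smul c a) (.smul c b))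
  | add_smul {X Y n} (c c' : k) (a : Expr A S X Y n) :
      Rel (.smul (c + c') a) (.add (.smul c a) (.smul c' a))
  | of_add {X Y n} (f g : A.Hom X Y n) : Rel (.of (f + g)) (.add (.of f) (.of g))
  | of_smul {X Y n} (c : k) (f : A.Hom X Y n) : Rel (.of (c • f)) (.smul c (.of f))
  | of_comp {X Y Z p q n} (h : p + q = n) (b : A.Hom Y Z p) (a : A.Hom X Y q) :
      Rel (.of (A.comp h b a)) (.comp h (.of b) (.of a))
  | id_comp {X Y n} (h : 0 + n = n) (a : Expr A S X Y n) : Rel (.comp h (.of (A.id Y)) a) a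
  | comp_id {X Y n} (h : n + 0 = n) (a : Expr A S X Y n) : Rel (.comp h a (.of (A.id X))) a
  | assoc {W X Y Z p q r s t n} (hpq : p + q = s) (hqr : q + r = t) (hs : s + r = n)
      (ht : p + t = n) (c : Expr A S Y Z p) (b : Expr A S X Y q) (a : Expr A S W X r) :
      Rel (.comp hs (.comp hpq c b) a) (.comp ht c (.comp hqr b a))
  | add_comp {X Y Z p q n} (h : p + q = n) (b b' : Expr A S Y Z p) (a : Expr A S X Y q) :
      Rel (.comp h (.add b b') a) (.add (.comp h b a) (.comp h b' a))
  | comp_add {X Y Z p q n} (h : p + q = n) (b : Expr A S Y Z p) (a a' : Expr A S X Y q) :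
      Rel (.comp h b (.add a a')) (.add (.comp h b a) (.comp h b a'))
  | smul_comp {X Y Z p q n} (h : p + q = n) (c : k) (b : Expr A S Y Z p) (a : Expr A S X Y q) :
      Rel (.comp h (.smul c b) a) (.smul c (.comp h b a))
  | comp_smul {X Y Z p q n} (h : p + q = n) (c : k) (b : Expr A S Y Z p) (a : Expr A S X Y q) :
      Rel (.comp h b (.smul c a)) (.smul c (.comp h b a))

/-- Equality of expressions modulo the relations. -/
instance Expr.setoid (X Y : A.Obj) (n : ℤ) : Setoid (Expr A S X Y n) where
  r := Expr.Rel
  iseqv := ⟨.refl, .symm, .trans⟩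

variable (A S) in
/-- The morphisms of degree `n` of the DG quotient. -/
def QHom (X Y : A.Obj) (n : ℤ) : Type (max u v w) := Quotient (Expr.setoid (S := S) X Y n)

/-- The morphism represented by an expression. -/
def QHom.mk {X Y : A.Obj} {n : ℤ} (a : Expr A S X Y n) : QHom A S X Y n := Quotient.mk _ a

theorem QHom.sound {X Y : A.Obj} {n : ℤ} {a b : Expr A S X Y n} (h : Expr.Rel a b) :
    QHom.mk a = QHom.mk b := Quotient.sound h

theorem QHom.exists_mk {X Y : A.Obj} {n : ℤ} (x : QHom A S X Y n) : ∃ a, QHom.mk a = x :=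
  Quotient.exists_rep x

instance (X Y : A.Obj) (n : ℤ) : Zero (QHom A S X Y n) := ⟨QHom.mk (.of 0)⟩
instance (X Y : A.Obj) (n : ℤ) : Add (QHom A S X Y n) :=
  ⟨Quotient.map₂ .add fun _ _ h _ _ h' => .add_congr h h'⟩
instance (X Y : A.Obj) (n : ℤ) : SMul k (QHom A S X Y n) :=
  ⟨fun c => Quotient.map (.smul c) fun _ _ h => .smul_congr c h⟩
instance (X Y : A.Obj) (n : ℤ) : Neg (QHom A S X Y n) := ⟨fun x => (-1 : k) • x⟩

theorem QHom.mk_zero {X Y : A.Obj} {n : ℤ} : (QHom.mk (.of 0) : QHom A S X Y n) = 0 := rfl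
theorem QHom.mk_add {X Y : A.Obj} {n : ℤ} (a b : Expr A S X Y n) :
    QHom.mk (.add a b) = QHom.mk a + QHom.mk b := rfl
theorem QHom.mk_smul {X Y : A.Obj} {n : ℤ} (c : k) (a : Expr A S X Y n) :
    QHom.mk (.smul c a) = c • QHom.mk a := rfl

theorem QHom.one_smul' {X Y : A.Obj} {n : ℤ} (x : QHom A S X Y n) : (1 : k) • x = x := by
  obtain ⟨x, rfl⟩ := QHom.exists_mk x
  exact QHom.sound (.one_smul x)
theorem QHom.add_smul' {X Y : A.Obj} {n : ℤ} (c c' : k) (x : QHom A S X Y n) :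
    (c + c') • x = c • x + c' • x := by
  obtain ⟨x, rfl⟩ := QHom.exists_mk x
  exact QHom.sound (.add_smul c c' x)
theorem QHom.zero_smul' {X Y : A.Obj} {n : ℤ} (x : QHom A S X Y n) : (0 : k) • x = 0 := by
  obtain ⟨x, rfl⟩ := QHom.exists_mk x
  exact QHom.sound (.zero_smul x)
theorem QHom.zero_add' {X Y : A.Obj} {n : ℤ} (x : QHom A S X Y n) : 0 + x = x := by
  obtain ⟨x, rfl⟩ := QHom.exists_mk x
  exact QHom.sound (.zero_add x)
theorem QHom.add_comm' {X Y : A.Obj} {n : ℤ} (x y : QHom A S X Y n) : x + y = y + x := by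
  obtain ⟨x, rfl⟩ := QHom.exists_mk x
  obtain ⟨y, rfl⟩ := QHom.exists_mk y
  exact QHom.sound (.add_comm x y)
theorem QHom.add_assoc' {X Y : A.Obj} {n : ℤ} (x y z : QHom A S X Y n) :
    x + y + z = x + (y + z) := by
  obtain ⟨x, rfl⟩ := QHom.exists_mk x
  obtain ⟨y, rfl⟩ := QHom.exists_mk y
  obtain ⟨z, rfl⟩ := QHom.exists_mk z
  exact QHom.sound (.add_assoc x y z)

instance (X Y : A.Obj) (n : ℤ) : AddCommGroup (QHom A S X Y n) where
  add_assoc := QHom.add_assoc'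
  zero_add := QHom.zero_add'
  add_zero x := by rw [QHom.add_comm', QHom.zero_add']
  nsmul := nsmulRec
  zsmul := zsmulRec
  neg_add_cancel x := by
    have h := QHom.add_smul' (-1 : k) 1 x
    rw [neg_add_cancel, QHom.zero_smul', QHom.one_smul'] at h
    exact h.symm
  add_comm := QHom.add_comm'

instance (X Y : A.Obj) (n : ℤ) : Module k (QHom A S X Y n) where
  one_smul := QHom.one_smul'
  mul_smul c c' x := by
    obtain ⟨x, rfl⟩ := QHom.exists_mk x
    exact QHom.sound (.mul_smul c c' x)
  smul_zero c := by
    refine QHom.sound (.trans (.smul_congr c (.symm (.zero_smul (.of 0)))) ?_)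
    refine .trans (.symm (.mul_smul c 0 _)) ?_
    rw [mul_zero]
    exact .zero_smul _
  smul_add c x y := by
    obtain ⟨x, rfl⟩ := QHom.exists_mk x
    obtain ⟨y, rfl⟩ := QHom.exists_mk y
    exact QHom.sound (.smul_add c x y)
  add_smul := QHom.add_smul'
  zero_smul := QHom.zero_smul'

/-- Composition in the DG quotient. -/
def QHom.comp {X Y Z : A.Obj} {p q n : ℤ} (h : p + q = n) :
    QHom A S Y Z p →ₗ[k] QHom A S X Y q →ₗ[k] QHom A S X Z n :=
  LinearMap.mk₂ k (Quotient.map₂ (.comp h) fun _ _ hb _ _ ha => .comp_congr h hb ha)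
    (fun b b' a => by
      obtain ⟨a, rfl⟩ := QHom.exists_mk a
      obtain ⟨b, rfl⟩ := QHom.exists_mk b
      obtain ⟨b', rfl⟩ := QHom.exists_mk b'
      exact QHom.sound (.add_comp h b b' a))
    (fun c b a => by
      obtain ⟨a, rfl⟩ := QHom.exists_mk a
      obtain ⟨b, rfl⟩ := QHom.exists_mk b
      exact QHom.sound (.smul_comp h c b a))
    (fun b a a' => by
      obtain ⟨a, rfl⟩ := QHom.exists_mk a
      obtain ⟨a', rfl⟩ := QHom.exists_mk a'
      obtain ⟨b, rfl⟩ := QHom.exists_mk b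
      exact QHom.sound (.comp_add h b a a'))
    (fun c b a => by
      obtain ⟨a, rfl⟩ := QHom.exists_mk a
      obtain ⟨b, rfl⟩ := QHom.exists_mk b
      exact QHom.sound (.comp_smul h c b a))

theorem QHom.comp_mk {X Y Z : A.Obj} {p q n : ℤ} (h : p + q = n) (b : Expr A S Y Z p)
    (a : Expr A S X Y q) : QHom.comp h (.mk b) (.mk a) = .mk (.comp h b a) := rfl

variable (S) in
/-- A morphism of `A` as a morphism of the DG quotient. -/
def QHom.of {X Y : A.Obj} {n : ℤ} : A.Hom X Y n →ₗ[k] QHom A S X Y n where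
  toFun f := .mk (.of f)
  map_add' f g := QHom.sound (.of_add f g)
  map_smul' c f := QHom.sound (.of_smul c f)

theorem QHom.of_comp {X Y Z : A.Obj} {p q n : ℤ} (h : p + q = n) (b : A.Hom Y Z p)
    (a : A.Hom X Y q) : QHom.of S (A.comp h b a) = QHom.comp h (QHom.of S b) (QHom.of S a) :=
  QHom.sound (.of_comp h b a)

theorem QHom.id_comp {X Y : A.Obj} {n : ℤ} (h : 0 + n = n) (x : QHom A S X Y n) :
    QHom.comp h (QHom.of S (A.id Y)) x = x := by
  obtain ⟨x, rfl⟩ := QHom.exists_mk x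
  exact QHom.sound (.id_comp h x)

theorem QHom.comp_id {X Y : A.Obj} {n : ℤ} (h : n + 0 = n) (x : QHom A S X Y n) :
    QHom.comp h x (QHom.of S (A.id X)) = x := by
  obtain ⟨x, rfl⟩ := QHom.exists_mk x
  exact QHom.sound (.comp_id h x)

theorem QHom.assoc {W X Y Z : A.Obj} {p q r s t n : ℤ} (hpq : p + q = s) (hqr : q + r = t)
    (hs : s + r = n) (ht : p + t = n) (c : QHom A S Y Z p) (b : QHom A S X Y q)
    (a : QHom A S W X r) :
    QHom.comp hs (QHom.comp hpq c b) a = QHom.comp ht c (QHom.comp hqr b a) := by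
  obtain ⟨a, rfl⟩ := QHom.exists_mk a
  obtain ⟨b, rfl⟩ := QHom.exists_mk b
  obtain ⟨c, rfl⟩ := QHom.exists_mk c
  exact QHom.sound (.assoc hpq hqr hs ht c b a)

/-- The differential of an expression: it is the one of `A` on the morphisms of `A`, and
`d ε_U = id_U`. -/
def Expr.d : ∀ {X Y : A.Obj} {m : ℤ} (_ : Expr A S X Y m) {n : ℤ} (_ : m + 1 = n), QHom A S X Y n
  | _, _, _, .of f, _, h => QHom.of S (A.d h f)
  | _, _, _, .eps U _, _, h => QHom.of S (A.castDeg (by rw [← h]; rfl) (A.id U))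
  | _, _, _, .comp (p := p) h' b a, _, h =>
      QHom.comp (by rw [← h, ← h']; ring) (b.d rfl) (.mk a) +
        sgn k p • QHom.comp (by rw [← h, ← h']; ring) (.mk b) (a.d rfl)
  | _, _, _, .add a b, _, h => a.d h + b.d h
  | _, _, _, .smul c a, _, h => c • a.d h

theorem Expr.d_comp {X Y Z : A.Obj} {p q n p' q' n' : ℤ} (h : p + q = n) (hn : n + 1 = n')
    (hp : p + 1 = p') (hq : q + 1 = q') (hl : p' + q = n') (hr : p + q' = n')
    (b : Expr A S Y Z p) (a : Expr A S X Y q) :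
    (Expr.comp h b a).d hn = QHom.comp hl (b.d hp) (.mk a) +
      sgn k p • QHom.comp hr (.mk b) (a.d hq) := by
  subst hp hq
  rfl

theorem DGCat.d_id (A : DGCat.{u, v, w} k) (X : A.Obj) {n : ℤ} (h : 0 + 1 = n) :
    A.d h (A.id X) = 0 := by
  have := A.leibniz (add_zero 0) h h h (by rw [add_zero]) (by rw [zero_add]) (A.id X) (A.id X)
  rw [A.comp_id, A.comp_id, sgn_zero, one_smul, A.id_comp] at this
  simpa using this

theorem Expr.Rel.d {X Y : A.Obj} {m n : ℤ} (h : m + 1 = n) {a b : Expr A S X Y m}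
    (hab : Expr.Rel a b) : a.d h = b.d h := by
  induction hab generalizing n with
  | refl a => rfl
  | symm _ ih => exact (ih h).symm
  | trans _ _ ih ih' => exact (ih h).trans (ih' h)
  | comp_congr h' hb ha ihb iha =>
    rw [d_comp h' h rfl rfl (by omega) (by omega), d_comp h' h rfl rfl (by omega) (by omega),
      ihb, iha, QHom.sound hb, QHom.sound ha]
  | add_congr _ _ ih ih' => simp only [Expr.d, ih h, ih' h]
  | smul_congr c _ ih => simp only [Expr.d, ih h]
  | add_assoc a b c => simp only [Expr.d, _root_.add_assoc]
  | add_comm a b => simp only [Expr.d]; rw [_root_.add_comm]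
  | zero_add a => simp only [Expr.d, map_zero, _root_.zero_add]
  | zero_smul a => simp only [Expr.d, map_zero, _root_.zero_smul]
  | one_smul a => simp only [Expr.d, _root_.one_smul]
  | mul_smul c c' a => simp only [Expr.d, SemigroupAction.mul_smul]
  | smul_add c a b => simp only [Expr.d, _root_.smul_add]
  | add_smul c c' a => simp only [Expr.d, _root_.add_smul]
  | of_add f g => simp only [Expr.d, map_add]
  | of_smul c f => simp only [Expr.d, map_smul]
  | of_comp h' b a =>
    rw [d_comp h' h rfl rfl (by omega) (by omega)]
    simp only [Expr.d]
    rw [A.leibniz h' h rfl rfl (by omega) (by omega), map_add, map_smul, QHom.of_comp,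
      QHom.of_comp]
    rfl
  | id_comp h' a =>
    rw [d_comp h' h rfl h (by omega) (by omega)]
    simp only [Expr.d]
    rw [A.d_id, map_zero, map_zero, LinearMap.zero_apply, _root_.zero_add, sgn_zero,
      _root_.one_smul]
    exact QHom.id_comp _ _
  | comp_id h' a =>
    rw [d_comp h' h h rfl (by omega) (by omega)]
    simp only [Expr.d]
    rw [A.d_id, map_zero, map_zero, _root_.smul_zero, _root_.add_zero]
    exact QHom.comp_id _ _
  | @assoc _ _ _ _ p q r s t _ hpq hqr hs ht c b a =>
    rw [d_comp hs h rfl rfl (by omega) (by omega), d_comp hpq rfl rfl rfl (by omega) (by omega),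
      d_comp ht h rfl rfl (by omega) (by omega), d_comp hqr rfl rfl rfl (by omega) (by omega),
      ← QHom.comp_mk, ← QHom.comp_mk]
    simp only [map_add, map_smul, LinearMap.add_apply, LinearMap.smul_apply, _root_.smul_add,
      smul_smul]
    rw [QHom.assoc (hqr := hqr) (ht := by omega),
      QHom.assoc (hqr := (by omega : q + 1 + r = t + 1)) (ht := by omega),
      QHom.assoc (hqr := (by omega : q + (r + 1) = t + 1)) (ht := by omega), _root_.add_assoc,
      (by rw [← hpq, sgn_add] : sgn k s = sgn k p * sgn k q)]
  | add_comp h' b b' a =>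
    simp only [Expr.d, QHom.mk_add, map_add, LinearMap.add_apply, _root_.smul_add]
    abel
  | comp_add h' b a a' =>
    simp only [Expr.d, QHom.mk_add, map_add, _root_.smul_add]
    abel
  | smul_comp h' c b a =>
    simp only [Expr.d, QHom.mk_smul, map_smul, LinearMap.smul_apply, _root_.smul_add]
    rw [smul_comm c]
  | comp_smul h' c b a =>
    simp only [Expr.d, QHom.mk_smul, map_smul, _root_.smul_add]
    rw [smul_comm c]

/-- The differential of the DG quotient. -/
def QHom.d {X Y : A.Obj} {m n : ℤ} (h : m + 1 = n) : QHom A S X Y m →ₗ[k] QHom A S X Y n where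
  toFun := Quotient.lift (fun a => a.d h) fun _ _ hab => Expr.Rel.d h hab
  map_add' x y := by
    obtain ⟨x, rfl⟩ := QHom.exists_mk x
    obtain ⟨y, rfl⟩ := QHom.exists_mk y
    rfl
  map_smul' c x := by
    obtain ⟨x, rfl⟩ := QHom.exists_mk x
    rfl

theorem QHom.d_mk {X Y : A.Obj} {m n : ℤ} (h : m + 1 = n) (a : Expr A S X Y m) :
    QHom.d h (.mk a) = a.d h := rfl

theorem QHom.leibniz {X Y Z : A.Obj} {p q n p' q' n' : ℤ} (h : p + q = n) (hn : n + 1 = n')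
    (hp : p + 1 = p') (hq : q + 1 = q') (hl : p' + q = n') (hr : p + q' = n')
    (b : QHom A S Y Z p) (a : QHom A S X Y q) :
    QHom.d hn (QHom.comp h b a) = QHom.comp hl (QHom.d hp b) a +
      sgn k p • QHom.comp hr b (QHom.d hq a) := by
  obtain ⟨a, rfl⟩ := QHom.exists_mk a
  obtain ⟨b, rfl⟩ := QHom.exists_mk b
  exact Expr.d_comp h hn hp hq hl hr b a

theorem QHom.d_d {X Y : A.Obj} {l m n : ℤ} (h : l + 1 = m) (h' : m + 1 = n)
    (x : QHom A S X Y l) : QHom.d h' (QHom.d h x) = 0 := by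
  obtain ⟨a, rfl⟩ := QHom.exists_mk x
  rw [QHom.d_mk]
  induction a generalizing m n with
  | of f =>
    change QHom.of S (A.d h' (A.d h f)) = 0
    rw [A.d_d, map_zero]
  | eps U hU =>
    obtain rfl : m = 0 := by omega
    change QHom.of S (A.d h' (A.id U)) = 0
    rw [A.d_id, map_zero]
  | @comp X Y Z p q r hpq b a ihb iha =>
    rw [Expr.d_comp hpq h rfl rfl (by omega) (by omega), map_add, map_smul,
      QHom.leibniz _ h' rfl rfl (by omega) (by omega),
      QHom.leibniz _ h' rfl rfl (by omega) (by omega), ihb, iha, sgn_succ,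
      QHom.d_mk, QHom.d_mk]
    simp
  | add a b iha ihb =>
    simp only [Expr.d, map_add]
    rw [iha, ihb, add_zero]
  | smul c a iha =>
    simp only [Expr.d, map_smul]
    rw [iha, smul_zero]

variable (A S) in
/-- The DG quotient `A/B`, for the full DG subcategory `B` of `A` with the set of objects `S`: it
is obtained from `A` by freely adding, for each object `U` of `B`, a morphism `ε_U : U → U` of
degree `-1` with `d ε_U = id_U`. -/
def DGCat.quotient : DGCat.{u, max u v w, w} k where
  Obj := A.Obj
  Hom := QHom A S
  id X := QHom.of S (A.id X)
  comp := QHom.comp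
  id_comp := QHom.id_comp
  comp_id := QHom.comp_id
  assoc := QHom.assoc
  d := QHom.d
  d_d := QHom.d_d
  leibniz := QHom.leibniz

end quotient

/-! ### The categories `I₂`, `K` and `A/B` -/

/-- The two objects `X₁` and `X₂`. -/
inductive Two : Type
  | x₁ : Two
  | x₂ : Two

open Two

/-- The category with two objects and precisely one morphism with any given source and target. -/
abbrev J₂ : CategoryTheory.Category.{0} Two where
  Hom _ _ := Unit
  id _ := ()
  comp _ _ := ()
  id_comp _ := rfl
  comp_id _ := rfl
  assoc _ _ _ := rfl

/-- The arrow of `A₀`. -/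
inductive ArrowGen : Two → Two → Type
  | f : ArrowGen x₁ x₂

/-- The arrows of `K`. -/
inductive KGen : Two → Two → Type
  | f : KGen x₁ x₂
  | g : KGen x₂ x₁
  | α₁ : KGen x₁ x₁
  | α₂ : KGen x₂ x₂
  | u : KGen x₁ x₂

/-- The degrees of the arrows of `K`. -/
def KGen.deg : ∀ a b : Two, KGen a b → ℤ
  | _, _, .f => 0
  | _, _, .g => 0
  | _, _, .α₁ => -1
  | _, _, .α₂ => -1
  | _, _, .u => -2

section main
variable (k : Type w) [CommRing k]

/-- The `k`-category `I₂` generated by `J₂`. -/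
def I₂ : DGCat.{0, w, w} k := DGCat.lin k J₂

/-- The morphism of degree `0` of `I₂` given by the morphism `a → b` of `J₂`. -/
def I₂.arrow (a b : Two) : (I₂ k).Hom a b 0 := Finsupp.single ⟨(), rfl⟩ (1 : k)

/-- The DG category `A₀` freely generated by `f : X₁ → X₂` of degree `0` with `df = 0`. -/
def A₀ : DGCat.{0, w, w} k :=
  DGCat.free (k := k) (E := ArrowGen) (δ := fun _ _ _ => 0) (fun _ _ _ => 0)
    (fun _ _ _ => map_zero _)

/-- The generator `f` of `A₀`. -/
def A₀.f : (A₀ k).Hom x₁ x₂ 0 := word k (fun _ _ _ => 0) (.cons ArrowGen.f .nil) rfl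

theorem A₀.f_closed : A₀.f k ∈ (A₀ k).cocycles x₁ x₂ 0 := by
  refine (freeD_word _ _ _ (rfl : (0 : ℤ) + 1 = 0 + 1)).trans ?_
  rw [dWord_cons _ _ _ rfl _ rfl (by rfl) (by rfl), dWord_nil, map_zero, LinearMap.zero_apply,
    map_zero, smul_zero, add_zero]
  rfl

/-- The differentials of the generators of `K`: `df = dg = 0`, `dα₁ = gf - 1`, `dα₂ = fg - 1`,
`du = fα₁ - α₂f`. -/
def KGen.d : ∀ (a b : Two) (e : KGen a b), FreeHom k KGen.deg a b (KGen.deg a b e + 1)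
  | _, _, .f => 0
  | _, _, .g => 0
  | _, _, .α₁ => word k KGen.deg (.cons .g (.cons .f .nil)) (by decide) -
      word k KGen.deg .nil (by decide)
  | _, _, .α₂ => word k KGen.deg (.cons .f (.cons .g .nil)) (by decide) -
      word k KGen.deg .nil (by decide)
  | _, _, .u => word k KGen.deg (.cons .f (.cons .α₁ .nil)) (by decide) -
      word k KGen.deg (.cons .α₂ (.cons .f .nil)) (by decide)

theorem KGen.dWord_cons_zero {a b c : Two} (e : KGen b c) {z : ℤ} (he : KGen.deg _ _ e = z) (hz : z = 0)
    (hd : KGen.d k _ _ e = 0) (p : Word KGen a b) {i m n : ℤ} (hi : Word.deg KGen.deg p = i)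
    (hm : i + 1 = m) (h : Word.deg KGen.deg (.cons e p) + 1 = n) (h2 : z + m = n) :
    dWord k (KGen.d k) (.cons e p) h =
      freeComp k KGen.deg h2 (word k KGen.deg (.cons e .nil) (by simp [Word.deg, he]))
        (dWord k (KGen.d k) p (by rw [hi, hm])) := by
  rw [dWord_cons (i := i) (m := m) _ _ _ hi _ (by rw [hi, hm]) (by omega) (by omega), hd, map_zero,
    LinearMap.zero_apply, zero_add, (by rw [he, hz, sgn_zero] : sgn k (KGen.deg _ _ e) = 1),
    one_smul]
  subst he
  rfl

theorem KGen.dWord_f {n : ℤ} (h : Word.deg KGen.deg (.cons KGen.f .nil) + 1 = n) :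
    dWord k (KGen.d k) (.cons KGen.f .nil) h = 0 := by
  rw [KGen.dWord_cons_zero k _ rfl rfl rfl _ rfl rfl h h, dWord_nil, map_zero]

theorem KGen.dWord_g {n : ℤ} (h : Word.deg KGen.deg (.cons KGen.g .nil) + 1 = n) :
    dWord k (KGen.d k) (.cons KGen.g .nil) h = 0 := by
  rw [KGen.dWord_cons_zero k _ rfl rfl rfl _ rfl rfl h h, dWord_nil, map_zero]

theorem KGen.dWord_gf {n : ℤ}
    (h : Word.deg KGen.deg (.cons KGen.g (.cons KGen.f .nil)) + 1 = n) :
    dWord k (KGen.d k) (.cons KGen.g (.cons KGen.f .nil)) h = 0 := by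
  rw [KGen.dWord_cons_zero k _ rfl rfl rfl _ rfl rfl h h, dWord_f, map_zero]

theorem KGen.dWord_fg {n : ℤ}
    (h : Word.deg KGen.deg (.cons KGen.f (.cons KGen.g .nil)) + 1 = n) :
    dWord k (KGen.d k) (.cons KGen.f (.cons KGen.g .nil)) h = 0 := by
  rw [KGen.dWord_cons_zero k _ rfl rfl rfl _ rfl rfl h h, dWord_g, map_zero]

theorem KGen.dWord_α₁ {n : ℤ} (h : Word.deg KGen.deg (.cons KGen.α₁ .nil) + 1 = n) (h' : n = 0)
    (h₁ : Word.deg KGen.deg (.cons KGen.g (.cons KGen.f .nil)) = n)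
    (h₂ : Word.deg KGen.deg (.nil : Word KGen x₁ x₁) = n) :
    dWord k (KGen.d k) (.cons KGen.α₁ .nil) h =
      word k KGen.deg (.cons .g (.cons .f .nil)) h₁ - word k KGen.deg .nil h₂ := by
  subst h'
  rw [dWord_cons (i := 0) (m := 1) (n := 0) _ _ _ (by decide) _ (by decide)
    (by decide) (by decide), dWord_nil, map_zero,
    smul_zero, add_zero]
  exact freeComp_nil_right (n := 0) rfl (add_zero 0) _

theorem KGen.dWord_fα₁ {n : ℤ}
    (h : Word.deg KGen.deg (.cons KGen.f (.cons KGen.α₁ .nil)) + 1 = n) (h' : n = 0)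
    (h₁ : Word.deg KGen.deg (.cons KGen.f (.cons KGen.g (.cons KGen.f .nil))) = n)
    (h₂ : Word.deg KGen.deg (.cons KGen.f .nil) = n) :
    dWord k (KGen.d k) (.cons KGen.f (.cons KGen.α₁ .nil)) h =
      word k KGen.deg (.cons KGen.f (.cons KGen.g (.cons KGen.f .nil))) h₁ -
        word k KGen.deg (.cons KGen.f .nil) h₂ := by
  rw [KGen.dWord_cons_zero (m := n) (z := 0) k _ rfl rfl rfl _ rfl (by rw [← h]; rfl) h (zero_add n),
    dWord_α₁ k _ h' (by rw [h']; rfl) (by rw [h']; rfl), map_sub, freeComp_word, freeComp_word]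
  rfl

theorem KGen.dWord_α₂f {n : ℤ}
    (h : Word.deg KGen.deg (.cons KGen.α₂ (.cons KGen.f .nil)) + 1 = n) (h' : n = 0)
    (h₁ : Word.deg KGen.deg (.cons KGen.f (.cons KGen.g (.cons KGen.f .nil))) = n)
    (h₂ : Word.deg KGen.deg (.cons KGen.f .nil) = n) :
    dWord k (KGen.d k) (.cons KGen.α₂ (.cons KGen.f .nil)) h =
      word k KGen.deg (.cons KGen.f (.cons KGen.g (.cons KGen.f .nil))) h₁ -
        word k KGen.deg (.cons KGen.f .nil) h₂ := by
  subst h'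
  rw [dWord_cons (i := 0) (m := 1) (n := 0) _ _ _ (by decide) _ (by decide)
    (by decide) (by decide), dWord_f, map_zero,
    smul_zero, add_zero]
  have e : KGen.d k _ _ KGen.α₂ = word k KGen.deg (.cons .f (.cons .g .nil)) (by decide) -
    word k KGen.deg .nil (by decide) := rfl
  rw [e, map_sub, LinearMap.sub_apply, freeComp_word, freeComp_word]
  rfl

theorem KGen.d_d (a b : Two) (e : KGen a b) :
    freeD k (KGen.d k) rfl (KGen.d k a b e) = 0 := by
  cases e
  · exact map_zero _
  · exact map_zero _
  · refine (map_sub _ _ _).trans ?_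
    rw [freeD_word, freeD_word, dWord_nil, dWord_gf, sub_zero]
  · refine (map_sub _ _ _).trans ?_
    rw [freeD_word, freeD_word, dWord_nil, dWord_fg, sub_zero]
  · refine (map_sub _ _ _).trans ?_
    rw [freeD_word, freeD_word, dWord_fα₁ k (n := KGen.deg _ _ KGen.u + 1 + 1) _ (by decide) (by decide)
      (by decide), dWord_α₂f k (n := KGen.deg _ _ KGen.u + 1 + 1) _ (by decide) (by decide)
      (by decide), sub_self]

/-- The DG category `K`. -/
def K : DGCat.{0, w, w} k := DGCat.free (KGen.d k) (KGen.d_d k)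

/-- The generators of `K` as morphisms of `K`. -/
def K.gen {a b : Two} (e : KGen a b) : (K k).Hom a b (KGen.deg a b e) :=
  word k KGen.deg (.cons e .nil) (add_zero _)

/-- `A = A₀^pretr`. -/
def A : DGCat.{w, w, w} k := (A₀ k).pretr

/-- The object `Cone(f)` of `A`. -/
def A.cone : (A k).Obj := Tw.cone (A₀.f k) (A₀.f_closed k)

/-- The DG quotient `A/B`, where `B` is the full DG subcategory of `A` with the single object
`Cone(f)`. -/
def AmodB : DGCat.{w, w, w} k := (A k).quotient {A.cone k}

/-- The objects `X₁` and `X₂` of `A/B`. -/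
def AmodB.X (a : Two) : (AmodB k).Obj := Tw.of (A := A₀ k) a

/-- The morphism `f : X₁ → X₂` of `A/B`. -/
def AmodB.f : (AmodB k).Hom (AmodB.X k x₁) (AmodB.X k x₂) 0 :=
  QHom.of (A := A k) {A.cone k} (Tw.ofHom (A₀.f k))

end main

theorem DGCat.id_mem_cocycles {k : Type w} [CommRing k] (C : DGCat.{u, v, w} k) (X : C.Obj) :
    C.id X ∈ C.cocycles X X 0 :=
  C.d_id X rfl

end DG

end

noncomputable section

namespace DG
open Two

/-! ### Transport along equalities of degrees -/

section castDeg
variable {k : Type w} [CommRing k] (A : GrCat.{u, v, w} k)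

/-! The cohomology of `K` is computed by an explicit contraction on words. The quotient `A/B` is
compared with `K` by reading morphisms of twisted complexes as matrices.

Cohomology of `K`. A word with target X₂ is 1 or f, or has one of the forms f g p, f α₁ p, α₂ p, u
p. Since d(α₂ p) = f g p - p - α₂ dp and d(u p) = f α₁ p - α₂ f p + u dp, the operator h with f g p
↦ α₂ p, f α₁ p ↦ u p and 0 on all other words satisfies id = dh + hd up to shorter words and
multiples of 1 or f (`K.homotopy_word`). By induction on length, every cocycle with target X₂ is
cohomologous to a multiple of 1 or f (`K.sub_diff_mem_base`). Target X₁ reduces to target X₂,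
because gf - 1 = dα₁ makes left multiplication by f injective on cohomology
(`K.mem_arrowWord_sup_range`). Hence Ext vanishes outside degree 0, and in degree 0 it is generated
by one class. The functor to `I₂` that kills α₁, α₂ and u sends this class to a basis vector, so the
class is a free generator and the functor is a quasi-equivalence.

Comparison with `A/B`. As a graded object Cone(f) is X₂ ⊕ X₁[1], so ε is a 2 × 2 matrix. Its entries
are, up to sign, candidates for α₂, u, g and α₁, and dε = id read entry by entry gives the
differentials prescribed in `K`. This defines K → A/B (`ConeData.functor`).

The functor is surjective on morphisms: every object of A is a graded sum of shifts of X₁ and X₂, so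
an expression in morphisms of A and ε is a matrix with entries built from f and the entries of ε
(`QHom.mem_of_splitting`). It is injective: forgetting differentials, ε is free over A, so there is
a graded functor from A/B to matrices over `K` that sends ε to the matrix with entries -α₂, -u, g,
α₁. Its composite with K → A/B is the standard embedding of `K` (`AmodB.toPretr_toAmodB`). The
statements on Ext in `A/B` are then transported from `K`. -/

theorem GrCat.castDeg_castDeg {X Y : A.Obj} {l m n : ℤ} (h : l = m) (h' : m = n)
    (f : A.Hom X Y l) : A.castDeg h' (A.castDeg h f) = A.castDeg (h.trans h') f := by
  subst h h'
  rfl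

theorem GrCat.castDeg_comp {X Y Z : A.Obj} {p q m n : ℤ} (e : m = n) (h : p + q = m)
    (b : A.Hom Y Z p) (a : A.Hom X Y q) :
    A.castDeg e (A.comp h b a) = A.comp (h.trans e) b a := by
  subst e
  rfl

theorem GrCat.comp_castDeg_left {X Y Z : A.Obj} {p p' q n : ℤ} (e : p = p') (h : p' + q = n)
    (b : A.Hom Y Z p) (a : A.Hom X Y q) :
    A.comp h (A.castDeg e b) a = A.comp (by rw [e, h]) b a := by
  subst e
  rfl

theorem GrCat.comp_castDeg_right {X Y Z : A.Obj} {p q q' n : ℤ} (e : q = q') (h : p + q' = n)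
    (b : A.Hom Y Z p) (a : A.Hom X Y q) :
    A.comp h b (A.castDeg e a) = A.comp (by rw [e, h]) b a := by
  subst e
  rfl

theorem GrCat.castDeg_bijective {X Y : A.Obj} {m n : ℤ} (e : m = n) :
    Function.Bijective (A.castDeg (X := X) (Y := Y) e) := by
  subst e
  exact Function.bijective_id

end castDeg

/-! ### Graded functors, and functors from free categories -/

/-- A graded functor from `A` to `B` with the map `φ` on objects. -/
structure GrFunctor {k : Type w} [CommRing k] (A : GrCat.{u, v, w} k) (B : GrCat.{u', v', w} k)
    (φ : A.Obj → B.Obj) where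
  map : ∀ {X Y : A.Obj} (n : ℤ), A.Hom X Y n →ₗ[k] B.Hom (φ X) (φ Y) n
  map_id : ∀ X : A.Obj, map 0 (A.id X) = B.id (φ X)
  map_comp : ∀ {X Y Z : A.Obj} {p q n : ℤ} (h : p + q = n) (b : A.Hom Y Z p) (a : A.Hom X Y q),
    map n (A.comp h b a) = B.comp h (map p b) (map q a)

section lift
variable {k : Type w} [CommRing k]

theorem GrFunctor.map_castDeg {A : GrCat.{u, v, w} k} {B : GrCat.{u', v', w} k}
    {φ : A.Obj → B.Obj} (F : GrFunctor A B φ) {X Y : A.Obj} {m n : ℤ} (e : m = n)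
    (f : A.Hom X Y m) : F.map n (A.castDeg e f) = B.castDeg e (F.map m f) := by
  subst e
  rfl

variable {V : Type u} {E : V → V → Type g} {δ : ∀ a b : V, E a b → ℤ}

/-- The value of a word, given the values of the arrows. -/
def Word.eval (B : GrCat.{u', v', w} k) {φ : V → B.Obj}
    (gen : ∀ a b (e : E a b), B.Hom (φ a) (φ b) (δ a b e)) {a : V} :
    ∀ {b : V} (p : Word E a b) {n : ℤ} (_ : Word.deg δ p = n), B.Hom (φ a) (φ b) n
  | _, .nil, _, h => B.castDeg h (B.id (φ a))
  | _, .cons e p, _, h => B.comp h (gen _ _ e) (Word.eval B gen p rfl)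

theorem Word.eval_cons (B : GrCat.{u', v', w} k) {φ : V → B.Obj}
    (gen : ∀ a b (e : E a b), B.Hom (φ a) (φ b) (δ a b e)) {a b c : V} (e : E b c)
    (p : Word E a b) {m n : ℤ} (hp : Word.deg δ p = m) (h : Word.deg δ (.cons e p) = n)
    (h' : δ _ _ e + m = n) :
    Word.eval B gen (.cons e p) h = B.comp h' (gen _ _ e) (Word.eval B gen p hp) := by
  subst hp
  rfl

theorem Word.eval_comp (B : GrCat.{u', v', w} k) {φ : V → B.Obj}
    (gen : ∀ a b (e : E a b), B.Hom (φ a) (φ b) (δ a b e)) {a b c : V} (p : Word E a b)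
    (q : Word E b c) {l m n : ℤ} (hp : Word.deg δ p = l) (hq : Word.deg δ q = m)
    (h : Word.deg δ (p.comp q) = n) (h' : m + l = n) :
    Word.eval B gen (p.comp q) h = B.comp h' (Word.eval B gen q hq) (Word.eval B gen p hp) := by
  induction q generalizing m n with
  | nil =>
    obtain rfl : 0 = m := hq
    obtain rfl : l = n := by omega
    exact (B.id_comp h' _).symm
  | cons e q ih =>
    have hc : δ _ _ e + Word.deg δ q = m := hq
    have hl : Word.deg δ (p.comp q) = Word.deg δ q + l := by rw [Word.deg_comp, hp, add_comm]
    refine (Word.eval_cons B gen e (p.comp q) hl h (by omega)).trans ?_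
    rw [ih rfl hl rfl,
      Word.eval_cons B gen e q rfl hq hc, B.assoc]

/-- The linear extension of the evaluation of words. -/
def freeEval (B : GrCat.{u', v', w} k) {φ : V → B.Obj}
    (gen : ∀ a b (e : E a b), B.Hom (φ a) (φ b) (δ a b e)) {a b : V} (n : ℤ) :
    FreeHom k δ a b n →ₗ[k] B.Hom (φ a) (φ b) n :=
  Finsupp.linearCombination k
    fun p : {p : Word E a b // Word.deg δ p = n} => Word.eval B gen p.1 p.2

theorem freeEval_word (B : GrCat.{u', v', w} k) {φ : V → B.Obj}
    (gen : ∀ a b (e : E a b), B.Hom (φ a) (φ b) (δ a b e)) {a b : V} (p : Word E a b) {n : ℤ}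
    (h : Word.deg δ p = n) : freeEval B gen n (word k δ p h) = Word.eval B gen p h :=
  (Finsupp.linearCombination_single k _ _).trans (one_smul k _)

theorem freeEval_gen (B : GrCat.{u', v', w} k) {φ : V → B.Obj}
    (gen : ∀ a b (e : E a b), B.Hom (φ a) (φ b) (δ a b e)) {a b : V} (e : E a b)
    (h : Word.deg δ (.cons e .nil) = δ a b e) :
    freeEval B gen _ (word k δ (.cons e .nil) h) = gen a b e := by
  rw [freeEval_word, Word.eval_cons B gen e .nil rfl h (add_zero _)]
  exact B.comp_id _ _

theorem freeEval_comp (B : GrCat.{u', v', w} k) {φ : V → B.Obj}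
    (gen : ∀ a b (e : E a b), B.Hom (φ a) (φ b) (δ a b e)) {a b c : V} {p q n : ℤ} (h : p + q = n)
    (y : FreeHom k δ b c p) (x : FreeHom k δ a b q) :
    freeEval B gen n (freeComp k δ h y x) =
      B.comp h (freeEval B gen p y) (freeEval B gen q x) := by
  induction x using FreeHom.induction with
  | zero => simp
  | add x x' hx hx' => simp only [map_add, hx, hx']
  | smul s x hx =>
    induction y using FreeHom.induction with
    | zero => simp
    | add y y' hy hy' => simp only [map_add, LinearMap.add_apply, hy, hy']
    | smul t y hy =>
      simp only [map_smul, LinearMap.smul_apply, freeComp_word, freeEval_word]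
      rw [Word.eval_comp B gen x y hx hy _ h]

/-- The graded functor from a free graded category with prescribed values on the arrows. -/
def GrFunctor.ofFree (B : GrCat.{u', v', w} k) {φ : V → B.Obj}
    (gen : ∀ a b (e : E a b), B.Hom (φ a) (φ b) (δ a b e)) :
    GrFunctor (GrCat.free k δ) B φ where
  map n := freeEval B gen n
  map_id _ := freeEval_word B gen .nil rfl
  map_comp h y x := freeEval_comp B gen h y x

/-- Both sides obey the Leibniz rule along a word and vanish on the empty word, so agreement on
single arrows, which is `hgen`, propagates by induction. -/
theorem freeEval_dWord {dgen : ∀ (a b : V) (e : E a b), FreeHom k δ a b (δ a b e + 1)}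
    (B : DGCat.{u', v', w} k) {φ : V → B.Obj}
    (gen : ∀ a b (e : E a b), B.Hom (φ a) (φ b) (δ a b e))
    (hgen : ∀ a b (e : E a b), freeEval B.toGrCat gen _ (dgen a b e) = B.d rfl (gen a b e))
    {a b : V} (p : Word E a b) {m n : ℤ} (hm : Word.deg δ p = m) (h : m + 1 = n) :
    freeEval B.toGrCat gen n (dWord k dgen p (by rw [hm, h])) =
      B.d h (Word.eval B.toGrCat gen p hm) := by
  induction p generalizing m n with
  | nil =>
    obtain rfl : 0 = m := hm
    rw [dWord_nil, map_zero]
    exact (B.d_id _ h).symm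
  | cons e p ih =>
    have hm' : δ _ _ e + Word.deg δ p = m := hm
    rw [dWord_cons dgen e p rfl _ rfl (by omega) (by omega),
      Word.eval_cons B.toGrCat gen e p rfl hm hm',
      B.leibniz hm' h rfl rfl (by omega) (by omega), map_add, map_smul, freeEval_comp,
      freeEval_comp, hgen, freeEval_word, freeEval_gen, ih rfl rfl]

theorem freeEval_freeD {dgen : ∀ (a b : V) (e : E a b), FreeHom k δ a b (δ a b e + 1)}
    (B : DGCat.{u', v', w} k) {φ : V → B.Obj}
    (gen : ∀ a b (e : E a b), B.Hom (φ a) (φ b) (δ a b e))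
    (hgen : ∀ a b (e : E a b), freeEval B.toGrCat gen _ (dgen a b e) = B.d rfl (gen a b e))
    {a b : V} {m n : ℤ} (h : m + 1 = n) (x : FreeHom k δ a b m) :
    freeEval B.toGrCat gen n (freeD k dgen h x) = B.d h (freeEval B.toGrCat gen m x) := by
  induction x using FreeHom.induction with
  | zero => simp
  | add x x' hx hx' => simp only [map_add, hx, hx']
  | smul s x hx =>
    rw [map_smul, map_smul, map_smul, map_smul, freeD_word,
      freeEval_dWord B gen hgen x hx h, freeEval_word]

/-- The DG functor from a free DG category with prescribed values on the arrows, compatible with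
the differentials. -/
def DGFunctor.ofFree {dgen : ∀ (a b : V) (e : E a b), FreeHom k δ a b (δ a b e + 1)}
    (hd : ∀ (a b : V) (e : E a b), freeD k dgen rfl (dgen a b e) = 0)
    (B : DGCat.{u', v', w} k) {φ : V → B.Obj}
    (gen : ∀ a b (e : E a b), B.Hom (φ a) (φ b) (δ a b e))
    (hgen : ∀ a b (e : E a b), freeEval B.toGrCat gen _ (dgen a b e) = B.d rfl (gen a b e)) :
    DGFunctor (DGCat.free dgen hd) B φ where
  map n := freeEval B.toGrCat gen n
  map_id _ := freeEval_word B.toGrCat gen .nil rfl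
  map_comp h y x := freeEval_comp B.toGrCat gen h y x
  map_d h x := freeEval_freeD B gen hgen h x

end lift

/-! ### Functors from a DG quotient -/

section quotientLift
variable {k : Type w} [CommRing k] {A : DGCat.{u, v, w} k} {S : Set A.Obj}
  {B : GrCat.{u', v', w} k} {φ : A.Obj → B.Obj}

/-- The value of an expression, given the values of the morphisms of `A` and of the `ε_U`. -/
def Expr.eval (F : GrFunctor A.toGrCat B φ) (e : ∀ U ∈ S, B.Hom (φ U) (φ U) (-1)) :
    ∀ {X Y : A.Obj} {n : ℤ}, Expr A S X Y n → B.Hom (φ X) (φ Y) n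
  | _, _, n, .of f => F.map n f
  | _, _, _, .eps U hU => e U hU
  | _, _, _, .comp h b a => B.comp h (b.eval F e) (a.eval F e)
  | _, _, _, .add a b => a.eval F e + b.eval F e
  | _, _, _, .smul c a => c • a.eval F e

/-- Each relation is an axiom of graded `k`-categories or expresses that `F` is a functor. None of
them constrains the `ε_U`, so the values `e` may be arbitrary; this freeness is what later yields
injectivity of K → A/B. -/
theorem Expr.Rel.eval (F : GrFunctor A.toGrCat B φ) (e : ∀ U ∈ S, B.Hom (φ U) (φ U) (-1))
    {X Y : A.Obj} {n : ℤ} {a b : Expr A S X Y n} (hab : Expr.Rel a b) :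
    a.eval F e = b.eval F e := by
  induction hab with
  | refl a => rfl
  | symm _ ih => exact ih.symm
  | trans _ _ ih ih' => exact ih.trans ih'
  | comp_congr h _ _ ih ih' => simp only [Expr.eval, ih, ih']
  | add_congr _ _ ih ih' => simp only [Expr.eval, ih, ih']
  | smul_congr c _ ih => simp only [Expr.eval, ih]
  | add_assoc a b c => exact _root_.add_assoc _ _ _
  | add_comm a b => exact _root_.add_comm _ _
  | zero_add a => simp only [Expr.eval, map_zero, _root_.zero_add]
  | zero_smul a => simp only [Expr.eval, map_zero, _root_.zero_smul]
  | one_smul a => exact _root_.one_smul _ _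
  | mul_smul c c' a => exact SemigroupAction.mul_smul _ _ _
  | smul_add c a b => exact _root_.smul_add _ _ _
  | add_smul c c' a => exact _root_.add_smul _ _ _
  | of_add f g => exact map_add _ _ _
  | of_smul c f => exact map_smul _ _ _
  | of_comp h b a => exact F.map_comp h b a
  | id_comp h a => simp only [Expr.eval, F.map_id, B.id_comp]
  | comp_id h a => simp only [Expr.eval, F.map_id, B.comp_id]
  | assoc hpq hqr hs ht c b a => exact B.assoc hpq hqr hs ht _ _ _
  | add_comp h b b' a => simp only [Expr.eval, map_add, LinearMap.add_apply]
  | comp_add h b a a' => simp only [Expr.eval, map_add]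
  | smul_comp h c b a => simp only [Expr.eval, map_smul, LinearMap.smul_apply]
  | comp_smul h c b a => simp only [Expr.eval, map_smul]

/-- The graded functor from a DG quotient given by a graded functor from `A` and the values of
the `ε_U`. -/
def GrFunctor.ofQuotient (F : GrFunctor A.toGrCat B φ)
    (e : ∀ U ∈ S, B.Hom (φ U) (φ U) (-1)) : GrFunctor (A.quotient S).toGrCat B φ where
  map n :=
    { toFun := Quotient.lift (fun a => a.eval F e) fun _ _ hab => Expr.Rel.eval F e hab
      map_add' := fun x y => by
        obtain ⟨x, rfl⟩ := QHom.exists_mk x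
        obtain ⟨y, rfl⟩ := QHom.exists_mk y
        rfl
      map_smul' := fun c x => by
        obtain ⟨x, rfl⟩ := QHom.exists_mk x
        rfl }
  map_id X := F.map_id X
  map_comp h b a := by
    obtain ⟨a, rfl⟩ := QHom.exists_mk a
    obtain ⟨b, rfl⟩ := QHom.exists_mk b
    rfl

/-- The morphism `ε_U` of the DG quotient. -/
def QHom.eps (U : A.Obj) (hU : U ∈ S) : QHom A S U U (-1) := .mk (.eps U hU)

end quotientLift

/-! ### Left multiplication by the generators of `K` -/

namespace K
variable (k : Type w) [CommRing k]

/-- The differential of `K`. -/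
abbrev diff {a b : Two} {m n : ℤ} (h : m + 1 = n) :
    FreeHom k KGen.deg a b m →ₗ[k] FreeHom k KGen.deg a b n := freeD k (KGen.d k) h

theorem deg_single {a b : Two} (e : KGen a b) :
    Word.deg KGen.deg (.cons e .nil) = KGen.deg _ _ e := by simp [Word.deg]

theorem deg_cons {a b c : Two} (e : KGen b c) {p : Word KGen a b} {m n : ℤ}
    (hp : Word.deg KGen.deg p = m) (h : KGen.deg _ _ e + m = n) :
    Word.deg KGen.deg (.cons e p) = n := by
  rw [Word.deg, hp, h]

/-- Left multiplication by a generator. -/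
def lmul {a b c : Two} (e : KGen b c) {m n : ℤ} (h : KGen.deg _ _ e + m = n) :
    FreeHom k KGen.deg a b m →ₗ[k] FreeHom k KGen.deg a c n :=
  freeComp k KGen.deg h (word k KGen.deg (.cons e .nil) (deg_single e))

theorem lmul_word {a b c : Two} (e : KGen b c) {m n : ℤ} (h : KGen.deg _ _ e + m = n)
    (p : Word KGen a b) (hp : Word.deg KGen.deg p = m) :
    lmul k e h (word k KGen.deg p hp) = word k KGen.deg (.cons e p) (deg_cons e hp h) :=
  freeComp_word _ _ _ _ _

theorem freeComp_pair {a b c d : Two} (e : KGen c d) (e' : KGen b c) {j l m n : ℤ}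
    (hq : Word.deg KGen.deg (.cons e (.cons e' .nil)) = l) (h : l + m = n)
    (hj : KGen.deg _ _ e' + m = j) (h' : KGen.deg _ _ e + j = n) (x : FreeHom k KGen.deg a b m) :
    freeComp k KGen.deg h (word k KGen.deg (.cons e (.cons e' .nil)) hq) x =
      lmul k e h' (lmul k e' hj x) := by
  have hl : KGen.deg _ _ e + KGen.deg _ _ e' = l := by rw [← hq, Word.deg, deg_single]
  rw [lmul, lmul, ← freeComp_assoc (hpq := hl) (hs := h), freeComp_word]
  rfl

theorem dWord_gen {a b : Two} (e : KGen a b) {n : ℤ}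
    (h : Word.deg KGen.deg (.cons e .nil) + 1 = n) (h' : KGen.deg _ _ e + 1 = n) :
    dWord k (KGen.d k) (.cons e .nil) h = (GrCat.free k KGen.deg).castDeg h' (KGen.d k _ _ e) := by
  subst h'
  rw [dWord_cons (i := 0) (m := 1) (n := KGen.deg _ _ e + 1) _ _ _ rfl _ (by simp [Word.deg])
    (add_zero _) rfl, dWord_nil, map_zero, smul_zero, add_zero]
  exact freeComp_nil_right rfl (add_zero _) _

/-- Leibniz rule with respect to the leftmost letter. Every nonempty word has such a letter, so the
specializations below determine the differential recursively, without unfolding words. -/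
theorem diff_lmul {a b c : Two} (e : KGen b c) {m n m' n' : ℤ} (h : KGen.deg _ _ e + m = n)
    (hm : m + 1 = m') (hn : n + 1 = n') (h' : KGen.deg _ _ e + m' = n')
    (h'' : KGen.deg _ _ e + 1 + m = n') (x : FreeHom k KGen.deg a b m) :
    diff k hn (lmul k e h x) = freeComp k KGen.deg h'' (KGen.d k _ _ e) x +
      sgn k (KGen.deg _ _ e) • lmul k e h' (diff k hm x) := by
  rw [lmul, freeD_leibniz (hp := rfl) (hq := hm) (hl := h'') (hr := h'), freeD_word (KGen.d k) _ (deg_single e),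
    dWord_gen k e _ rfl]
  rfl

section
variable {k} {a : Two} {m n m' n' : ℤ}

theorem diff_f (h : KGen.deg _ _ .f + m = n) (hm : m + 1 = m') (hn : n + 1 = n')
    (h' : KGen.deg _ _ .f + m' = n') (x : FreeHom k KGen.deg a x₁ m) :
    diff k hn (lmul k .f h x) = lmul k .f h' (diff k hm x) := by
  rw [diff_lmul k _ h hm hn h' (by omega)]
  rw [show KGen.d k _ _ .f = 0 from rfl, map_zero, LinearMap.zero_apply, zero_add]
  simp [KGen.deg]

theorem diff_g (h : KGen.deg _ _ .g + m = n) (hm : m + 1 = m') (hn : n + 1 = n')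
    (h' : KGen.deg _ _ .g + m' = n') (x : FreeHom k KGen.deg a x₂ m) :
    diff k hn (lmul k .g h x) = lmul k .g h' (diff k hm x) := by
  rw [diff_lmul k _ h hm hn h' (by omega)]
  rw [show KGen.d k _ _ .g = 0 from rfl, map_zero, LinearMap.zero_apply, zero_add]
  simp [KGen.deg]

theorem comp_dα₁ (h₀ : KGen.deg _ _ .α₁ + 1 + m = m) (hf : KGen.deg _ _ .f + m = m)
    (hg : KGen.deg _ _ .g + m = m) (x : FreeHom k KGen.deg a x₁ m) :
    freeComp k KGen.deg h₀ (KGen.d k _ _ .α₁) x = lmul k .g hg (lmul k .f hf x) - x := by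
  have e : KGen.d k _ _ .α₁ = word k KGen.deg (.cons .g (.cons .f .nil)) (by decide) -
    word k KGen.deg .nil (by decide) := rfl
  rw [e, map_sub, LinearMap.sub_apply, freeComp_nil, freeComp_pair k _ _ _ _ hf hg]

theorem comp_dα₂ (h₀ : KGen.deg _ _ .α₂ + 1 + m = m) (hf : KGen.deg _ _ .f + m = m)
    (hg : KGen.deg _ _ .g + m = m) (x : FreeHom k KGen.deg a x₂ m) :
    freeComp k KGen.deg h₀ (KGen.d k _ _ .α₂) x = lmul k .f hf (lmul k .g hg x) - x := by
  have e : KGen.d k _ _ .α₂ = word k KGen.deg (.cons .f (.cons .g .nil)) (by decide) -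
    word k KGen.deg .nil (by decide) := rfl
  rw [e, map_sub, LinearMap.sub_apply, freeComp_nil, freeComp_pair k _ _ _ _ hg hf]

theorem comp_du (h₀ : KGen.deg _ _ .u + 1 + m = n) (hα₁ : KGen.deg _ _ .α₁ + m = n)
    (hf : KGen.deg _ _ .f + n = n) (hf' : KGen.deg _ _ .f + m = m)
    (hα₂ : KGen.deg _ _ .α₂ + m = n) (x : FreeHom k KGen.deg a x₁ m) :
    freeComp k KGen.deg h₀ (KGen.d k _ _ .u) x =
      lmul k .f hf (lmul k .α₁ hα₁ x) - lmul k .α₂ hα₂ (lmul k .f hf' x) := by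
  have e : KGen.d k _ _ .u = word k KGen.deg (.cons .f (.cons .α₁ .nil)) (by decide) -
    word k KGen.deg (.cons .α₂ (.cons .f .nil)) (by decide) := rfl
  rw [e, map_sub, LinearMap.sub_apply, freeComp_pair k _ _ _ _ hα₁ hf,
    freeComp_pair k _ _ _ _ hf' hα₂]

theorem diff_α₁ (h : KGen.deg _ _ .α₁ + m = n) (hm : m + 1 = m') (hn : n + 1 = m)
    (h' : KGen.deg _ _ .α₁ + m' = m) (hf : KGen.deg _ _ .f + m = m)
    (hg : KGen.deg _ _ .g + m = m) (x : FreeHom k KGen.deg a x₁ m) :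
    diff k hn (lmul k .α₁ h x) =
      lmul k .g hg (lmul k .f hf x) - x - lmul k .α₁ h' (diff k hm x) := by
  rw [diff_lmul k _ h hm hn h' (by omega), comp_dα₁ _ hf hg]
  simp [KGen.deg, sub_eq_add_neg]

theorem diff_α₂ (h : KGen.deg _ _ .α₂ + m = n) (hm : m + 1 = m') (hn : n + 1 = m)
    (h' : KGen.deg _ _ .α₂ + m' = m) (hf : KGen.deg _ _ .f + m = m)
    (hg : KGen.deg _ _ .g + m = m) (x : FreeHom k KGen.deg a x₂ m) :
    diff k hn (lmul k .α₂ h x) =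
      lmul k .f hf (lmul k .g hg x) - x - lmul k .α₂ h' (diff k hm x) := by
  rw [diff_lmul k _ h hm hn h' (by omega), comp_dα₂ _ hf hg]
  simp [KGen.deg, sub_eq_add_neg]

theorem diff_u (h : KGen.deg _ _ .u + m = n) (hm : m + 1 = m') (hn : n + 1 = n')
    (h' : KGen.deg _ _ .u + m' = n') (hα₁ : KGen.deg _ _ .α₁ + m = n')
    (hf : KGen.deg _ _ .f + n' = n') (hf' : KGen.deg _ _ .f + m = m)
    (hα₂ : KGen.deg _ _ .α₂ + m = n') (x : FreeHom k KGen.deg a x₁ m) :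
    diff k hn (lmul k .u h x) = lmul k .f hf (lmul k .α₁ hα₁ x) -
      lmul k .α₂ hα₂ (lmul k .f hf' x) + lmul k .u h' (diff k hm x) := by
  rw [diff_lmul k _ h hm hn h' (by omega), comp_du _ hα₁ hf hf' hα₂,
    (show sgn k (KGen.deg _ _ .u) = 1 by simp [KGen.deg, sgn]), one_smul]

end

/-! ### A homotopy on the morphisms of `K` with target `X₂` -/

/-- The homotopy on words: `f g p ↦ α₂ p`, `f α₁ p ↦ u p`, and `0` on the other words. -/
def contrWord {a : Two} : ∀ {b : Two} (p : Word KGen a b) {m : ℤ}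
    (_ : m + 1 = Word.deg KGen.deg p), FreeHom k KGen.deg a b m
  | _, .cons .f (.cons .g p), _, h => word k KGen.deg (.cons .α₂ p) (by
      simp only [Word.deg, KGen.deg] at h ⊢; omega)
  | _, .cons .f (.cons .α₁ p), _, h => word k KGen.deg (.cons .u p) (by
      simp only [Word.deg, KGen.deg] at h ⊢; omega)
  | _, _, _, _ => 0

/-- The homotopy `f g p ↦ α₂ p`, `f α₁ p ↦ u p`. -/
def contr {a b : Two} {m n : ℤ} (h : m + 1 = n) :
    FreeHom k KGen.deg a b n →ₗ[k] FreeHom k KGen.deg a b m :=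
  Finsupp.linearCombination k fun p : {p : Word KGen a b // Word.deg KGen.deg p = n} =>
    contrWord k p.1 (h.trans p.2.symm)

theorem contr_word {a b : Two} {m n : ℤ} (h : m + 1 = n) (p : Word KGen a b)
    (hp : Word.deg KGen.deg p = n) :
    contr k h (word k KGen.deg p hp) = contrWord k p (h.trans hp.symm) :=
  (Finsupp.linearCombination_single k _ _).trans (one_smul k _)

section
variable {k} {a : Two} {l m n : ℤ}

/-- The rules for `contr` look only at the two leftmost letters, so they extend linearly in the
remaining factor. This matters because `x` will also be a differential, which is not a single word.
-/
theorem contr_f_g (h : l + 1 = n) (hf : KGen.deg _ _ .f + m = n)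
    (hg : KGen.deg _ _ .g + m = m) (hα₂ : KGen.deg _ _ .α₂ + m = l)
    (x : FreeHom k KGen.deg a x₂ m) :
    contr k h (lmul k .f hf (lmul k .g hg x)) = lmul k .α₂ hα₂ x := by
  induction x using FreeHom.induction with
  | zero => simp only [map_zero]
  | add x y hx hy => simp only [map_add, hx, hy]
  | smul c p hp =>
    simp only [map_smul]
    rw [lmul_word, lmul_word, contr_word,
      lmul_word]
    rfl

theorem contr_f_α₁ (h : l + 1 = n) (hf : KGen.deg _ _ .f + n = n)
    (hα₁ : KGen.deg _ _ .α₁ + m = n) (hu : KGen.deg _ _ .u + m = l)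
    (x : FreeHom k KGen.deg a x₁ m) :
    contr k h (lmul k .f hf (lmul k .α₁ hα₁ x)) = lmul k .u hu x := by
  induction x using FreeHom.induction with
  | zero => simp only [map_zero]
  | add x y hx hy => simp only [map_add, hx, hy]
  | smul c p hp =>
    simp only [map_smul]
    rw [lmul_word, lmul_word, contr_word,
      lmul_word]
    rfl

theorem contr_α₂ (h : l + 1 = n) (hα₂ : KGen.deg _ _ .α₂ + m = n)
    (x : FreeHom k KGen.deg a x₂ m) : contr k h (lmul k .α₂ hα₂ x) = 0 := by
  induction x using FreeHom.induction with
  | zero => simp only [map_zero]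
  | add x y hx hy => simp only [map_add, hx, hy, add_zero]
  | smul c p hp =>
    rw [map_smul, map_smul, lmul_word, contr_word]
    exact smul_zero c

theorem contr_u (h : l + 1 = n) (hu : KGen.deg _ _ .u + m = n)
    (x : FreeHom k KGen.deg a x₁ m) : contr k h (lmul k .u hu x) = 0 := by
  induction x using FreeHom.induction with
  | zero => simp only [map_zero]
  | add x y hx hy => simp only [map_add, hx, hy, add_zero]
  | smul c p hp =>
    rw [map_smul, map_smul, lmul_word, contr_word]
    exact smul_zero c

end

end K

/-- The length of a word. -/
def Word.length {V : Type u} {E : V → V → Type g} {a : V} : ∀ {b : V}, Word E a b → ℕ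
  | _, .nil => 0
  | _, .cons _ p => p.length + 1

/-! ### Filtration by word length and the cocycles of `K` -/

namespace K
variable (k : Type w) [CommRing k]

/-- The span of the words of length less than `L`. -/
def fil (a b : Two) (n : ℤ) (L : ℕ) : Submodule k (FreeHom k KGen.deg a b n) :=
  Submodule.span k {y | ∃ (p : Word KGen a b) (hp : Word.deg KGen.deg p = n),
    p.length < L ∧ word k KGen.deg p hp = y}

theorem word_mem_fil {a b : Two} {n : ℤ} {L : ℕ} (p : Word KGen a b)
    (hp : Word.deg KGen.deg p = n) (hL : p.length < L) :
    word k KGen.deg p hp ∈ fil k a b n L :=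
  Submodule.subset_span ⟨p, hp, hL, rfl⟩

theorem fil_mono {a b : Two} {n : ℤ} {L L' : ℕ} (h : L ≤ L') : fil k a b n L ≤ fil k a b n L' :=
  Submodule.span_mono fun _ ⟨p, hp, hL, e⟩ => ⟨p, hp, hL.trans_le h, e⟩

theorem exists_mem_fil {a b : Two} {n : ℤ} (x : FreeHom k KGen.deg a b n) :
    ∃ L, x ∈ fil k a b n L := by
  induction x using FreeHom.induction with
  | zero => exact ⟨0, zero_mem _⟩
  | add x y hx hy =>
    obtain ⟨L, hL⟩ := hx
    obtain ⟨L', hL'⟩ := hy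
    exact ⟨max L L', add_mem (fil_mono k (le_max_left _ _) hL) (fil_mono k (le_max_right _ _) hL')⟩
  | smul c p hp => exact ⟨p.length + 1, Submodule.smul_mem _ _ (word_mem_fil k p hp (by omega))⟩

/-- Both nonzero rules replace two letters by one, so the length drops by exactly one. -/
theorem contrWord_mem_fil : ∀ {a b : Two} (p : Word KGen a b) {m : ℤ}
    (h : m + 1 = Word.deg KGen.deg p) {L : ℕ} (_ : p.length < L + 1),
    contrWord k p h ∈ fil k a b m L
  | _, _, .cons .f (.cons .g p), _, _, _, hL => word_mem_fil k _ _ (by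
      simp only [Word.length] at hL ⊢; omega)
  | _, _, .cons .f (.cons .α₁ p), _, _, _, hL => word_mem_fil k _ _ (by
      simp only [Word.length] at hL ⊢; omega)
  | _, _, .nil, _, _, _, _ => zero_mem _
  | _, _, .cons .f .nil, _, _, _, _ => zero_mem _
  | _, _, .cons .g _, _, _, _, _ => zero_mem _
  | _, _, .cons .α₁ _, _, _, _, _ => zero_mem _
  | _, _, .cons .α₂ _, _, _, _, _ => zero_mem _
  | _, _, .cons .u _, _, _, _, _ => zero_mem _

theorem contr_mem_fil {a b : Two} {m n : ℤ} (h : m + 1 = n) {L : ℕ}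
    {x : FreeHom k KGen.deg a b n} (hx : x ∈ fil k a b n (L + 1)) :
    contr k h x ∈ fil k a b m L := by
  refine (Submodule.span_le.2 ?_ : fil k a b n (L + 1) ≤ (fil k a b m L).comap (contr k h)) hx
  rintro _ ⟨p, hp, hL, rfl⟩
  change contr k h (word k KGen.deg p hp) ∈ fil k a b m L
  rw [contr_word]
  exact contrWord_mem_fil k p _ hL

/-- The word `1` or `f` with target `X₂`. -/
def toX₂ : ∀ a : Two, Word KGen a x₂
  | x₁ => .cons .f .nil
  | x₂ => .nil

/-- The span of the word `1` or `f` with target `X₂`. -/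
def base (a : Two) (n : ℤ) : Submodule k (FreeHom k KGen.deg a x₂ n) :=
  Submodule.span k {y | ∃ h, y = word k KGen.deg (toX₂ a) h}

theorem diff_base {a : Two} {m n : ℤ} (h : m + 1 = n) {x : FreeHom k KGen.deg a x₂ m}
    (hx : x ∈ base k a m) : diff k h x = 0 := by
  refine (Submodule.span_le.2 ?_ : base k a m ≤ LinearMap.ker (diff (a := a) (b := x₂) k h)) hx
  rintro _ ⟨hp, rfl⟩
  change diff k h _ = 0
  rw [freeD_word]
  cases a
  · exact KGen.dWord_f k _
  · exact dWord_nil _ _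

/-- The contraction inverts the leading terms f g p of d(α₂ p) and f α₁ p of d(u p). What is left
over is strictly shorter, except for the words 1 and f, on which both the differential and the
contraction vanish. -/
theorem homotopy_word {a : Two} {l n n' : ℤ} (hl : l + 1 = n) (hn : n + 1 = n') {L : ℕ}
    (p : Word KGen a x₂) (hp : Word.deg KGen.deg p = n) (hL : p.length < L + 1) :
    word k KGen.deg p hp - diff k hl (contr k hl (word k KGen.deg p hp)) -
      contr k hn (diff k hn (word k KGen.deg p hp)) ∈ fil k a x₂ n L ⊔ base k a n := by
  match a, p with
  | _, .nil =>
    rw [contr_word, freeD_word, dWord_nil]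
    simp only [contrWord, map_zero, sub_zero]
    exact Submodule.mem_sup_right (Submodule.subset_span ⟨hp, rfl⟩)
  | _, .cons .f .nil =>
    rw [contr_word, freeD_word, KGen.dWord_f]
    simp only [contrWord, map_zero, sub_zero]
    exact Submodule.mem_sup_right (Submodule.subset_span ⟨hp, rfl⟩)
  | a, .cons .f (.cons .g p) =>
    refine Submodule.mem_sup_left ?_
    obtain ⟨i, hi⟩ : ∃ i, Word.deg KGen.deg p = i := ⟨_, rfl⟩
    have h₁ : KGen.deg _ _ .f + i = n := by
      simp only [← hp, ← hi, Word.deg, KGen.deg]; omega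
    obtain rfl : i = n := by simpa [KGen.deg] using h₁
    have h₀ : KGen.deg _ _ .g + i = i := h₁
    rw [← lmul_word k .f h₁ _ (deg_cons _ hi h₀), ← lmul_word k .g h₀ p hi]
    have h₂ : KGen.deg _ _ .α₂ + i = l := by simp only [KGen.deg]; omega
    have h₃ : KGen.deg _ _ .f + n' = n' := by simp only [KGen.deg]; omega
    have h₄ : KGen.deg _ _ .α₂ + n' = i := by simp only [KGen.deg]; omega
    rw [contr_f_g hl h₁ h₀ h₂, diff_α₂ h₂ hn hl h₄ h₁ h₀, diff_f h₁ hn hn h₃,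
      diff_g h₀ hn hn h₃, contr_f_g hn h₃ h₃ h₄]
    -- X = f g p, Y = p, Z = α₂ dp: the remainder is p itself, two letters shorter.
    have : ∀ X Y Z : FreeHom k KGen.deg a x₂ i, X - (X - Y - Z) - Z = Y := fun X Y Z => by abel
    rw [this]
    exact word_mem_fil k p hi (by simp only [Word.length] at hL; omega)
  | a, .cons .f (.cons .α₁ p) =>
    refine Submodule.mem_sup_left ?_
    obtain ⟨i, hi⟩ : ∃ i, Word.deg KGen.deg p = i := ⟨_, rfl⟩
    have h₁ : KGen.deg _ _ .α₁ + i = n := by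
      simp only [← hp, ← hi, Word.deg, KGen.deg]; omega
    obtain rfl : n' = i := by simp only [KGen.deg] at h₁; omega
    have h₂ : KGen.deg _ _ .f + n = n := by simp only [KGen.deg]; omega
    have h₃ : KGen.deg _ _ .f + n' = n' := by simp only [KGen.deg]; omega
    have h₄ : KGen.deg _ _ .u + n' = l := by simp only [KGen.deg]; omega
    have h₅ : KGen.deg _ _ .u + (n' + 1) = n := by simp only [KGen.deg]; omega
    have h₆ : KGen.deg _ _ .α₂ + n' = n := by simp only [KGen.deg]; omega
    have h₇ : KGen.deg _ _ .α₁ + (n' + 1) = n' := by simp only [KGen.deg]; omega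
    rw [← lmul_word k .f h₂ _ (deg_cons _ hi h₁), ← lmul_word k .α₁ h₁ p hi,
      contr_f_α₁ hl h₂ h₁ h₄, diff_u h₄ rfl hl h₅ h₁ h₂ h₃ h₆, diff_f h₂ hn hn h₃,
      diff_α₁ h₁ rfl hn h₇ h₃ h₃, map_sub, map_sub, map_sub, map_sub, contr_f_g hn h₃ h₃ h₆,
      contr_f_α₁ hn h₃ h₇ h₅]
    -- X = f α₁ p, Y = α₂ f p, Z = u dp, T = h(f p) with h the contraction. The terms Y cancel
    -- because du contains -α₂ f while h(f g f p) = α₂ f p. The remainder h(f p) is short, since f p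
    -- has one letter less than f α₁ p and h removes another.
    have : ∀ X Y Z T : FreeHom k KGen.deg a x₂ n, X - (X - Y + Z) - (Y - T - Z) = T :=
      fun X Y Z T => by abel
    rw [this, lmul_word k .f h₃ p hi]
    exact contr_mem_fil k hn (word_mem_fil k _ _ (by simp only [Word.length] at hL ⊢; omega))
  | a, .cons .α₂ p =>
    refine Submodule.mem_sup_left ?_
    obtain ⟨i, hi⟩ : ∃ i, Word.deg KGen.deg p = i := ⟨_, rfl⟩
    have h₁ : KGen.deg _ _ .α₂ + i = n := by
      simp only [← hp, ← hi, Word.deg]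
    obtain rfl : n' = i := by simp only [KGen.deg] at h₁; omega
    have h₃ : KGen.deg _ _ .f + n' = n' := by simp only [KGen.deg]; omega
    have h₇ : KGen.deg _ _ .α₂ + (n' + 1) = n' := by simp only [KGen.deg]; omega
    -- The contraction kills α₂ p and takes d(α₂ p) = f g p - p - α₂ dp to α₂ p - h(p), so the
    -- remainder is h(p).
    rw [← lmul_word k .α₂ h₁ p hi, contr_α₂, map_zero, sub_zero, diff_α₂ h₁ rfl hn h₇ h₃ h₃,
      map_sub, map_sub, contr_f_g hn h₃ h₃ h₁, contr_α₂, sub_zero, sub_sub_cancel]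
    exact contr_mem_fil k hn (word_mem_fil k _ _ (by simp only [Word.length] at hL ⊢; omega))
  | a, .cons .u p =>
    refine Submodule.mem_sup_left ?_
    obtain ⟨i, hi⟩ : ∃ i, Word.deg KGen.deg p = i := ⟨_, rfl⟩
    have h₁ : KGen.deg _ _ .u + i = n := by
      simp only [← hp, ← hi, Word.deg]
    have h₂ : KGen.deg _ _ .u + (i + 1) = n' := by simp only [KGen.deg] at h₁ ⊢; omega
    have h₃ : KGen.deg _ _ .f + n' = n' := by simp only [KGen.deg]; omega
    have h₄ : KGen.deg _ _ .f + i = i := by simp only [KGen.deg]; omega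
    have h₅ : KGen.deg _ _ .α₁ + i = n' := by simp only [KGen.deg] at h₁ ⊢; omega
    have h₆ : KGen.deg _ _ .α₂ + i = n' := by simp only [KGen.deg] at h₁ ⊢; omega
    -- The contraction takes d(u p) = f α₁ p - α₂ f p + u dp to u p exactly: there is no remainder.
    rw [← lmul_word k .u h₁ p hi, contr_u, map_zero, sub_zero, diff_u h₁ rfl hn h₂ h₅ h₃ h₄ h₆,
      map_add, map_sub, contr_f_α₁ hn h₃ h₅ h₁, contr_α₂, contr_u, sub_zero, add_zero, sub_self]
    exact zero_mem _

theorem homotopy {a : Two} {l n n' : ℤ} (hl : l + 1 = n) (hn : n + 1 = n') {L : ℕ}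
    {x : FreeHom k KGen.deg a x₂ n} (hx : x ∈ fil k a x₂ n (L + 1)) :
    x - diff k hl (contr k hl x) - contr k hn (diff k hn x) ∈ fil k a x₂ n L ⊔ base k a n := by
  refine (Submodule.span_le.2 ?_ : fil k a x₂ n (L + 1) ≤ (fil k a x₂ n L ⊔ base k a n).comap
    (LinearMap.id - (diff k hl).comp (contr k hl) - (contr k hn).comp (diff k hn))) hx
  rintro _ ⟨p, hp, hL, rfl⟩
  exact homotopy_word k hl hn p hp hL

/-- For a cocycle the term h(dx) disappears, so x is cohomologous to a shorter element plus an
element of `base`. Iterating on the length bound leaves only `base`. -/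
theorem sub_diff_mem_base {a : Two} {l n n' : ℤ} (hl : l + 1 = n) (hn : n + 1 = n')
    (x : FreeHom k KGen.deg a x₂ n) (hx : diff k hn x = 0) :
    ∃ y : FreeHom k KGen.deg a x₂ l, x - diff k hl y ∈ base k a n := by
  obtain ⟨L, hL⟩ := exists_mem_fil k x
  induction L generalizing x with
  | zero =>
    refine ⟨0, ?_⟩
    -- No word has length less than 0, so this step of the filtration is zero.
    have : x = 0 := by simpa [fil] using hL
    rw [this, map_zero, sub_zero]
    exact zero_mem _
  | succ L ih =>
    obtain ⟨z, hz, b, hb, e⟩ := Submodule.mem_sup.1 (homotopy k hl hn hL)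
    rw [hx, map_zero, sub_zero] at e
    -- The induction applies to z only if z is a cocycle; it is, since z + b differs from the
    -- cocycle x by an exact term and b is closed.
    have hdz : diff k hn z = 0 := by
      have := congrArg (diff k hn) e
      rwa [map_add, diff_base k hn hb, add_zero, map_sub, hx, freeD_freeD _ (KGen.d_d k),
        sub_zero] at this
    obtain ⟨y, hy⟩ := ih z hdz hz
    refine ⟨y + contr k hl x, ?_⟩
    have : x - diff k hl (y + contr k hl x) = (z - diff k hl y) + b := by
      rw [map_add, ← sub_sub, sub_right_comm, ← e]
      abel
    rw [this]
    exact add_mem hy hb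

/-- The word in `f` and `g` representing the generator of `Ext⁰`. -/
def arrowWord : ∀ a b : Two, Word KGen a b
  | _, x₂ => toX₂ _
  | x₁, x₁ => .nil
  | x₂, x₁ => .cons .g .nil

theorem deg_arrowWord (a b : Two) : Word.deg KGen.deg (arrowWord a b) = 0 := by
  cases a <;> cases b <;> rfl

theorem diff_arrowWord (a b : Two) {n : ℤ} (h : 0 + 1 = n) :
    diff k h (word k KGen.deg (arrowWord a b) (deg_arrowWord a b)) = 0 := by
  rw [freeD_word]
  cases a <;> cases b
  · exact dWord_nil _ _
  · exact KGen.dWord_f k _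
  · exact KGen.dWord_g k _
  · exact dWord_nil _ _

/-- For target X₂ this is `sub_diff_mem_base`. For target X₁, left multiplication by f moves the
cocycle to target X₂, and left multiplication by g brings the conclusion back at the cost of the
exact term gfx - x = d(α₁ x). -/
theorem mem_arrowWord_sup_range {a b : Two} {l n n' : ℤ} (hl : l + 1 = n) (hn : n + 1 = n')
    (x : FreeHom k KGen.deg a b n) (hx : diff k hn x = 0) :
    x ∈ Submodule.span k {y | ∃ h, y = word k KGen.deg (arrowWord a b) h} ⊔
      LinearMap.range (diff k hl) := by
  cases b with
  | x₂ =>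
    obtain ⟨y, hy⟩ := sub_diff_mem_base k hl hn x hx
    exact Submodule.mem_sup.2 ⟨_, hy, _, ⟨y, rfl⟩, sub_add_cancel _ _⟩
  | x₁ =>
    have hf : KGen.deg _ _ .f + n = n := by simp [KGen.deg]
    have hg : KGen.deg _ _ .g + n = n := by simp [KGen.deg]
    have hf' : KGen.deg _ _ .f + n' = n' := by simp [KGen.deg]
    have hg' : KGen.deg _ _ .g + l = l := by simp [KGen.deg]
    have hα : KGen.deg _ _ .α₁ + n = l := by simp only [KGen.deg]; omega
    have hα' : KGen.deg _ _ .α₁ + n' = n := by simp only [KGen.deg]; omega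
    obtain ⟨y, hy⟩ := sub_diff_mem_base k hl hn (lmul k .f hf x)
      (by rw [diff_f hf hn hn hf', hx, map_zero])
    have e := diff_α₁ hα hn hl hα' hf hg x
    rw [hx, map_zero, sub_zero] at e
    -- Left multiplication by g takes the normal forms for target X₂ to those for target X₁ modulo
    -- exact terms: 1 becomes g, and f becomes gf = 1 + dα₁.
    have hbase : base k a n ≤ (Submodule.span k
        {y | ∃ h, y = word k KGen.deg (arrowWord a x₁) h} ⊔ LinearMap.range (diff k hl)).comap
          (lmul k .g hg) := by
      refine Submodule.span_le.2 ?_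
      rintro _ ⟨hp, rfl⟩
      change lmul k .g hg (word k KGen.deg (toX₂ a) hp) ∈ Submodule.span k
        {y | ∃ h, y = word k KGen.deg (arrowWord a x₁) h} ⊔ LinearMap.range (diff k hl)
      cases a with
      | x₂ =>
        rw [lmul_word]
        exact Submodule.mem_sup_left (Submodule.subset_span ⟨_, rfl⟩)
      | x₁ =>
        have hz : Word.deg KGen.deg (.nil : Word KGen x₁ x₁) = n := hp
        have e := diff_α₁ hα hn hl hα' hf hg (word k KGen.deg .nil hz)
        rw [freeD_word, dWord_nil, map_zero, sub_zero, lmul_word k .f hf] at e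
        exact Submodule.mem_sup.2 ⟨_, Submodule.subset_span ⟨hz, rfl⟩, _, ⟨_, e⟩,
          add_sub_cancel _ _⟩
    have h₁ : lmul k .g hg (lmul k .f hf x) - x ∈ LinearMap.range (diff k hl) := ⟨_, e⟩
    have h₂ : lmul k .g hg (diff k hl y) ∈ LinearMap.range (diff k hl) :=
      ⟨lmul k .g hg' y, diff_g hg' hl hl hg y⟩
    have h₀ : lmul k .g hg (lmul k .f hf x - diff k hl y) ∈ Submodule.span k
        {y | ∃ h, y = word k KGen.deg (arrowWord a x₁) h} ⊔ LinearMap.range (diff k hl) := hbase hy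
    -- The decomposition used is x = g(fx - dy) + (g dy - (gfx - x)).
    have h₃ := add_mem h₀ (Submodule.mem_sup_right (sub_mem h₂ h₁))
    rw [map_sub] at h₃
    convert h₃ using 1
    abel

end K

/-! ### Cohomology and functors -/

section ext
variable {k : Type w} [CommRing k]

theorem IsFreeGenerator.map {M : Type v} {N : Type v'} [AddCommGroup M] [Module k M]
    [AddCommGroup N] [Module k N] {x : M} (hx : IsFreeGenerator k x) {F : M →ₗ[k] N}
    (hF : Function.Bijective F) : IsFreeGenerator k (F x) := by
  have : (fun c : k => c • F x) = F ∘ fun c : k => c • x := by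
    ext c
    simp
  exact (congrArg Function.Bijective this).mpr (hF.comp hx)

theorem IsFreeGenerator.bijective {M : Type v} {N : Type v'} [AddCommGroup M] [Module k M]
    [AddCommGroup N] [Module k N] {x : M} (hx : IsFreeGenerator k x) {F : M →ₗ[k] N}
    (hF : IsFreeGenerator k (F x)) : Function.Bijective F := by
  refine (hx.of_comp_iff F).1 ?_
  have : F ∘ (fun c : k => c • x) = fun c : k => c • F x := by
    ext c
    simp
  exact (congrArg Function.Bijective this).mpr hF

variable {A : DGCat.{u, v, w} k} {B : DGCat.{u', v', w} k} {φ : A.Obj → B.Obj}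

theorem DGCat.exists_cls {X Y : A.Obj} {n : ℤ} (x : A.Ext X Y n) :
    ∃ z : A.cocycles X Y n, A.cls z = x :=
  Submodule.Quotient.mk_surjective _ x

theorem DGCat.cls_eq_zero {X Y : A.Obj} {n : ℤ} {z : A.cocycles X Y n} :
    A.cls z = 0 ↔ z.1 ∈ A.coboundaries X Y n :=
  Submodule.Quotient.mk_eq_zero _

theorem DGCat.subsingleton_ext {X Y : A.Obj} {n : ℤ}
    (h : ∀ z ∈ A.cocycles X Y n, z ∈ A.coboundaries X Y n) : Subsingleton (A.Ext X Y n) := by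
  refine subsingleton_of_forall_eq 0 fun x => ?_
  obtain ⟨z, rfl⟩ := DGCat.exists_cls x
  exact DGCat.cls_eq_zero.2 (h z.1 z.2)

/-- Independence can be tested after a linear map, spanning cannot. This is how `I₂` detects that
the generators of Ext⁰ in `K` have no torsion. -/
theorem IsFreeGenerator.of_map {M : Type v} {N : Type v'} [AddCommGroup M] [Module k M]
    [AddCommGroup N] [Module k N] {x : M} {F : M →ₗ[k] N} (hF : IsFreeGenerator k (F x))
    (h : ∀ y : M, ∃ c : k, c • x = y) : IsFreeGenerator k x := by
  refine ⟨Function.Injective.of_comp (f := F) ?_, h⟩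
  have : F ∘ (fun c : k => c • x) = fun c : k => c • F x := by
    ext c
    simp
  exact (congrArg Function.Injective this).mpr hF.1

theorem DGCat.exists_smul_cls {X Y : A.Obj} {n : ℤ} (x : A.cocycles X Y n)
    (h : ∀ z ∈ A.cocycles X Y n, z ∈ Submodule.span k {x.1} ⊔ A.coboundaries X Y n)
    (y : A.Ext X Y n) : ∃ c : k, c • A.cls x = y := by
  obtain ⟨z, rfl⟩ := DGCat.exists_cls y
  obtain ⟨_, hx, b, hb, e⟩ := Submodule.mem_sup.1 (h z.1 z.2)
  obtain ⟨c, rfl⟩ := Submodule.mem_span_singleton.1 hx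
  refine ⟨c, Eq.symm ?_⟩
  have e' : A.cls (z - c • x) = 0 := DGCat.cls_eq_zero.2 (by
    rw [Submodule.coe_sub, Submodule.coe_smul, ← e, add_sub_cancel_left]
    exact hb)
  rwa [DGCat.cls, Submodule.Quotient.mk_sub, Submodule.Quotient.mk_smul, sub_eq_zero] at e'

theorem DGCat.isFreeGenerator_cls {X Y : A.Obj} {n : ℤ} (x : A.cocycles X Y n)
    (h : ∀ z ∈ A.cocycles X Y n, ∃ c : k, z - c • x.1 ∈ A.coboundaries X Y n)
    (h' : ∀ c : k, c • x.1 ∈ A.coboundaries X Y n → c = 0) : IsFreeGenerator k (A.cls x) := by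
  constructor
  · intro c c' e
    have e' : A.cls ((c - c') • x) = 0 := by
      rw [DGCat.cls, Submodule.Quotient.mk_smul, sub_smul, sub_eq_zero]
      exact e
    exact sub_eq_zero.1 (h' _ (DGCat.cls_eq_zero.1 e'))
  · intro y
    obtain ⟨z, rfl⟩ := DGCat.exists_cls y
    obtain ⟨c, hc⟩ := h z.1 z.2
    refine ⟨c, ?_⟩
    have e : A.cls (z - c • x) = 0 := DGCat.cls_eq_zero.2 hc
    rw [DGCat.cls, Submodule.Quotient.mk_sub, Submodule.Quotient.mk_smul, sub_eq_zero] at e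
    exact e.symm

theorem DGFunctor.mapExt_cls (F : DGFunctor A B φ) {X Y : A.Obj} {n : ℤ}
    (z : A.cocycles X Y n) : F.mapExt X Y n (A.cls z) = B.cls (F.mapCocycles X Y n z) := rfl

/-- Bijectivity in the neighbouring degrees is needed as well: degree n - 1 lifts primitives, and
degree n + 1 shows that a lift of a cocycle is a cocycle. -/
theorem DGFunctor.FullyFaithful.mapExt_bijective {F : DGFunctor A B φ} (hF : F.FullyFaithful)
    (X Y : A.Obj) (n : ℤ) : Function.Bijective (F.mapExt X Y n) := by
  constructor
  · rw [injective_iff_map_eq_zero]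
    intro x hx
    obtain ⟨z, rfl⟩ := DGCat.exists_cls x
    rw [F.mapExt_cls, DGCat.cls_eq_zero] at hx
    obtain ⟨y, hy⟩ := hx
    obtain ⟨y, rfl⟩ := (hF X Y (n - 1)).2 y
    rw [← F.map_d] at hy
    exact DGCat.cls_eq_zero.2 ⟨y, (hF X Y n).1 hy⟩
  · intro x
    obtain ⟨⟨z, hz⟩, rfl⟩ := DGCat.exists_cls x
    obtain ⟨y, rfl⟩ := (hF X Y n).2 z
    refine ⟨A.cls ⟨y, ?_⟩, rfl⟩
    have hz' : B.d rfl (F.map n y) = 0 := hz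
    rw [← F.map_d] at hz'
    exact (hF X Y (n + 1)).1 (hz'.trans (map_zero _).symm)

theorem DGCat.IsHoInverse.map {X Y : A.Obj} {f : A.Hom X Y 0} {g : A.Hom Y X 0}
    (h : A.IsHoInverse f g) (F : DGFunctor A B φ) : B.IsHoInverse (F.map 0 f) (F.map 0 g) where
  closed_left := F.cocycles_le _ _ _ h.closed_left
  closed_right := F.cocycles_le _ _ _ h.closed_right
  left := by
    obtain ⟨y, hy⟩ := h.left
    refine ⟨F.map _ y, ?_⟩
    rw [← F.map_d, hy, map_sub, F.map_comp, F.map_id]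
  right := by
    obtain ⟨y, hy⟩ := h.right
    refine ⟨F.map _ y, ?_⟩
    rw [← F.map_d, hy, map_sub, F.map_comp, F.map_id]

theorem DGCat.isHoInverse_id (X : A.Obj) : A.IsHoInverse (A.id X) (A.id X) where
  closed_left := A.d_id X rfl
  closed_right := A.d_id X rfl
  left := by
    rw [A.id_comp, sub_self]
    exact zero_mem _
  right := by
    rw [A.id_comp, sub_self]
    exact zero_mem _

end ext

/-! ### `K` is a resolution of `I₂` -/

section resolution
variable (k : Type w) [CommRing k]

theorem bijective_linearCombination_of_eq_single {k : Type w} [CommRing k] {ι : Type v}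
    (x : ι → ι →₀ k) (hx : ∀ i, x i = Finsupp.single i 1) :
    Function.Bijective (Finsupp.linearCombination k x) := by
  have h : Finsupp.linearCombination k x = LinearMap.id := by
    ext i
    simp [hx]
  rw [h]
  exact Function.bijective_id

theorem K.evalWord {a b : Two} (p : Word KGen a b) {n : ℤ} (h : Word.deg KGen.deg p = n) :
    (K k).evalWord (E := KGen) KGen.deg (fun _ _ e => K.gen k e) p h = word k KGen.deg p h := by
  induction p generalizing n with
  | nil =>
    subst h
    rfl
  | cons e p ih =>
    exact (congrArg ((K k).comp h (K.gen k e)) (ih rfl)).trans (K.lmul_word k e h p rfl)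

/-- The levels of the generators of `K`. -/
def KGen.level : ∀ a b : Two, KGen a b → ℕ
  | _, _, .f => 0
  | _, _, .g => 0
  | _, _, .α₁ => 1
  | _, _, .α₂ => 1
  | _, _, .u => 2

/-- The words are a basis by construction. The differentials of α₁ and α₂ involve only f and g, and
du involves only f, α₁ and α₂, so three levels suffice. -/
theorem K.isSemiFree : DGCat.IsSemiFree.{0, w, w, 0} (K k) := by
  refine ⟨KGen, KGen.deg, fun _ _ e => K.gen k e, KGen.level, fun X Y n => ?_, fun X Y e => ?_⟩
  · exact bijective_linearCombination_of_eq_single _ fun p => K.evalWord k p.1 p.2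
  · have hd : (K k).d rfl (K.gen k e) = KGen.d k X Y e :=
      (freeD_word (KGen.d k) (.cons e .nil) (K.deg_single e) rfl).trans (K.dWord_gen k e _ rfl)
    rw [hd]
    have key : ∀ (p : Word KGen X Y) (h : Word.deg KGen.deg p = KGen.deg X Y e + 1),
        p.LevelLT KGen.level (KGen.level X Y e) → word k KGen.deg p h ∈ Submodule.span k
          {x | ∃ (p : Word KGen X Y) (h : Word.deg KGen.deg p = KGen.deg X Y e + 1),
            p.LevelLT KGen.level (KGen.level X Y e) ∧
            (K k).evalWord (E := KGen) KGen.deg (fun _ _ e => K.gen k e) p h = x} :=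
      fun p h hp => Submodule.subset_span ⟨p, h, hp, K.evalWord k p h⟩
    cases e with
    | f => exact zero_mem _
    | g => exact zero_mem _
    | α₁ => exact sub_mem (key _ _ (by simp [Word.LevelLT, KGen.level])) (key _ _ trivial)
    | α₂ => exact sub_mem (key _ _ (by simp [Word.LevelLT, KGen.level])) (key _ _ trivial)
    | u =>
      exact sub_mem (key _ _ (by simp [Word.LevelLT, KGen.level]))
        (key _ _ (by simp [Word.LevelLT, KGen.level]))

/-! ### The universal property of `K` -/

section lift
variable {k} (B : DGCat.{u, v, w} k) (X : Two → B.Obj) (f : B.Hom (X x₁) (X x₂) 0)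
  (g : B.Hom (X x₂) (X x₁) 0) (α₁ : B.Hom (X x₁) (X x₁) (-1)) (α₂ : B.Hom (X x₂) (X x₂) (-1))
  (u : B.Hom (X x₁) (X x₂) (-2))

/-- A family of morphisms indexed by the generators of `K`. -/
def KGen.toHom : ∀ (a b : Two) (e : KGen a b), B.Hom (X a) (X b) (KGen.deg a b e)
  | _, _, .f => f
  | _, _, .g => g
  | _, _, .α₁ => α₁
  | _, _, .α₂ => α₂
  | _, _, .u => u

/-- The five hypotheses are the images of the defining relations of `K`; they are all that a DG
functor out of `K` must satisfy. -/
theorem KGen.freeEval_toHom (hf : B.d (zero_add 1) f = 0) (hg : B.d (zero_add 1) g = 0)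
    (hα₁ : B.d (neg_add_cancel 1) α₁ = B.comp (add_zero 0) g f - B.id _)
    (hα₂ : B.d (neg_add_cancel 1) α₂ = B.comp (add_zero 0) f g - B.id _)
    (hu : B.d (by norm_num) u = B.comp (zero_add (-1)) f α₁ - B.comp (add_zero (-1)) α₂ f)
    (a b : Two) (e : KGen a b) :
    freeEval B.toGrCat (KGen.toHom B X f g α₁ α₂ u) _ (KGen.d k a b e) =
      B.d rfl (KGen.toHom B X f g α₁ α₂ u a b e) := by
  cases e with
  | f => exact (map_zero _).trans hf.symm
  | g => exact (map_zero _).trans hg.symm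
  | α₁ =>
    refine ((map_sub _ _ _).trans (congrArg₂ _ (freeEval_word _ _ _ _)
      (freeEval_word _ _ _ _))).trans (Eq.trans ?_ hα₁.symm)
    -- The value of a nonempty word carries an identity at its right end, which is the only
    -- difference from the stated relation.
    exact congrArg (fun z => B.comp (add_zero 0) g z - B.id _) (B.comp_id (add_zero 0) f)
  | α₂ =>
    refine ((map_sub _ _ _).trans (congrArg₂ _ (freeEval_word _ _ _ _)
      (freeEval_word _ _ _ _))).trans (Eq.trans ?_ hα₂.symm)
    exact congrArg (fun z => B.comp (add_zero 0) f z - B.id _) (B.comp_id (add_zero 0) g)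
  | u =>
    refine ((map_sub _ _ _).trans (congrArg₂ _ (freeEval_word _ _ _ _)
      (freeEval_word _ _ _ _))).trans (Eq.trans ?_ hu.symm)
    exact congrArg₂ (fun y z => B.comp (zero_add (-1)) f y - B.comp (add_zero (-1)) α₂ z)
      (B.comp_id (add_zero (-1)) α₁) (B.comp_id (add_zero 0) f)

/-- The DG functor from `K` with prescribed values on the generators. -/
def K.lift (hf : B.d (zero_add 1) f = 0) (hg : B.d (zero_add 1) g = 0)
    (hα₁ : B.d (neg_add_cancel 1) α₁ = B.comp (add_zero 0) g f - B.id _)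
    (hα₂ : B.d (neg_add_cancel 1) α₂ = B.comp (add_zero 0) f g - B.id _)
    (hu : B.d (by norm_num) u = B.comp (zero_add (-1)) f α₁ - B.comp (add_zero (-1)) α₂ f) :
    DGFunctor (K k) B X :=
  DGFunctor.ofFree (KGen.d_d k) B (KGen.toHom B X f g α₁ α₂ u)
    (KGen.freeEval_toHom B X f g α₁ α₂ u hf hg hα₁ hα₂ hu)

/-- The DG functor from `K` given by mutually inverse closed morphisms. -/
def K.liftIso (hf : B.d (zero_add 1) f = 0) (hg : B.d (zero_add 1) g = 0)
    (hgf : B.comp (add_zero 0) g f = B.id _) (hfg : B.comp (add_zero 0) f g = B.id _) :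
    DGFunctor (K k) B X :=
  K.lift B X f g 0 0 0 hf hg (by rw [map_zero, hgf, sub_self]) (by rw [map_zero, hfg, sub_self])
    (by simp)

end lift

/-! ### The morphisms and Ext of `I₂`, and the quasi-equivalence -/

theorem I₂.comp_arrow (a b c : (I₂ k).Obj) (h : (0 : ℤ) + 0 = 0) :
    (I₂ k).comp h (I₂.arrow k b c) (I₂.arrow k a b) = I₂.arrow k a c :=
  (linComp_single k J₂ (fun _ _ _ => 0) (fun _ _ _ _ _ => rfl) h _ _ 1 1).trans
    (by rw [mul_one]; rfl)

theorem I₂.subsingleton_hom (a b : (I₂ k).Obj) {n : ℤ} (hn : n ≠ 0) :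
    Subsingleton ((I₂ k).Hom a b n) := by
  have : IsEmpty {f : Unit // (0 : ℤ) = n} := ⟨fun x => hn x.2.symm⟩
  exact inferInstanceAs (Subsingleton ({f : Unit // (0 : ℤ) = n} →₀ k))

/-- The resolution `K → I₂`. -/
def K.toI₂ : DGFunctor (K k) (I₂ k) id :=
  K.liftIso (I₂ k) id (I₂.arrow k x₁ x₂) (I₂.arrow k x₂ x₁) rfl rfl
    (I₂.comp_arrow k x₁ x₂ x₁ _) (I₂.comp_arrow k x₂ x₁ x₂ _)

/-- The words `1`, `f`, `g` as closed morphisms of `K`. -/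
def K.arrow (a b : Two) : (K k).cocycles a b 0 :=
  ⟨word k KGen.deg (K.arrowWord a b) (K.deg_arrowWord a b), K.diff_arrowWord k a b rfl⟩

theorem K.toI₂_arrow (a b : Two) : (K.toI₂ k).map 0 (K.arrow k a b).1 = I₂.arrow k a b := by
  cases a <;> cases b
  · exact (K.toI₂ k).map_id x₁
  · exact freeEval_gen _ _ KGen.f _
  · exact freeEval_gen _ _ KGen.g _
  · exact (K.toI₂ k).map_id x₂

theorem I₂.coboundaries (a b : (I₂ k).Obj) (n : ℤ) : (I₂ k).coboundaries a b n = ⊥ :=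
  LinearMap.range_zero

theorem I₂.isFreeGenerator (a b : (I₂ k).Obj) (h : I₂.arrow k a b ∈ (I₂ k).cocycles a b 0) :
    IsFreeGenerator k ((I₂ k).cls ⟨I₂.arrow k a b, h⟩) := by
  -- The coefficient is the value of the finitely supported function at the only morphism a → b.
  refine DGCat.isFreeGenerator_cls _ (fun z _ => ⟨(show {f : Unit // (0 : ℤ) = 0} →₀ k from z)
    ⟨(), rfl⟩, ?_⟩) fun c hc => ?_
  · have : z - (show {f : Unit // (0 : ℤ) = 0} →₀ k from z) ⟨(), rfl⟩ • I₂.arrow k a b = 0 := by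
      refine sub_eq_zero.2 (Finsupp.ext (α := {f : Unit // (0 : ℤ) = 0}) fun x => ?_)
      obtain rfl : x = ⟨(), rfl⟩ := rfl
      refine Eq.symm ((Finsupp.smul_apply _ _ _).trans ?_)
      exact (congrArg (_ * ·) Finsupp.single_eq_same).trans (mul_one _)
    rw [this]
    exact zero_mem _
  · rw [I₂.coboundaries, Submodule.mem_bot] at hc
    have := DFunLike.congr_fun (F := {f : Unit // (0 : ℤ) = 0} →₀ k) hc ⟨(), rfl⟩
    refine Eq.trans ?_ this
    refine Eq.symm ((Finsupp.smul_apply _ _ _).trans ?_)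
    exact (congrArg (c * ·) Finsupp.single_eq_same).trans (mul_one c)

theorem I₂.subsingleton_ext (a b : (I₂ k).Obj) {n : ℤ} (hn : n ≠ 0) :
    Subsingleton ((I₂ k).Ext a b n) := by
  refine DGCat.subsingleton_ext fun z _ => ?_
  have := I₂.subsingleton_hom k a b hn
  rw [Subsingleton.elim z 0]
  exact zero_mem _

theorem K.subsingleton_ext (a b : (K k).Obj) {n : ℤ} (hn : n ≠ 0) :
    Subsingleton ((K k).Ext a b n) := by
  refine DGCat.subsingleton_ext fun z hz => ?_
  have h := K.mem_arrowWord_sup_range k (sub_add_cancel n 1) rfl z hz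
  -- The normal form is a word of degree 0, so in degree n ≠ 0 there is none and every cocycle is
  -- exact.
  have e : {y : FreeHom k KGen.deg a b n | ∃ h, y = word k KGen.deg (K.arrowWord a b) h} = ∅ :=
    Set.eq_empty_of_forall_notMem fun y ⟨h, _⟩ => hn (h.symm.trans (K.deg_arrowWord a b))
  rwa [e, Submodule.span_empty, bot_sup_eq] at h

theorem K.isFreeGenerator_mapExt_arrow (a b : (K k).Obj) :
    IsFreeGenerator k ((K.toI₂ k).mapExt a b 0 ((K k).cls (K.arrow k a b))) := by
  have e : (K.toI₂ k).mapExt a b 0 ((K k).cls (K.arrow k a b)) =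
      (I₂ k).cls ⟨I₂.arrow k a b, rfl⟩ :=
    congrArg (I₂ k).cls (Subtype.ext (K.toI₂_arrow k a b))
  rw [e]
  exact I₂.isFreeGenerator k a b rfl

/-- Spanning comes from the contraction on words, independence from the image in `I₂`. -/
theorem K.isFreeGenerator (a b : (K k).Obj) :
    IsFreeGenerator k ((K k).cls (K.arrow k a b)) := by
  refine IsFreeGenerator.of_map (K.isFreeGenerator_mapExt_arrow k a b)
    (DGCat.exists_smul_cls _ fun z hz => ?_)
  have h := K.mem_arrowWord_sup_range k (sub_add_cancel 0 1) rfl z hz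
  have : {y : FreeHom k KGen.deg a b 0 | ∃ h, y = word k KGen.deg (K.arrowWord a b) h} =
      {(K.arrow k a b).1} :=
    Set.ext fun y => ⟨fun ⟨_, h⟩ => h, fun h => ⟨K.deg_arrowWord a b, h⟩⟩
  rwa [this] at h

/-- In degree 0 a free generator goes to a free generator; in all other degrees both sides vanish.
-/
theorem K.isResolution : DGFunctor.IsResolution.{0, w, w, 0, w, 0} (K.toI₂ k) where
  semiFree := K.isSemiFree k
  bijective_obj := Function.bijective_id
  quasiEquivalence :=
    { fullyFaithful := fun a b n => by
        by_cases hn : n = 0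
        · subst hn
          exact (K.isFreeGenerator k a b).bijective (K.isFreeGenerator_mapExt_arrow k a b)
        · exact ⟨fun _ _ _ => (K.subsingleton_ext k a b hn).elim _ _,
            fun y => ⟨0, (I₂.subsingleton_ext k a b hn).elim _ _⟩⟩
      essSurj := fun Z => ⟨Z, (I₂ k).id Z, (I₂ k).id Z, DGCat.isHoInverse_id Z⟩ }

/-- The homotopies are α₁ and α₂ themselves: gf - 1 = dα₁ and fg - 1 = dα₂. -/
theorem K.isHoInverse : (K k).IsHoInverse (K.arrow k x₁ x₂).1 (K.arrow k x₂ x₁).1 where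
  closed_left := (K.arrow k x₁ x₂).2
  closed_right := (K.arrow k x₂ x₁).2
  left := ⟨K.gen k .α₁, (freeD_word (KGen.d k) _ (K.deg_single KGen.α₁)
    (by decide : KGen.deg _ _ KGen.α₁ + 1 = 0)).trans ((K.dWord_gen k .α₁ _ rfl).trans
      (congrArg (· - word k KGen.deg (.nil : Word KGen x₁ x₁) rfl)
        (freeComp_word (.cons KGen.g .nil) (.cons KGen.f .nil) rfl rfl (add_zero 0)).symm))⟩
  right := ⟨K.gen k .α₂, (freeD_word (KGen.d k) _ (K.deg_single KGen.α₂)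
    (by decide : KGen.deg _ _ KGen.α₂ + 1 = 0)).trans ((K.dWord_gen k .α₂ _ rfl).trans
      (congrArg (· - word k KGen.deg (.nil : Word KGen x₂ x₂) rfl)
        (freeComp_word (.cons KGen.f .nil) (.cons KGen.g .nil) rfl rfl (add_zero 0)).symm))⟩

end resolution

/-! ### Graded functors -/

section grFunctor
variable {k : Type w} [CommRing k]

/-- Words are composites of arrows and form a basis, so a graded functor is determined by its values
on arrows. Used to compare composites through `A/B` without computing them on long words. -/
theorem GrFunctor.ext_free {V : Type u} {E : V → V → Type g} {δ : ∀ a b : V, E a b → ℤ}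
    {B : GrCat.{u', v', w} k} {φ : V → B.Obj} (F G : GrFunctor (GrCat.free k δ) B φ)
    (h : ∀ (a b : V) (e : E a b) (he : Word.deg δ (.cons e .nil) = δ a b e),
      F.map _ (word k δ (.cons e .nil) he) = G.map _ (word k δ (.cons e .nil) he))
    {a b : V} {n : ℤ} (x : FreeHom k δ a b n) : F.map n x = G.map n x := by
  have key : ∀ {b : V} (p : Word E a b) {n : ℤ} (hp : Word.deg δ p = n),
      F.map n (word k δ p hp) = G.map n (word k δ p hp) := by
    intro b p
    induction p with
    | nil =>
      intro n hp
      obtain rfl : 0 = n := hp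
      exact (F.map_id a).trans (G.map_id a).symm
    | cons e p ih =>
      intro n hp
      have he : Word.deg δ (.cons e .nil) = δ _ _ e := by simp [Word.deg]
      have hn : δ _ _ e + Word.deg δ p = n := by rw [← hp, Word.deg]
      have e₁ : word k δ (.cons e p) hp =
        freeComp k δ hn (word k δ (.cons e .nil) he) (word k δ p rfl) := by
          rw [freeComp_word]
          rfl
      rw [e₁]
      exact (F.map_comp hn _ _).trans (((congrArg₂ (fun y z => B.comp hn y z) (h _ _ e he)
        (ih rfl))).trans (G.map_comp hn _ _).symm)
  have hF : (F.map n : FreeHom k δ a b n →ₗ[k] _) = G.map n := by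
    refine Finsupp.lhom_ext' fun p => LinearMap.ext_ring ?_
    exact key p.1 p.2
  exact congrArg (fun L => L x) hF

/-- The composition of graded functors. -/
def GrFunctor.comp {A : GrCat.{u, v, w} k} {B : GrCat.{u', v', w} k} {C : GrCat k}
    {φ : A.Obj → B.Obj} {ψ : B.Obj → C.Obj} (G : GrFunctor B C ψ) (F : GrFunctor A B φ) :
    GrFunctor A C (ψ ∘ φ) where
  map n := (G.map n).comp (F.map n)
  map_id X := (congrArg (G.map 0) (F.map_id X)).trans (G.map_id _)
  map_comp h b a := (congrArg (G.map _) (F.map_comp h b a)).trans (G.map_comp h _ _)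

/-- The graded functor underlying a DG functor. -/
def DGFunctor.toGrFunctor {A : DGCat.{u, v, w} k} {B : DGCat.{u', v', w} k} {φ : A.Obj → B.Obj}
    (F : DGFunctor A B φ) : GrFunctor A.toGrCat B.toGrCat φ where
  map := F.map
  map_id := F.map_id
  map_comp := F.map_comp

/-- The graded functor from `A` to its DG quotient. -/
def GrFunctor.toQuotient (A : DGCat.{u, v, w} k) (S : Set A.Obj) :
    GrFunctor A.toGrCat (A.quotient S).toGrCat id where
  map _ := QHom.of S
  map_id _ := rfl
  map_comp := QHom.of_comp

/-- The composition in a graded category factors through a decomposition of the identity of the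
middle object. -/
theorem GrCat.comp_eq_sum (B : GrCat.{u, v, w} k) {ι : Type*} [Fintype ι] {X X' Y Z Z' : B.Obj}
    {W : ι → B.Obj} {s t : ι → ℤ} (hst : ∀ x, s x + t x = 0)
    (inj : ∀ x, B.Hom (W x) Y (s x)) (proj : ∀ x, B.Hom Y (W x) (t x))
    (hid : ∑ x, B.comp (hst x) (inj x) (proj x) = B.id Y) {i j p q n l m : ℤ} (h : p + q = n)
    (hl : i + n = l) (hm : l + j = m) (c : B.Hom Z Z' i) (b : B.Hom Y Z p) (a : B.Hom X Y q)
    (e : B.Hom X' X j) :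
    B.comp hm (B.comp hl c (B.comp h b a)) e =
      ∑ x, B.comp (by rw [← hm, ← hl, ← h]; linear_combination hst x)
        (B.comp (rfl : (i + p) + s x = _) (B.comp rfl c b) (inj x))
        (B.comp (rfl : (t x + q) + j = _) (B.comp rfl (proj x) a) e) := by
  -- The identity of the middle object is inserted in front of `a`; the rest is reassociation, and
  -- the result is matrix multiplication.
  have ha : a = ∑ x, B.comp (by linear_combination hst x) (inj x)
      (B.comp (rfl : t x + q = _) (proj x) a) := by
    conv_lhs => rw [← B.id_comp (zero_add q) a, ← hid, map_sum, LinearMap.sum_apply]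
    exact Finset.sum_congr rfl fun x _ => B.assoc _ _ _ _ _ _ _
  conv_lhs => rw [ha]
  simp only [map_sum, LinearMap.sum_apply]
  refine Finset.sum_congr rfl fun x _ => ?_
  rw [← B.assoc (hpq := (rfl : p + s x = _)) (hs := by rw [← h]; linear_combination hst x),
    ← B.assoc (hpq := (by ring : i + (p + s x) = i + p + s x))
      (hs := by rw [← hl, ← h]; linear_combination hst x),
    ← B.assoc (hpq := (rfl : i + p = _)) (hs := rfl),
    B.assoc (hqr := (rfl : (t x + q) + j = _)) (ht := by
      rw [← hm, ← hl, ← h]; linear_combination hst x)]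

end grFunctor

/-! ### The components of a twisted complex -/

section components
variable {k : Type w} [CommRing k] {A : DGCat.{u, v, w} k}

/-- The inclusion of a component of a twisted complex. -/
def Tw.inj (T : Tw A) (j : Fin T.n) {l : ℤ} (h : l + T.r j = 0) : TwHom (Tw.of (T.C j)) T l :=
  fun i _ => A.castDeg (by simp only [Tw.of]; omega) (twId T i j)

/-- The projection to a component of a twisted complex. -/
def Tw.proj (T : Tw A) (i : Fin T.n) {l : ℤ} (h : l = T.r i) : TwHom T (Tw.of (T.C i)) l :=
  fun _ j => A.castDeg (by simp only [Tw.of]; omega) (twId T i j)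

theorem twComp_twId {T T' : Tw A} {l : ℤ} (f : TwHom T T' l) : twComp (add_zero l) f (twId T) = f :=
  (GrCat.pretr A).comp_id (add_zero l) f

theorem twId_twComp {T T' : Tw A} {l : ℤ} (f : TwHom T T' l) :
    twComp (zero_add l) (twId T') f = f :=
  (GrCat.pretr A).id_comp (zero_add l) f

/-- The inclusion is column j of the identity matrix, so composing with it extracts column j of `f`,
up to transport of degrees. -/
theorem twComp_inj {T T' : Tw A} {l m n : ℤ} (f : TwHom T T' l) (j : Fin T.n)
    (hm : m + T.r j = 0) (h : l + m = n) (i x) :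
    twComp h f (T.inj j hm) i x = A.castDeg (by simp only [Tw.of]; omega) (f i j) := by
  conv_rhs => rw [← twComp_twId f]
  rw [twComp_apply, twComp_apply, map_sum]
  refine Finset.sum_congr rfl fun y _ => ?_
  rw [GrCat.castDeg_comp]
  exact A.comp_castDeg_right _ _ _ _

theorem proj_twComp {T T' : Tw A} {l m n : ℤ} (f : TwHom T T' l) (i : Fin T'.n)
    (hm : m = T'.r i) (h : m + l = n) (x j) :
    twComp h (T'.proj i hm) f x j = A.castDeg (by simp only [Tw.of]; omega) (f i j) := by
  conv_rhs => rw [← twId_twComp f]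
  rw [twComp_apply, twComp_apply, map_sum]
  refine Finset.sum_congr rfl fun y _ => ?_
  rw [GrCat.castDeg_comp]
  exact A.comp_castDeg_left _ _ _ _

theorem proj_twComp_inj {T T' : Tw A} {l m m' l' n : ℤ} (f : TwHom T T' l) (i : Fin T'.n)
    (j : Fin T.n) (hm : m = T'.r i) (hm' : m' + T.r j = 0) (hl' : m + l = l') (h : l' + m' = n)
    (x y) :
    twComp h (twComp hl' (T'.proj i hm) f) (T.inj j hm') x y =
      A.castDeg (by simp only [Tw.of]; omega) (f i j) := by
  rw [twComp_inj, proj_twComp]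
  exact GrCat.castDeg_castDeg _ _ _ _

theorem sum_inj_proj (T : Tw A) {s : Fin T.n → ℤ} (hs : ∀ x, s x + T.r x = 0) :
    ∑ x, twComp (hs x) (T.inj x (hs x)) (T.proj x rfl) = twId T := by
  conv_rhs => rw [← twComp_twId (twId T)]
  ext i j
  rw [Finset.sum_apply, Finset.sum_apply, twComp_apply]
  refine Finset.sum_congr rfl fun x _ => ?_
  refine (Fin.sum_univ_one fun z : Fin 1 =>
    A.comp _ (T.inj x (hs x) i z) (T.proj x rfl z j)).trans ?_
  exact (A.comp_castDeg_left _ _ _ _).trans (A.comp_castDeg_right _ _ _ _)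

end components

/-! ### Components of a cone -/

section coneData
variable {k : Type w} [CommRing k]

/-- The data exhibiting `C` as the cone of a closed morphism `f : X₁ → X₂` of degree `0`: a
decomposition `C = X₂ ⊕ X₁[1]` as a graded object, with the differentials of the components. -/
structure ConeData (B : DGCat.{u, v, w} k) {X₁ X₂ : B.Obj} (f : B.Hom X₁ X₂ 0) (C : B.Obj) where
  d_f : B.d (zero_add 1) f = 0
  i₁ : B.Hom X₁ C (-1)
  i₂ : B.Hom X₂ C 0
  p₁ : B.Hom C X₁ 1
  p₂ : B.Hom C X₂ 0
  d_i₁ : B.d (neg_add_cancel 1) i₁ = B.comp (add_zero 0) i₂ f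
  d_i₂ : B.d (zero_add 1) i₂ = 0
  d_p₁ : B.d (one_add_one_eq_two) p₁ = 0
  d_p₂ : B.d (zero_add 1) p₂ = - B.comp (zero_add 1) f p₁
  p₁_i₁ : B.comp (add_neg_cancel 1) p₁ i₁ = B.id X₁
  p₁_i₂ : B.comp (add_zero 1) p₁ i₂ = 0
  p₂_i₁ : B.comp (zero_add (-1)) p₂ i₁ = 0
  p₂_i₂ : B.comp (add_zero 0) p₂ i₂ = B.id X₂

/-- The image of cone data under a DG functor. -/
def ConeData.map {A : DGCat.{u, v, w} k} {B : DGCat.{u', v', w} k} {φ : A.Obj → B.Obj}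
    {X₁ X₂ C : A.Obj} {f : A.Hom X₁ X₂ 0} (D : ConeData A f C) (F : DGFunctor A B φ) :
    ConeData B (F.map 0 f) (φ C) where
  d_f := by rw [← F.map_d, D.d_f, map_zero]
  i₁ := F.map _ D.i₁
  i₂ := F.map _ D.i₂
  p₁ := F.map _ D.p₁
  p₂ := F.map _ D.p₂
  d_i₁ := by rw [← F.map_d, D.d_i₁, F.map_comp]
  d_i₂ := by rw [← F.map_d, D.d_i₂, map_zero]
  d_p₁ := by rw [← F.map_d, D.d_p₁, map_zero]
  d_p₂ := by rw [← F.map_d, D.d_p₂, map_neg, F.map_comp]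
  p₁_i₁ := by rw [← F.map_comp, D.p₁_i₁, F.map_id]
  p₁_i₂ := by rw [← F.map_comp, D.p₁_i₂, map_zero]
  p₂_i₁ := by rw [← F.map_comp, D.p₂_i₁, map_zero]
  p₂_i₂ := by rw [← F.map_comp, D.p₂_i₂, F.map_id]

section
variable {B : DGCat.{u, v, w} k} {X : Two → B.Obj} {C : B.Obj} {f : B.Hom (X x₁) (X x₂) 0}
  (D : ConeData B f C) (ε : B.Hom C C (-1))

/-- As p₁ is closed of degree 1, only the term with dε = id survives, with sign -1. -/
theorem ConeData.d_p₁_comp (hε : B.d (neg_add_cancel 1) ε = B.id C) :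
    B.d (zero_add 1) (B.comp (add_neg_cancel 1) D.p₁ ε) = - D.p₁ := by
  rw [B.leibniz (n' := 1) _ _ one_add_one_eq_two (neg_add_cancel 1) (by norm_num) (add_zero 1),
    D.d_p₁, hε, B.comp_id, map_zero, LinearMap.zero_apply, zero_add,
    (by simpa using sgn_succ k 0 : sgn k 1 = -1), neg_one_smul]

/-- The projection p₂ is not closed: dp₂ = -f p₁ contributes the second term. -/
theorem ConeData.d_p₂_comp (hε : B.d (neg_add_cancel 1) ε = B.id C) :
    B.d (neg_add_cancel 1) (B.comp (zero_add (-1)) D.p₂ ε) =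
      D.p₂ - B.comp (add_zero 0) f (B.comp (add_neg_cancel 1) D.p₁ ε) := by
  rw [B.leibniz (n' := 0) _ _ (zero_add 1) (neg_add_cancel 1) (by norm_num) (add_zero 0),
    D.d_p₂, hε, B.comp_id, map_neg, LinearMap.neg_apply, sgn_zero, one_smul,
    B.assoc (hqr := add_neg_cancel 1) (ht := add_zero 0)]
  abel

/-- The DG functor from `K` given by the cone of `f` and a contraction `ε` of the cone. -/
def ConeData.functor (hε : B.d (neg_add_cancel 1) ε = B.id C) : DGFunctor (K k) B X :=
  K.lift B X f
    -- Up to sign these are the four entries of ε in the decomposition C = X₂ ⊕ X₁[1]: g and α₁ come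
    -- from the row of p₁, -α₂ and -u from the row of p₂. The signs make dα₂ = fg - 1 and du = fα₁ -
    -- α₂f come out.
    (B.comp (add_zero 0) (B.comp (add_neg_cancel 1) D.p₁ ε) D.i₂)
    (B.comp (zero_add (-1)) (B.comp (add_neg_cancel 1) D.p₁ ε) D.i₁)
    (-B.comp (add_zero (-1)) (B.comp (zero_add (-1)) D.p₂ ε) D.i₂)
    (-B.comp (by norm_num) (B.comp (zero_add (-1)) D.p₂ ε) D.i₁)
    D.d_f
    (by
      rw [B.leibniz (n' := 1) _ _ (zero_add 1) (zero_add 1) (by norm_num) (zero_add 1),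
        D.d_p₁_comp ε hε, D.d_i₂, map_zero, smul_zero, add_zero, map_neg, LinearMap.neg_apply,
        D.p₁_i₂, neg_zero])
    (by
      rw [B.leibniz (n' := 0) _ _ (zero_add 1) (neg_add_cancel 1) (by norm_num) (add_zero 0),
        D.d_p₁_comp ε hε, D.d_i₁, map_neg, LinearMap.neg_apply, D.p₁_i₁, sgn_zero, one_smul,
        B.assoc (hqr := add_zero 0) (ht := add_zero 0)]
      abel)
    (by
      rw [map_neg, B.leibniz (n' := 0) _ _ (neg_add_cancel 1) (zero_add 1) (add_zero 0)
          (by norm_num), D.d_p₂_comp ε hε, D.d_i₂, map_zero, smul_zero, add_zero, map_sub,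
        LinearMap.sub_apply, D.p₂_i₂, B.assoc (hqr := add_zero 0) (ht := add_zero 0)]
      abel)
    (by
      -- du = -((p₂ - f p₁ ε) i₁ - p₂ ε i₂ f). Here p₂ i₁ = 0, and the two remaining terms are f α₁
      -- and -α₂ f.
      rw [map_neg, B.leibniz (n' := -1) _ _ (neg_add_cancel 1) (neg_add_cancel 1)
          (zero_add (-1)) (add_zero (-1)), D.d_p₂_comp ε hε, D.d_i₁, map_sub,
        LinearMap.sub_apply, D.p₂_i₁, B.assoc (hqr := zero_add (-1)) (ht := zero_add (-1)),
        map_neg, LinearMap.neg_apply, B.assoc (hqr := add_zero 0) (ht := add_zero (-1)),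
        sgn_neg_one, neg_one_smul]
      abel)

end

end coneData

/-! ### The cone in the DG category of twisted complexes -/

section twCone
variable {k : Type w} [CommRing k] {A : DGCat.{u, v, w} k}

theorem d_castDeg_twId (T : Tw A) (i j : Fin T.n) {m n : ℤ} (h : 0 + T.r i - T.r j = m)
    (h' : m + 1 = n) : A.d h' (A.castDeg h (twId T i j)) = 0 := by
  by_cases hij : i = j
  · subst hij
    rw [twId_self, GrCat.castDeg_castDeg, d_castDeg, A.d_id]
  · rw [twId_ne T hij, map_zero, map_zero]

/-- Entries of the identity matrix are closed and the source has zero twist, so only q ∘ inj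
remains: column j of q. -/
theorem twD_inj (T : Tw A) (j : Fin T.n) {l m : ℤ} (hl : l + T.r j = 0) (h : l + 1 = m) (x y) :
    twD h (T.inj j hl) x y = A.castDeg (by simp only [Tw.of]; omega) (T.q x j) := by
  have h₁ : twNaive h (T.inj j hl) = 0 := by
    funext x y
    refine (twNaive_apply h _ x y).trans (Eq.trans ?_ (smul_zero (sgn k (T.r x))))
    exact congrArg _ (d_castDeg_twId T x j _ _)
  have h₂ : twComp h (T.inj j hl) (Tw.of (T.C j)).q = 0 := by
    funext x y
    exact (twComp_apply _ _ _ _ _).trans (Finset.sum_eq_zero fun z _ => map_zero _)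
  rw [twD_apply, h₁, h₂, smul_zero, sub_zero, zero_add]
  exact twComp_inj _ _ _ _ _ _

/-- Dual to the inclusion: only the term -(-1)^l proj ∘ q remains, a row of q with a sign. This is
the origin of the minus sign in dp₂ = -f p₁. -/
theorem twD_proj (T : Tw A) (i : Fin T.n) {l m : ℤ} (hl : l = T.r i) (h : l + 1 = m) (x y) :
    twD h (T.proj i hl) x y =
      -(sgn k l • A.castDeg (by simp only [Tw.of]; omega) (T.q i y)) := by
  have h₁ : twNaive h (T.proj i hl) = 0 := by
    funext x y
    refine (twNaive_apply h _ x y).trans (Eq.trans ?_ (smul_zero (sgn k 0)))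
    exact congrArg _ (d_castDeg_twId T i y _ _)
  have h₂ : twComp (by rw [← h, add_comm] : 1 + l = m) (Tw.of (T.C i)).q (T.proj i hl) = 0 := by
    funext x y
    exact (twComp_apply _ _ _ _ _).trans (Finset.sum_eq_zero fun z _ =>
      LinearMap.congr_fun (map_zero (A.comp _)) (T.proj i hl z y))
  rw [twD_apply, h₁, h₂, zero_add, zero_sub]
  exact congrArg (fun z => -(sgn k l • z)) (proj_twComp T.q i hl h x y)

theorem twD_proj_eq_zero (T : Tw A) (i : Fin T.n) {l m : ℤ} (hl : l = T.r i) (h : l + 1 = m)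
    (hq : ∀ y, T.q i y = 0) : twD h (T.proj i hl) = 0 := by
  funext x y
  rw [twD_proj, hq, map_zero, smul_zero, neg_zero]
  rfl

theorem inj_twComp_ofHom (T : Tw A) (j : Fin T.n) {Z : A.Obj} {l m n : ℤ} (f : A.Hom Z (T.C j) m)
    (hl : l + T.r j = 0) (h : l + m = n) (x y) :
    twComp h (T.inj j hl) (Tw.ofHom f) x y =
      A.comp (by simp only [Tw.of]; omega) (twId T x j) f := by
  refine (Fin.sum_univ_one fun z : Fin 1 =>
    A.comp _ (T.inj j hl x z) (Tw.ofHom f z y)).trans ?_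
  exact (A.comp_castDeg_left _ _ _ _).trans (A.comp_castDeg_right _ _ _ _)

theorem ofHom_twComp_proj (T : Tw A) (i : Fin T.n) {Z : A.Obj} {l m n : ℤ}
    (f : A.Hom (T.C i) Z m) (hl : l = T.r i) (h : m + l = n) (x y) :
    twComp h (Tw.ofHom f) (T.proj i hl) x y =
      A.comp (by simp only [Tw.of]; omega) f (twId T i y) := by
  refine (Fin.sum_univ_one fun z : Fin 1 =>
    A.comp _ (Tw.ofHom f x z) (T.proj i hl z y)).trans ?_
  exact (A.comp_castDeg_left _ _ _ _).trans (A.comp_castDeg_right _ _ _ _)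

theorem proj_twComp_inj_self (T : Tw A) (i : Fin T.n) {l m : ℤ} (hl : l = T.r i)
    (hm : m + T.r i = 0) (h : l + m = 0) :
    twComp h (T.proj i hl) (T.inj i hm) = twId (Tw.of (T.C i)) := by
  ext x y
  refine (proj_twComp _ _ _ _ _ _).trans ?_
  obtain rfl : x = y := Subsingleton.elim (α := Fin 1) x y
  refine ((GrCat.castDeg_castDeg _ _ _ _).trans ?_).trans (twId_self _ _).symm
  rw [twId_self]
  exact GrCat.castDeg_castDeg _ _ _ _

theorem proj_twComp_inj_of_ne (T : Tw A) {i j : Fin T.n} (hij : i ≠ j) {l m n : ℤ}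
    (hl : l = T.r i) (hm : m + T.r j = 0) (h : l + m = n) :
    twComp h (T.proj i hl) (T.inj j hm) = 0 := by
  ext x y
  refine (proj_twComp _ _ _ _ _ _).trans ((GrCat.castDeg_castDeg _ _ _ _).trans ?_)
  rw [twId_ne T hij]
  exact map_zero _

/-- One-term complexes have zero twist and zero shift, so neither the q-terms nor a sign appears. -/
theorem twD_ofHom {X Y : A.Obj} {m n : ℤ} (h : m + 1 = n) (f : A.Hom X Y m) :
    twD h (Tw.ofHom f) = Tw.ofHom (A.d h f) := by
  subst h
  have h₁ : twComp (add_comm 1 m) (Tw.of Y).q (Tw.ofHom f) = 0 := by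
    funext x y
    exact (twComp_apply _ _ _ _ _).trans (Finset.sum_eq_zero fun z _ =>
      LinearMap.congr_fun (map_zero (A.comp _)) (Tw.ofHom f z y))
  have h₂ : twComp rfl (Tw.ofHom f) (Tw.of X).q = 0 := by
    funext x y
    exact (twComp_apply _ _ _ _ _).trans (Finset.sum_eq_zero fun z _ => map_zero _)
  rw [twD_apply, h₁, h₂, smul_zero, sub_zero, add_zero]
  funext x y
  refine (twNaive_apply rfl _ x y).trans ?_
  have e : sgn k ((Tw.of Y).r x) = 1 := sgn_zero k
  rw [e, one_smul]
  refine (d_castDeg A _ _ f).trans ?_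
  have key : ∀ {m n n' : ℤ} (h : m + 1 = n) (h' : n = n') (f : A.Hom X Y m),
      A.d (h.trans h') f = A.castDeg h' (A.d h f) := by
    intro m n n' h h' f
    subst h'
    rfl
  exact key _ _ f

theorem castId_comp_eq_castDeg {X Y : A.Obj} {z m n : ℤ} (hz : 0 = z) (h : z + m = n)
    (f : A.Hom X Y m) :
    A.comp h (A.castDeg hz (A.id Y)) f = A.castDeg (by omega) f := by
  subst hz
  obtain rfl : m = n := by omega
  exact A.id_comp h f

theorem comp_castId_eq_castDeg {X Y : A.Obj} {z m n : ℤ} (hz : 0 = z) (h : m + z = n)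
    (f : A.Hom X Y m) :
    A.comp h f (A.castDeg hz (A.id X)) = A.castDeg (by omega) f := by
  subst hz
  obtain rfl : m = n := by omega
  exact A.comp_id h f

section
variable {X Y : A.Obj} (f : A.Hom X Y 0) (hf : f ∈ A.cocycles X Y 0)

/-- The entrywise form of d i₁ = i₂ f: column 1 of the twist is f in row 0 and zero in row 1. -/
theorem castDeg_coneMatrix_right (x : Fin 2) {n : ℤ}
    (h : 1 + (![0, 1] : Fin 2 → ℤ) x - (![0, 1] : Fin 2 → ℤ) 1 = n)
    (h' : 0 + (![0, 1] : Fin 2 → ℤ) x - (![0, 1] : Fin 2 → ℤ) 0 + 0 = n) :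
    A.castDeg h (Tw.coneMatrix f x 1) = A.comp h' (twId (Tw.cone f hf) x (0 : Fin 2)) f := by
  match x with
  | 0 =>
    refine (GrCat.castDeg_castDeg _ _ _ f).trans (Eq.symm ?_)
    refine (congrArg (fun z => A.comp h' z f) (twId_self (Tw.cone f hf) (0 : Fin 2))).trans ?_
    exact castId_comp_eq_castDeg _ _ f
  | 1 =>
    refine (map_zero _).trans (Eq.symm ?_)
    refine (congrArg (fun z => A.comp h' z f) (twId_ne (Tw.cone f hf) (i := (1 : Fin 2))
      (j := (0 : Fin 2)) (Fin.zero_ne_one.symm))).trans ?_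
    exact LinearMap.congr_fun (map_zero (A.comp _)) f

/-- The entrywise form of d p₂ = -f p₁, apart from the sign. -/
theorem castDeg_coneMatrix_left (y : Fin 2) {n : ℤ}
    (h : 1 + (![0, 1] : Fin 2 → ℤ) 0 - (![0, 1] : Fin 2 → ℤ) y = n)
    (h' : 0 + (0 + (![0, 1] : Fin 2 → ℤ) 1 - (![0, 1] : Fin 2 → ℤ) y) = n) :
    A.castDeg h (Tw.coneMatrix f 0 y) = A.comp h' f (twId (Tw.cone f hf) (1 : Fin 2) y) := by
  match y with
  | 0 =>
    refine (map_zero _).trans (Eq.symm ?_)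
    refine (congrArg (fun z => A.comp h' f z) (twId_ne (Tw.cone f hf) (i := (1 : Fin 2))
      (j := (0 : Fin 2)) (Fin.zero_ne_one.symm))).trans ?_
    exact map_zero _
  | 1 =>
    refine (GrCat.castDeg_castDeg _ _ _ f).trans (Eq.symm ?_)
    refine (congrArg (fun z => A.comp h' f z) (twId_self (Tw.cone f hf) (1 : Fin 2))).trans ?_
    exact comp_castId_eq_castDeg _ _ f

/-- `Tw.cone f` is a cone of `f`. -/
def Tw.coneData :
    ConeData A.pretr (X₁ := Tw.of X) (X₂ := Tw.of Y) (Tw.ofHom f) (Tw.cone f hf) where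
  d_f := by
    refine (twD_ofHom (zero_add 1) f).trans ?_
    rw [(show A.d (zero_add 1) f = 0 from hf)]
    funext x y
    exact map_zero _
  i₁ := (Tw.cone f hf).inj (1 : Fin 2) (neg_add_cancel (1 : ℤ))
  i₂ := (Tw.cone f hf).inj (0 : Fin 2) (zero_add (0 : ℤ))
  p₁ := (Tw.cone f hf).proj (1 : Fin 2) rfl
  p₂ := (Tw.cone f hf).proj (0 : Fin 2) rfl
  d_i₁ := by
    funext x y
    have e₁ := twD_inj (Tw.cone f hf) (1 : Fin 2) (neg_add_cancel (1 : ℤ)) (neg_add_cancel 1) x y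
    have e₂ := inj_twComp_ofHom (Tw.cone f hf) (0 : Fin 2) f (zero_add (0 : ℤ)) (add_zero 0) x y
    exact e₁.trans ((castDeg_coneMatrix_right f hf x _ _).trans e₂.symm)
  d_i₂ := by
    funext x y
    refine (twD_inj (Tw.cone f hf) (0 : Fin 2) _ _ _ _).trans ?_
    exact (congrArg _ (Tw.coneMatrix_left f x)).trans (map_zero _)
  d_p₁ := twD_proj_eq_zero (Tw.cone f hf) (1 : Fin 2) _ _ (Tw.coneMatrix_right f)
  d_p₂ := by
    funext x y
    have e₁ := twD_proj (Tw.cone f hf) (0 : Fin 2) (l := 0) rfl (zero_add 1) x y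
    have e₂ := ofHom_twComp_proj (Tw.cone f hf) (1 : Fin 2) f (l := 1) rfl (zero_add 1) x y
    rw [sgn_zero, one_smul] at e₁
    exact e₁.trans (congrArg Neg.neg ((castDeg_coneMatrix_left f hf y _ _).trans e₂.symm))
  p₁_i₁ := proj_twComp_inj_self (Tw.cone f hf) (1 : Fin 2) _ _ (add_neg_cancel 1)
  p₁_i₂ := proj_twComp_inj_of_ne (Tw.cone f hf) (i := (1 : Fin 2)) (j := (0 : Fin 2))
    Fin.zero_ne_one.symm _ _ (add_zero 1)
  p₂_i₁ := proj_twComp_inj_of_ne (Tw.cone f hf) (i := (0 : Fin 2)) (j := (1 : Fin 2))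
    Fin.zero_ne_one _ _ (zero_add (-1))
  p₂_i₂ := proj_twComp_inj_self (Tw.cone f hf) (0 : Fin 2) _ _ (add_zero 0)

end

end twCone

/-! ### Functoriality of twisted complexes -/

section pretrFunctor
variable {k : Type w} [CommRing k] {A : DGCat.{u, v, w} k} {B : DGCat.{u', v', w} k}
  {φ : A.Obj → B.Obj}

/-- `Tw.ofHom` as a linear map. -/
def Tw.ofHomLinear (X Y : A.Obj) (n : ℤ) : A.Hom X Y n →ₗ[k] TwHom (Tw.of X) (Tw.of Y) n where
  toFun := Tw.ofHom
  map_add' f g := by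
    funext x y
    exact map_add _ _ _
  map_smul' c f := by
    funext x y
    exact map_smul _ _ _

/-- The embedding of `A` into its twisted complexes. -/
def GrFunctor.toPretr (A : DGCat.{u, v, w} k) : GrFunctor A.toGrCat A.pretr.toGrCat Tw.of where
  map {X Y} n := Tw.ofHomLinear X Y n
  map_id X := by
    funext x y
    obtain rfl : x = y := Subsingleton.elim (α := Fin 1) x y
    change Tw.ofHom (A.id X) x x = twId (Tw.of X) x x
    exact (twId_self (Tw.of X) x).symm
  map_comp {X Y Z p q n} h b a := by
    funext x y
    refine (GrCat.castDeg_comp _ _ _ _ _).trans (Eq.symm ?_)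
    refine (Fin.sum_univ_one fun z : Fin 1 => A.comp _ (Tw.ofHom b x z) (Tw.ofHom a z y)).trans ?_
    exact (A.comp_castDeg_left _ _ _ _).trans (A.comp_castDeg_right _ _ _ _)

theorem Tw.ofHom_bijective {X Y : A.Obj} {n : ℤ} :
    Function.Bijective (Tw.ofHom : A.Hom X Y n → _) where
  left _ _ h := (GrCat.castDeg_bijective _ _).1 (congrFun (congrFun h (0 : Fin 1)) (0 : Fin 1))
  right q := by
    obtain ⟨f, hf⟩ := (GrCat.castDeg_bijective _ _).2 (q (0 : Fin 1) (0 : Fin 1))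
    refine ⟨f, ?_⟩
    funext x y
    obtain rfl : x = (0 : Fin 1) := Subsingleton.elim (α := Fin 1) _ _
    obtain rfl : y = (0 : Fin 1) := Subsingleton.elim (α := Fin 1) _ _
    exact hf

/-- The image of the graded object underlying a twisted complex. -/
def Tw.graded (φ : A.Obj → B.Obj) (T : Tw A) : Tw B where
  n := T.n
  C := φ ∘ T.C
  r := T.r
  -- A graded functor need not preserve the Maurer–Cartan equation, so the twist is discarded. Only
  -- the graded structure of the target is used.
  q _ _ := 0
  upper _ _ _ := rfl
  maurerCartan _ _ := by simp

theorem GrFunctor.map_twId (F : GrFunctor A.toGrCat B.toGrCat φ) (T : Tw A) (i j : Fin T.n) :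
    F.map _ (twId T i j) = twId (T.graded φ) i j := by
  by_cases hij : i = j
  · subst hij
    refine (congrArg _ (twId_self T i)).trans (Eq.trans ?_ (twId_self (T.graded φ) i).symm)
    exact (F.map_castDeg _ _).trans (congrArg _ (F.map_id _))
  · refine (congrArg _ (twId_ne T hij)).trans (Eq.trans ?_ (twId_ne (T.graded φ) hij).symm)
    exact map_zero _

/-- The action of a graded functor on the entries of a morphism of twisted complexes. -/
def GrFunctor.mapMatrix (F : GrFunctor A.toGrCat B.toGrCat φ) (T T' : Tw A) (n : ℤ) :
    TwHom T T' n →ₗ[k] TwHom (T.graded φ) (T'.graded φ) n where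
  toFun f i j := F.map _ (f i j)
  map_add' f g := by
    funext i j
    exact map_add _ _ _
  map_smul' c f := by
    funext i j
    exact map_smul _ _ _

/-- The extension of a graded functor to graded objects underlying twisted complexes. -/
def GrFunctor.pretr (F : GrFunctor A.toGrCat B.toGrCat φ) :
    GrFunctor A.pretr.toGrCat B.pretr.toGrCat (Tw.graded φ) where
  map {T T'} n := F.mapMatrix T T' n
  map_id T := by
    funext i j
    exact F.map_twId T i j
  map_comp h b a := by
    funext i j
    refine (congrArg (F.map _) (twComp_apply h b a i j)).trans ((map_sum (F.map _) _ _).trans ?_)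
    refine (Finset.sum_congr rfl fun x _ => F.map_comp _ _ _).trans ?_
    exact (twComp_apply h (F.mapMatrix _ _ _ b) (F.mapMatrix _ _ _ a) i j).symm

theorem GrFunctor.pretr_inj (F : GrFunctor A.toGrCat B.toGrCat φ) (T : Tw A) (j : Fin T.n) {l : ℤ}
    (h : l + T.r j = 0) : F.pretr.map l (T.inj j h) = (T.graded φ).inj j h := by
  funext x y
  exact (F.map_castDeg _ _).trans (congrArg _ (F.map_twId T x j))

theorem GrFunctor.pretr_proj (F : GrFunctor A.toGrCat B.toGrCat φ) (T : Tw A) (i : Fin T.n) {l : ℤ}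
    (h : l = T.r i) : F.pretr.map l (T.proj i h) = (T.graded φ).proj i h := by
  funext x y
  exact (F.map_castDeg _ _).trans (congrArg _ (F.map_twId T i y))

theorem GrFunctor.pretr_ofHom (F : GrFunctor A.toGrCat B.toGrCat φ) {X Y : A.Obj} {n : ℤ}
    (f : A.Hom X Y n) : F.pretr.map n (Tw.ofHom f) = Tw.ofHom (F.map n f) := by
  funext x y
  exact F.map_castDeg _ _

end pretrFunctor

/-! ### Generation of the morphisms of a DG quotient -/

section splitting
variable {k : Type w} [CommRing k]

/-- A decomposition of an object of a graded category into shifts of objects in the image of `o`. -/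
structure GrCat.Splitting (B : GrCat.{u, v, w} k) {V : Type u'} (o : V → B.Obj) (T : B.Obj) where
  ι : Type
  [fintype : Fintype ι]
  C : ι → V
  s : ι → ℤ
  r : ι → ℤ
  s_add_r : ∀ x, s x + r x = 0
  inj : ∀ x, B.Hom (o (C x)) T (s x)
  proj : ∀ x, B.Hom T (o (C x)) (r x)
  sum_inj_proj : ∑ x, B.comp (s_add_r x) (inj x) (proj x) = B.id T

attribute [instance] GrCat.Splitting.fintype

/-- The image of a splitting under a graded functor. -/
def GrCat.Splitting.map {B : GrCat.{u, v, w} k} {C : GrCat k} {V : Type u'} {o : V → B.Obj}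
    {T : B.Obj} (D : B.Splitting o T) {φ : B.Obj → C.Obj} (F : GrFunctor B C φ) :
    C.Splitting (φ ∘ o) (φ T) where
  ι := D.ι
  C := D.C
  s := D.s
  r := D.r
  s_add_r := D.s_add_r
  inj x := F.map _ (D.inj x)
  proj x := F.map _ (D.proj x)
  sum_inj_proj := by
    rw [← F.map_id, ← D.sum_inj_proj, map_sum]
    exact Finset.sum_congr rfl fun x _ => (F.map_comp _ _ _).symm

variable {B : GrCat.{u, v, w} k} {V : Type u'} {o : V → B.Obj}
  (R : ∀ (X Y : V) (n : ℤ), Submodule k (B.Hom (o X) (o Y) n))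

/-- All the components of a morphism between objects with splittings belong to `R`. -/
def GrCat.Splitting.Mem {T T' : B.Obj} (D : B.Splitting o T) (D' : B.Splitting o T') {n : ℤ}
    (q : B.Hom T T' n) : Prop :=
  ∀ (i : D'.ι) (j : D.ι), B.comp (rfl : D'.r i + n + D.s j = _)
    (B.comp rfl (D'.proj i) q) (D.inj j) ∈ R (D.C j) (D'.C i) _

variable {R}

theorem GrCat.Splitting.Mem.add {T T' : B.Obj} {D : B.Splitting o T} {D' : B.Splitting o T'}
    {n : ℤ} {q q' : B.Hom T T' n} (h : D.Mem R D' q) (h' : D.Mem R D' q') :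
    D.Mem R D' (q + q') := fun i j => by
  rw [map_add, map_add, LinearMap.add_apply]
  exact add_mem (h i j) (h' i j)

theorem GrCat.Splitting.Mem.smul {T T' : B.Obj} {D : B.Splitting o T} {D' : B.Splitting o T'}
    {n : ℤ} {q : B.Hom T T' n} (c : k) (h : D.Mem R D' q) : D.Mem R D' (c • q) := fun i j => by
  rw [map_smul, map_smul, LinearMap.smul_apply]
  exact Submodule.smul_mem _ _ (h i j)

/-- Matrix multiplication: each component of b ∘ a is a sum of composites of a component of b with a
component of a. -/
theorem GrCat.Splitting.Mem.comp
    (hR : ∀ {X Y Z : V} {p q n : ℤ} (h : p + q = n) {b a}, b ∈ R Y Z p → a ∈ R X Y q →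
      B.comp h b a ∈ R X Z n)
    {T T' T'' : B.Obj} {D : B.Splitting o T} {D' : B.Splitting o T'} {D'' : B.Splitting o T''}
    {p q n : ℤ} (h : p + q = n) {b : B.Hom T' T'' p} {a : B.Hom T T' q} (hb : D'.Mem R D'' b)
    (ha : D.Mem R D' a) : D.Mem R D'' (B.comp h b a) := fun i j => by
  rw [B.comp_eq_sum D'.s_add_r D'.inj D'.proj D'.sum_inj_proj]
  exact Submodule.sum_mem _ fun x _ => hR _ (hb i x) (ha x j)

theorem GrCat.Splitting.eq_sum_comp {T T' : B.Obj} (D : B.Splitting o T) {n : ℤ}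
    (q : B.Hom T T' n) :
    q = ∑ j, B.comp (by linear_combination D.s_add_r j) (B.comp (rfl : n + D.s j = _) q (D.inj j))
      (D.proj j) := by
  conv_lhs => rw [← B.comp_id (add_zero n) q, ← D.sum_inj_proj, map_sum]
  exact Finset.sum_congr rfl fun j _ => (B.assoc _ _ _ _ _ _ _).symm

/-- A morphism is recovered from its components as Σ inj ∘ component ∘ proj. For objects in the
image of `o` the outer factors are assumed to lie in `R`. -/
theorem GrCat.Splitting.Mem.mem
    (hR : ∀ {X Y Z : V} {p q n : ℤ} (h : p + q = n) {b a}, b ∈ R Y Z p → a ∈ R X Y q →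
      B.comp h b a ∈ R X Z n)
    {X Y : V} {D : B.Splitting o (o X)} {D' : B.Splitting o (o Y)}
    (hD : ∀ x, D.proj x ∈ R _ _ _) (hD' : ∀ x, D'.inj x ∈ R _ _ _) {n : ℤ}
    {q : B.Hom (o X) (o Y) n} (h : D.Mem R D' q) : q ∈ R X Y n := by
  have e : q = ∑ i, ∑ j, B.comp (by linear_combination D'.s_add_r i) (D'.inj i)
      (B.comp (by linear_combination D.s_add_r j : D'.r i + n + D.s j + D.r j = D'.r i + n)
        (B.comp rfl (B.comp rfl (D'.proj i) q) (D.inj j)) (D.proj j)) := by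
    conv_lhs => rw [← B.id_comp (zero_add n) q, ← D'.sum_inj_proj, map_sum, LinearMap.sum_apply]
    refine Finset.sum_congr rfl fun i _ => ?_
    rw [B.assoc (hqr := rfl) (ht := by linear_combination D'.s_add_r i),
      ← map_sum, ← D.eq_sum_comp]
  rw [e]
  exact Submodule.sum_mem _ fun i _ => Submodule.sum_mem _ fun j _ =>
    hR _ (hD' i) (hR _ (h i j) (hD j))

/-- A graded subcategory of a DG quotient contains all morphisms between objects in the image of
`o` if it contains the components of the morphisms of `A` and of the `ε_U`. -/
theorem QHom.mem_of_splitting {A : DGCat.{u, v, w} k} {S : Set A.Obj} {V : Type u'}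
    {o : V → A.Obj} {R : ∀ (X Y : V) (n : ℤ), Submodule k (QHom A S (o X) (o Y) n)}
    (hR : ∀ {X Y Z : V} {p q n : ℤ} (h : p + q = n) {b a}, b ∈ R Y Z p → a ∈ R X Y q →
      QHom.comp h b a ∈ R X Z n)
    (D : ∀ T : A.Obj, A.toGrCat.Splitting o T)
    (hof : ∀ {X Y : V} {n : ℤ} (f : A.Hom (o X) (o Y) n), QHom.of S f ∈ R X Y n)
    (heps : ∀ (U : A.Obj) (hU : U ∈ S),
      ((D U).map (GrFunctor.toQuotient A S)).Mem R ((D U).map (GrFunctor.toQuotient A S))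
        (QHom.eps U hU))
    {X Y : V} {n : ℤ} (q : QHom A S (o X) (o Y) n) : q ∈ R X Y n := by
  have key : ∀ {T T' : A.Obj} {n : ℤ} (a : Expr A S T T' n),
      ((D T).map (GrFunctor.toQuotient A S)).Mem R ((D T').map (GrFunctor.toQuotient A S))
        (QHom.mk a) := by
    intro T T' n a
    induction a with
    | of f =>
      intro i j
      -- The splittings come from A, so a component of a morphism of A is again a morphism of A
      -- between objects in the image of `o`.
      refine (congrArg (· ∈ R _ _ _) ?_).mp (hof (A.comp rfl (A.comp rfl ((D _).proj i) f)
        ((D _).inj j)))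
      exact (QHom.of_comp _ _ _).trans (congrArg (fun z => QHom.comp rfl z _)
        (QHom.of_comp _ _ _))
    | eps U hU => exact heps U hU
    | comp h b a ihb iha => exact ihb.comp hR h iha
    | add a b iha ihb => exact iha.add ihb
    | smul c a iha => exact iha.smul c
  obtain ⟨a, rfl⟩ := QHom.exists_mk q
  exact (key a).mem hR (fun _ => hof _) (fun _ => hof _)

/-- The splitting of a twisted complex. -/
def Tw.splitting {A : DGCat.{u, v, w} k} (T : A.pretr.Obj) :
    A.pretr.toGrCat.Splitting Tw.of T where
  ι := Fin (Tw.n T)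
  C := Tw.C T
  s x := -Tw.r T x
  r := Tw.r T
  s_add_r _ := neg_add_cancel _
  inj x := Tw.inj T x (neg_add_cancel _)
  proj x := Tw.proj T x rfl
  sum_inj_proj := sum_inj_proj T fun _ => neg_add_cancel _

end splitting

/-! ### `K` as a full subcategory of the DG quotient -/

section quotientFunctor
variable {k : Type w} [CommRing k]

/-- The DG functor from `A` to its DG quotient. -/
def DGFunctor.toQuotient (A : DGCat.{u, v, w} k) (S : Set A.Obj) :
    DGFunctor A (A.quotient S) id where
  map _ := QHom.of S
  map_id _ := rfl
  map_comp := QHom.of_comp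
  map_d _ _ := rfl

/-- The morphisms in the image of a DG functor. -/
def DGFunctor.range {A : DGCat.{u, v, w} k} {B : DGCat.{u', v', w} k} {φ : A.Obj → B.Obj}
    (F : DGFunctor A B φ) (X Y : A.Obj) (n : ℤ) : Submodule k (B.Hom (φ X) (φ Y) n) :=
  LinearMap.range (F.map n)

theorem DGFunctor.mem_range_of_map_eq_neg {A : DGCat.{u, v, w} k} {B : DGCat.{u', v', w} k}
    {φ : A.Obj → B.Obj} (F : DGFunctor A B φ) {X Y : A.Obj} {n : ℤ} {x : A.Hom X Y n}
    {y : B.Hom (φ X) (φ Y) n} (h : F.map n x = -y) : y ∈ F.range X Y n :=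
  ⟨-x, by rw [map_neg, h, neg_neg]⟩

/-- The endomorphism of degree `-1` of `Y ⊕ X[1]` with given components. -/
def GrCat.coneEnd (B : GrCat.{u, v, w} k) {X Y : B.Obj} (α₂ : B.Hom Y Y (-1)) (u : B.Hom X Y (-2))
    (g : B.Hom Y X 0) (α₁ : B.Hom X X (-1)) (i j : Fin 2) :
    B.Hom ((![Y, X] : Fin 2 → B.Obj) j) ((![Y, X] : Fin 2 → B.Obj) i)
      (-1 + (![0, 1] : Fin 2 → ℤ) i - (![0, 1] : Fin 2 → ℤ) j) :=
  match i, j with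
  -- Index 0 is Y and index 1 is X[1]. The signs undo those in `ConeData.functor`.
  | 0, 0 => B.castDeg (by simp) (-α₂)
  | 0, 1 => B.castDeg (by simp) (-u)
  | 1, 0 => B.castDeg (by simp) g
  | 1, 1 => B.castDeg (by simp) α₁

/-- The graded functor from a DG quotient by one object. -/
def GrFunctor.ofQuotientSingleton {A : DGCat.{u, v, w} k} {B : GrCat.{u', v', w} k}
    {φ : A.Obj → B.Obj} (F : GrFunctor A.toGrCat B φ) (U : A.Obj)
    (e : B.Hom (φ U) (φ U) (-1)) : GrFunctor (A.quotient {U}).toGrCat B φ :=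
  GrFunctor.ofQuotient F fun V hV =>
    have h : U = V := hV.symm
    h ▸ e

/-- The extension of `F` to matrices preserves inclusions and projections, so the (i, j) component
of ε is sent to the (i, j) entry of the chosen matrix `e`. -/
theorem GrFunctor.ofQuotientSingleton_component {A : DGCat.{u, v, w} k} {B : DGCat.{u', v', w} k}
    {φ : A.Obj → B.Obj} (F : GrFunctor A.toGrCat B.toGrCat φ) (U : A.pretr.Obj)
    (e : B.pretr.Hom (Tw.graded φ U) (Tw.graded φ U) (-1))
    (i j : Fin (Tw.n U)) {l m s n : ℤ} (hi : l = Tw.r U i) (hj : s + Tw.r U j = 0)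
    (hm : l + -1 = m) (h : m + s = n) (hn : -1 + Tw.r U i - Tw.r U j = n) :
    (GrFunctor.ofQuotientSingleton F.pretr U e).map n (QHom.comp h (QHom.comp hm
      (QHom.of {U} (Tw.proj U i hi)) (QHom.eps U rfl)) (QHom.of {U} (Tw.inj U j hj))) =
    Tw.ofHom (B.castDeg hn (e i j)) := by
  refine (congrArg₂ (fun p q => twComp h (twComp hm p e) q) (F.pretr_proj U i hi)
    (F.pretr_inj U j hj)).trans ?_
  funext x y
  exact (proj_twComp_inj (T := Tw.graded φ U) (T' := Tw.graded φ U) e i j hi hj hm h x y).trans (B.castDeg_castDeg _ _ _).symm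

theorem GrFunctor.map_neg_eq {A : GrCat.{u, v, w} k} {B : GrCat.{u', v', w} k}
    {φ : A.Obj → B.Obj} (F : GrFunctor A B φ) {X Y : A.Obj} {n : ℤ} {x : A.Hom X Y n}
    {y : B.Hom (φ X) (φ Y) n} (h : F.map n x = y) : F.map n (-x) = -y := by
  rw [map_neg, h]

theorem Tw.neg_ofHom_neg {A : DGCat.{u, v, w} k} {X Y : A.Obj} {n : ℤ} (f : A.Hom X Y n) :
    -Tw.ofHom (-f) = Tw.ofHom f :=
  neg_eq_iff_eq_neg.mpr (map_neg (Tw.ofHomLinear X Y n) f)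

theorem DGFunctor.FullyFaithful.isFreeGenerator {A : DGCat.{u, v, w} k} {B : DGCat.{u', v', w} k}
    {φ : A.Obj → B.Obj} {F : DGFunctor A B φ} (hF : F.FullyFaithful) {X Y : A.Obj} {n : ℤ}
    {x : A.cocycles X Y n} (hx : IsFreeGenerator k (A.cls x)) {y : B.Hom (φ X) (φ Y) n}
    (hxy : F.map n x.1 = y) (hy : y ∈ B.cocycles (φ X) (φ Y) n) :
    IsFreeGenerator k (B.cls ⟨y, hy⟩) := by
  subst hxy
  exact hx.map (hF.mapExt_bijective X Y n)

/-! ### The functor K → A/B is fully faithful -/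

variable (k)

/-- The cone data of `Cone(f)` in the DG quotient. -/
def AmodB.coneData : ConeData (AmodB k) (X₁ := AmodB.X k x₁) (X₂ := AmodB.X k x₂) (AmodB.f k)
    (A.cone k) :=
  (Tw.coneData (A₀.f k) (A₀.f_closed k)).map (DGFunctor.toQuotient (A k) {A.cone k})

/-- The morphism `ε` of the DG quotient. -/
def AmodB.ε : (AmodB k).Hom (A.cone k) (A.cone k) (-1) := QHom.eps (A.cone k) rfl

/-- The DG functor from `K` to the DG quotient. -/
def K.toAmodB : DGFunctor (K k) (AmodB k) (AmodB.X k) :=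
  -- dε = id holds by definition of the differential of the quotient.
  (AmodB.coneData k).functor (X := AmodB.X k) (AmodB.ε k) rfl

theorem K.toAmodB_f : (K.toAmodB k).map 0 (K.gen k .f) = AmodB.f k :=
  freeEval_gen _ _ KGen.f _

theorem K.toAmodB_g : (K.toAmodB k).map 0 (K.gen k .g) =
    (AmodB k).comp (add_zero 0) ((AmodB k).comp (add_neg_cancel 1) (AmodB.coneData k).p₁
      (AmodB.ε k)) (AmodB.coneData k).i₂ :=
  freeEval_gen _ _ KGen.g _

theorem K.toAmodB_α₁ : (K.toAmodB k).map (-1) (K.gen k .α₁) =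
    (AmodB k).comp (zero_add (-1)) ((AmodB k).comp (add_neg_cancel 1) (AmodB.coneData k).p₁
      (AmodB.ε k)) (AmodB.coneData k).i₁ :=
  freeEval_gen _ _ KGen.α₁ _

theorem K.toAmodB_α₂ : (K.toAmodB k).map (-1) (K.gen k .α₂) =
    -(AmodB k).comp (add_zero (-1)) ((AmodB k).comp (zero_add (-1)) (AmodB.coneData k).p₂
      (AmodB.ε k)) (AmodB.coneData k).i₂ :=
  freeEval_gen _ _ KGen.α₂ _

theorem K.toAmodB_u : (K.toAmodB k).map (-2) (K.gen k .u) =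
    -(AmodB k).comp (by norm_num) ((AmodB k).comp (zero_add (-1)) (AmodB.coneData k).p₂
      (AmodB.ε k)) (AmodB.coneData k).i₁ :=
  freeEval_gen _ _ KGen.u _

/-- The inclusion of `A₀` into `K`, as a graded functor. -/
def A₀.toK : GrFunctor (A₀ k).toGrCat (K k).toGrCat id :=
  GrFunctor.ofFree (K k).toGrCat fun a b (e : ArrowGen a b) => match a, b, e with
    | _, _, .f => K.gen k .f

theorem A₀.toK_f : (A₀.toK k).map 0 (A₀.f k) = K.gen k .f :=
  freeEval_gen _ _ ArrowGen.f _

/-- `A₀ → K → A/B` is the canonical functor. -/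
theorem K.toAmodB_toK {a b : Two} {n : ℤ} (h : (A₀ k).Hom a b n) :
    (K.toAmodB k).map n ((A₀.toK k).map n h) =
      QHom.of (A := A k) {A.cone k} (Tw.ofHom h) := by
  refine GrFunctor.ext_free ((K.toAmodB k).toGrFunctor.comp (A₀.toK k))
    ((GrFunctor.toQuotient (A k) {A.cone k}).comp (GrFunctor.toPretr (A₀ k))) ?_ h
  intro a b e he
  cases e
  exact (congrArg ((K.toAmodB k).map 0) (A₀.toK_f k)).trans (K.toAmodB_f k)

/-- The image is closed under composition. It contains the morphisms of A between X₁ and X₂, since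
these come from `A₀` and A₀ → A/B factors through `K`, and it contains the components of ε; so it is
everything. -/
theorem K.toAmodB_surjective (a b : (K k).Obj) (n : ℤ) :
    Function.Surjective ((K.toAmodB k).map (X := a) (Y := b) n) := by
  intro q
  refine QHom.mem_of_splitting (A := A k) (S := {A.cone k}) (o := AmodB.X k)
    (R := (K.toAmodB k).range) ?_
    Tw.splitting ?_ ?_ q
  · rintro X Y Z p q n h _ _ ⟨b, rfl⟩ ⟨a, rfl⟩
    exact ⟨_, (K.toAmodB k).map_comp h b a⟩
  · intro X Y n f
    obtain ⟨f, rfl⟩ := Tw.ofHom_bijective.2 f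
    exact ⟨_, K.toAmodB_toK k f⟩
  · rintro U hU
    obtain rfl : U = A.cone k := hU
    intro i j
    -- The four entries of ε are, up to sign, the images of α₂, u, g and α₁.
    match i, j with
    | (0 : Fin 2), (0 : Fin 2) => exact DGFunctor.mem_range_of_map_eq_neg _ (K.toAmodB_α₂ k)
    | (0 : Fin 2), (1 : Fin 2) => exact DGFunctor.mem_range_of_map_eq_neg _ (K.toAmodB_u k)
    | (1 : Fin 2), (0 : Fin 2) => exact ⟨K.gen k .g, K.toAmodB_g k⟩
    | (1 : Fin 2), (1 : Fin 2) => exact ⟨K.gen k .α₁, K.toAmodB_α₁ k⟩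

/-- The graded object underlying the image of `Cone(f)` in the twisted complexes over `K`. -/
def K.cone : (K k).pretr.Obj := Tw.graded (A := A₀ k) (B := K k) id (A.cone k)

/-- The value of `ε` in the graded category of twisted complexes over `K`. -/
def K.ε : (K k).pretr.Hom (K.cone k) (K.cone k) (-1) :=
  fun i j => (K k).toGrCat.coneEnd (X := x₁) (Y := x₂) (K.gen k .α₂) (K.gen k .u) (K.gen k .g)
    (K.gen k .α₁) i j

/-- The graded functor from `A/B` to the graded category of twisted complexes over `K`. -/
def AmodB.toPretr : GrFunctor (AmodB k).toGrCat (K k).pretr.toGrCat (Tw.graded (A := A₀ k) id) :=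
  GrFunctor.ofQuotientSingleton (A₀.toK k).pretr (A.cone k) (K.ε k)

theorem AmodB.toPretr_component (i j : Fin 2) {l m s n : ℤ} (hi : l = (![0, 1] : Fin 2 → ℤ) i)
    (hj : s + (![0, 1] : Fin 2 → ℤ) j = 0) (hm : l + -1 = m) (h : m + s = n)
    (hn : -1 + (![0, 1] : Fin 2 → ℤ) i - (![0, 1] : Fin 2 → ℤ) j = n) :
    (AmodB.toPretr k).map n ((AmodB k).comp h ((AmodB k).comp hm
      (QHom.of {A.cone k} (Tw.proj (A.cone k) i hi) : (AmodB k).Hom (A.cone k) _ l) (AmodB.ε k))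
      (QHom.of {A.cone k} (Tw.inj (A.cone k) j hj) : (AmodB k).Hom _ (A.cone k) s)) =
    Tw.ofHom ((K k).castDeg hn (K.ε k i j)) :=
  GrFunctor.ofQuotientSingleton_component (A₀.toK k) (A.cone k) (K.ε k) i j hi hj hm h hn

/-- By freeness of `K` five arrows have to be checked. For f the functor on `A₀` is used, for the
others an entry of the matrix of ε. Since `Tw.ofHom` is injective, so is K → A/B. -/
theorem AmodB.toPretr_toAmodB {a b : (K k).Obj} {n : ℤ} (x : (K k).Hom a b n) :
    (AmodB.toPretr k).map n ((K.toAmodB k).map n x) = Tw.ofHom x := by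
  refine GrFunctor.ext_free ((AmodB.toPretr k).comp (K.toAmodB k).toGrFunctor)
    (GrFunctor.toPretr (K k)) ?_ x
  intro a b e he
  cases e
  · refine (congrArg ((AmodB.toPretr k).map 0) (K.toAmodB_f k)).trans ?_
    refine ((A₀.toK k).pretr_ofHom (A₀.f k)).trans ?_
    exact congrArg Tw.ofHom (A₀.toK_f k)
  · refine (congrArg ((AmodB.toPretr k).map 0) (K.toAmodB_g k)).trans ?_
    exact AmodB.toPretr_component k 1 0 rfl rfl _ _ rfl
  · refine (congrArg ((AmodB.toPretr k).map (-1)) (K.toAmodB_α₁ k)).trans ?_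
    exact AmodB.toPretr_component k 1 1 rfl rfl _ _ rfl
  · refine (congrArg ((AmodB.toPretr k).map (-1)) (K.toAmodB_α₂ k)).trans ?_
    -- α₂ goes to -p₂ ε i₂, and the corresponding matrix entry is -α₂: the signs cancel. The same
    -- happens for u.
    refine ((AmodB.toPretr k).map_neg_eq
      (AmodB.toPretr_component k 0 0 rfl rfl _ _ rfl)).trans ?_
    exact Tw.neg_ofHom_neg (A := K k) (K.gen k .α₂)
  · refine (congrArg ((AmodB.toPretr k).map (-2)) (K.toAmodB_u k)).trans ?_
    refine ((AmodB.toPretr k).map_neg_eq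
      (AmodB.toPretr_component k 0 1 rfl rfl _ _ rfl)).trans ?_
    exact Tw.neg_ofHom_neg (A := K k) (K.gen k .u)

theorem K.toAmodB_injective (a b : (K k).Obj) (n : ℤ) :
    Function.Injective ((K.toAmodB k).map (X := a) (Y := b) n) := fun x y h =>
  Tw.ofHom_bijective.1 (((AmodB.toPretr_toAmodB k x).symm.trans
    (congrArg ((AmodB.toPretr k).map n) h)).trans (AmodB.toPretr_toAmodB k y))

theorem K.toAmodB_fullyFaithful : (K.toAmodB k).FullyFaithful := fun a b n =>
  ⟨K.toAmodB_injective k a b n, K.toAmodB_surjective k a b n⟩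

theorem K.toAmodB_arrow_self (a : Two) :
    (K.toAmodB k).map 0 (K.arrow k a a).1 = (AmodB k).id (AmodB.X k a) := by
  cases a <;> exact (K.toAmodB k).map_id _

/-- The homotopies α₁ and α₂ of `K` are carried over by the DG functor, so a homotopy inverse of f
in `A/B` is the image of g. -/
theorem AmodB.isHoInverse : (AmodB k).IsHoInverse (AmodB.f k)
    ((K.toAmodB k).map 0 (K.arrow k x₂ x₁).1) :=
  have h := (K.isHoInverse k).map (K.toAmodB k)
  have e : (K.toAmodB k).map 0 (K.arrow k x₁ x₂).1 = AmodB.f k := K.toAmodB_f k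
  e ▸ h

end quotientFunctor

end DG

end

theorem corollary3p7p3 (k : Type w) [CommRing k] :
    -- `K` is a resolution of `I₂`
    (∃ F : DG.DGFunctor (DG.K k) (DG.I₂ k) id,
      F.map 0 (DG.K.gen k DG.KGen.f) = DG.I₂.arrow k DG.Two.x₁ DG.Two.x₂ ∧
      F.map 0 (DG.K.gen k DG.KGen.g) = DG.I₂.arrow k DG.Two.x₂ DG.Two.x₁ ∧
      DG.DGFunctor.IsResolution.{0, w, w, 0, w, 0} F) ∧
    -- `K` is the full DG subcategory of `A/B` with the objects `X₁` and `X₂`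
    (∃ Φ : DG.DGFunctor (DG.K k) (DG.AmodB k) (DG.AmodB.X k),
      Φ.map 0 (DG.K.gen k DG.KGen.f) = DG.AmodB.f k ∧ Φ.FullyFaithful) ∧
    -- the Ext groups in `A/B`
    (∀ (a b : DG.Two) (n : ℤ), n ≠ 0 →
      Subsingleton ((DG.AmodB k).Ext (DG.AmodB.X k a) (DG.AmodB.X k b) n)) ∧
    (∀ a : DG.Two, DG.IsFreeGenerator k
      ((DG.AmodB k).cls ⟨_, (DG.AmodB k).id_mem_cocycles (DG.AmodB.X k a)⟩)) ∧
    (∃ (hf : DG.AmodB.f k ∈ (DG.AmodB k).cocycles (DG.AmodB.X k DG.Two.x₁) (DG.AmodB.X k DG.Two.x₂) 0)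
      (g : (DG.AmodB k).Hom (DG.AmodB.X k DG.Two.x₂) (DG.AmodB.X k DG.Two.x₁) 0)
      (hg : g ∈ (DG.AmodB k).cocycles (DG.AmodB.X k DG.Two.x₂) (DG.AmodB.X k DG.Two.x₁) 0),
      (DG.AmodB k).IsHoInverse (DG.AmodB.f k) g ∧
      DG.IsFreeGenerator k ((DG.AmodB k).cls ⟨DG.AmodB.f k, hf⟩) ∧
      DG.IsFreeGenerator k ((DG.AmodB k).cls ⟨g, hg⟩)) := by
  have hΦ := DG.K.toAmodB_fullyFaithful k
  have h := DG.AmodB.isHoInverse k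
  -- The inverse g required in the last clause is left to unification with `h`: it is the image of
  -- the arrow g of `K`.
  refine ⟨⟨DG.K.toI₂ k, DG.K.toI₂_arrow k .x₁ .x₂, DG.K.toI₂_arrow k .x₂ .x₁, DG.K.isResolution k⟩,
    ⟨DG.K.toAmodB k, DG.K.toAmodB_f k, hΦ⟩, fun a b n hn => ?_, fun a => ?_,
    h.closed_left, _, h.closed_right, h, ?_, ?_⟩
  · have := DG.K.subsingleton_ext k a b hn
    exact (hΦ.mapExt_bijective a b n).2.subsingleton
  · exact hΦ.isFreeGenerator (DG.K.isFreeGenerator k a a) (DG.K.toAmodB_arrow_self k a) _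
  · exact hΦ.isFreeGenerator (DG.K.isFreeGenerator k .x₁ .x₂) (DG.K.toAmodB_f k) _
  · exact hΦ.isFreeGenerator (DG.K.isFreeGenerator k .x₂ .x₁) rfl _
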